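/- **Setting.** Let $(V,Y,\mathbf 1,\omega)$ be a vertex operator algebra over $\mathbb C$ ($\mathbb Z$-graded by the eigenvalues of $L(0)$, with finite-dimensional weight spaces that vanish for sufficiently negative weights), $Y(v,z)=\sum_{n\in\mathbb Z}v_nz^{-n-1}$, and let $g$ be an automorphism of $V$ of finite order $T$. For $0\le r<T$ put $V^r=\{v: gv=e^{2\pi i r/T}v\}$, $\delta_0=1$, and $\delta_r=0$ for $r\neq0$. *The algebra $A_g(V)$.* For homogeneous $u\in V^r$ and $v\in V$ let $$u\circ_g v=\operatorname{Res}_z\frac{(1+z)^{\mathrm{wt}\,u-1+\delta_r+r/T}}{z^{1+\delta_r}}Y(u,z)v,$$ and let $u*_gv=\operatorname{Res}_z\frac{(1+z)^{\mathrm{wt}\,u}}{z}Y(u,z)v$ if $r=0$ and $u*_gv=0$ if $r>0$. Let $O_g(V)$ be the span of all $u\circ_gv$. Then $A_g(V)=V/O_g(V)$ is an associative algebra under $*_g$, with unit the class of $\mathbf 1$; modules over it are unital. *Twisted modules.* A weak $g$-twisted $V$-module is a complex vector space $M$ with a linear map $v\mapsto Y_M(v,z)=\sum_{n\in\mathbb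 Q}v_nz^{-n-1}$, $v_n\in\operatorname{End}M$, such that: for $u\in V^r$ only $n\in\frac rT+\mathbb Z$ occur; $v_lw=0$ for $l\gg0$ ($v\in V$, $w\in M$); $Y_M(\mathbf 1,z)=1$; and for $u\in V^r$, $v\in V$ the twisted Jacobi identity holds: $$z_0^{-1}\delta\Big(\tfrac{z_1-z_2}{z_0}\Big)Y_M(u,z_1)Y_M(v,z_2)-z_0^{-1}\delta\Big(\tfrac{z_2-z_1}{-z_0}\Big)Y_M(v,z_2)Y_M(u,z_1)=z_2^{-1}\Big(\tfrac{z_1-z_0}{z_2}\Big)^{-r/T}\delta\Big(\tfrac{z_1-z_0}{z_2}\Big)Y_M(Y(u,z_0)v,z_2).$$ A morphism of such modules is a linear map $f$ with $fY_M(u,z)=Y_N(u,z)f$ for all $u\in V$. The module $M$ is admissible if it carries a grading $M=\bigoplus_{n\in\frac1T\mathbb Z_{\ge0}}M(n)$ with $v_mM(n)\subseteq M(n+\mathrm{wt}\,v-m-1)$ for homogeneous $v$. Let $\Omega(M)=\{w\in M: v_mw=0\text{ for all homogeneous }v\text{ and all }m>\mathrm{wt}\,v-1\}$; this is an $A_g(V)$-module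 on which the class of a homogeneous $a\in V^0$ acts as $o(a)=a_{\mathrm{wt}\,a-1}$. *The generalized Verma module.* Let $\mathcal L(V,g)=\bigoplus_{r=0}^{T-1}t^{r/T}\mathbb C[t,t^{-1}]\otimes V^r$, $D=\frac{d}{dt}\otimes1+1\otimes L(-1)$, and $V[g]=\mathcal L(V,g)/D\mathcal L(V,g)$. Write $a(q)$ for the class of $t^q\otimes a$, and set $a(q)=0$ if $a\in V^r$ and $q\notin\frac rT+\mathbb Z$. Then $V[g]$ is a Lie algebra with bracket $[a(p),b(q)]=\sum_{i\ge0}\binom pi(a_ib)(p+q-i)$, graded by $\deg a(q)=\mathrm{wt}\,a-q-1$; let $V[g]_0$ be its part of degree $0$ and $V[g]_-$ the sum of its parts of negative degree. Let $U$ be an $A_g(V)$-module. Make $U$ a module for the Lie algebra $P=V[g]_-\oplus V[g]_0$ by letting $V[g]_-$ act as $0$ and $a(\mathrm{wt}\,a-1)$ act as the class of $a$ in $A_g(V)$, for homogeneous $a\in V^0$, and put $M(U)=U(V[g])\otimes_{U(P)}U$, where $U(\cdot)$ of a Lie algebra denotes its universal enveloping algebra. It is graded by the degree of $V[g]$, with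 $U=1\otimes U$ in degree $0$. Put $Y(v,z)=\sum_{m\in\frac1T\mathbb Z}v(m)z^{-m-1}$. Let $W\subseteq M(U)$ be the span of all coefficients of $$(z_0+z_2)^{c}\,Y(a,z_0+z_2)Y(b,z_2)u-(z_2+z_0)^{c}\,Y(Y(a,z_0)b,z_2)u,\qquad c=\mathrm{wt}\,a-1+\delta_r+\tfrac rT,$$ for homogeneous $a\in V^r$ ($0\le r<T$), $b\in V$, $u\in U$, where powers of a binomial are expanded in nonnegative powers of its second variable. Set $\bar M(U)=M(U)/U(V[g])W$, with the induced operators $v(m)$ and the induced grading. **Theorem 6.1.** With $v_m=v(m)$ and the induced grading, $\bar M(U)$ is an admissible $g$-twisted $V$-module. The natural map $U\to\bar M(U)$, $u\mapsto 1\otimes u$, is injective with image $\bar M(U)(0)$, and it is a morphism of $A_g(V)$-modules into $\Omega(\bar M(U))$; in this sense $\bar M(U)(0)=U$. Moreover, for every weak $g$-twisted $V$-module $M$ and every morphism $\phi:U\to\Omega(M)$ of $A_g(V)$-modules there is a unique morphism $\bar\phi:\bar M(U)\to M$ of weak $g$-twisted $V$-modules that extends $\phi$. -/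

import Mathlib

noncomputable section

namespace TwistedVOA

open scoped VertexOperator TensorProduct

/-- The binomial coefficient `q (q - 1) ⋯ (q - i + 1) / i!` of a rational number, as a complex
number. -/
def bin (q : ℚ) (i : ℕ) : ℂ := ((Ring.choose q i : ℚ) : ℂ)

/-- A vertex operator algebra `(V, Y, 𝟏, ω)` over `ℂ`, with `Y(a, z) = ∑ a_n z^(-n-1)` and
`a_n = (Y a)[[n]]`. That `Y(a, z) b` is a Laurent series with finitely many negative powers is part
of the type `VertexOperator ℂ V`. The weight spaces are the eigenspaces of `L(0) = ω_1` for integral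
eigenvalues. The Jacobi identity is stated by its coefficients, the coefficient of
`z₀^(-l-1) z₁^(-m-1) z₂^(-n-1)`; all sums are finite because of the truncation condition. -/
class VertexOperatorAlgebra (V : Type*) [AddCommGroup V] [Module ℂ V] where
  /-- the state-field correspondence -/
  Y : V →ₗ[ℂ] VertexOperator ℂ V
  /-- the vacuum vector -/
  vac : V
  /-- the Virasoro vector -/
  conf : V
  /-- the rank (central charge) -/
  rank : ℂ
  vacuum : ∀ (n : ℤ) (b : V), ((Y vac)[[n]]) b = if n = -1 then b else 0
  creation : ∀ a : V, ((Y a)[[-1]]) vac = a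
  creation_nonneg : ∀ (a : V) (n : ℤ), 0 ≤ n → ((Y a)[[n]]) vac = 0
  jacobi : ∀ (a b w : V) (l m n : ℤ),
    ∑ᶠ i : ℕ, bin m i • ((Y (((Y a)[[l + i]]) b))[[m + n - i]]) w =
      ∑ᶠ i : ℕ, ((-1) ^ i * bin l i) •
        (((Y a)[[m + l - i]]) (((Y b)[[n + i]]) w) -
          (-1 : ℂ) ^ l • ((Y b)[[n + l - i]]) (((Y a)[[m + i]]) w))
  virasoro : ∀ (m n : ℤ) (w : V),
    ((Y conf)[[m + 1]]) (((Y conf)[[n + 1]]) w) - ((Y conf)[[n + 1]]) (((Y conf)[[m + 1]]) w) =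
      ((m : ℂ) - n) • ((Y conf)[[m + n + 1]]) w +
        (if m + n = 0 then ((m : ℂ) ^ 3 - m) / 12 * rank else 0) • w
  translation : ∀ (a b : V) (n : ℤ),
    ((Y (((Y conf)[[0]]) a))[[n]]) b = (-(n : ℂ)) • ((Y a)[[n - 1]]) b
  grading : DirectSum.IsInternal
    (fun n : ℤ => Module.End.eigenspace ((Y conf)[[1]]) (n : ℂ))
  finiteDimensional : ∀ n : ℤ,
    FiniteDimensional ℂ (Module.End.eigenspace ((Y conf)[[1]]) (n : ℂ))
  bounded_below : ∃ N : ℤ, ∀ n < N, Module.End.eigenspace ((Y conf)[[1]]) (n : ℂ) = ⊥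

section VOA

variable {V : Type*} [AddCommGroup V] [Module ℂ V] [VertexOperatorAlgebra V]

/-- The bilinear product `(a, b) ↦ a_n b` of a vertex operator algebra. -/
def md (n : ℤ) : V →ₗ[ℂ] V →ₗ[ℂ] V :=
  LinearMap.mk₂ ℂ (fun a b => ((VertexOperatorAlgebra.Y a)[[n]]) b)
    (fun a a' b => by simp) (fun c a b => by simp) (fun a b b' => by simp) (fun c a b => by simp)

/-- The vacuum vector. -/
abbrev vac (V : Type*) [AddCommGroup V] [Module ℂ V] [VertexOperatorAlgebra V] : V :=
  VertexOperatorAlgebra.vac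

/-- The operator `L(n) = ω_{n+1}`. -/
def vir (V : Type*) [AddCommGroup V] [Module ℂ V] [VertexOperatorAlgebra V] (n : ℤ) :
    Module.End ℂ V := md (n + 1) VertexOperatorAlgebra.conf

/-- The space of homogeneous vectors of weight `n`: those `v` with `L(0) v = n v`. -/
def wtSpace (V : Type*) [AddCommGroup V] [Module ℂ V] [VertexOperatorAlgebra V] (n : ℤ) :
    Submodule ℂ V := Module.End.eigenspace (vir V 0) (n : ℂ)

end VOA

/-- An automorphism of finite order of a vertex operator algebra. -/
structure FinAut (V : Type*) [AddCommGroup V] [Module ℂ V] [VertexOperatorAlgebra V] where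
  /-- the underlying linear automorphism -/
  toEquiv : V ≃ₗ[ℂ] V
  map_md : ∀ (n : ℤ) (a b : V), toEquiv (md n a b) = md n (toEquiv a) (toEquiv b)
  map_vac : toEquiv (vac V) = vac V
  map_conf : toEquiv (VertexOperatorAlgebra.conf : V) = VertexOperatorAlgebra.conf
  finite : IsOfFinOrder toEquiv

section Basic

variable {V : Type*} [AddCommGroup V] [Module ℂ V] [VertexOperatorAlgebra V]

theorem md_apply (n : ℤ) (a b : V) : md n a b = ((VertexOperatorAlgebra.Y a)[[n]]) b := rfl

theorem exists_trunc (a b : V) : ∃ N : ℕ, ∀ i : ℤ, (N : ℤ) ≤ i → md i a b = 0 := by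
  refine ⟨(-HahnSeries.order ((HahnModule.of ℂ).symm (VertexOperatorAlgebra.Y a b))).toNat,
    fun i hi => ?_⟩
  rw [md_apply]
  apply VertexOperator.ncoeff_eq_zero_of_lt_order
  have := Int.self_le_toNat (-HahnSeries.order ((HahnModule.of ℂ).symm (VertexOperatorAlgebra.Y a b)))
  omega

theorem finsum_eq_range {E : Type*} [AddCommMonoid E] (f : ℕ → E) (N : ℕ)
    (h : ∀ i, N ≤ i → f i = 0) : ∑ᶠ i, f i = ∑ i ∈ Finset.range N, f i := by
  apply finsum_eq_sum_of_support_subset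
  intro i hi
  by_contra hc
  exact hi (h i (by simpa using hc))

theorem bin_zero_right (q : ℚ) : bin q 0 = 1 := by simp [bin]

theorem bin_zero_succ (i : ℕ) (h : i ≠ 0) : bin 0 i = 0 := by
  simp [bin, Ring.choose_zero_ite, h]

theorem bin_add (p q : ℚ) (n : ℕ) :
    bin (p + q) n = ∑ x ∈ Finset.HasAntidiagonal.antidiagonal n, bin p x.1 * bin q x.2 := by
  simp [bin, Ring.add_choose_eq n (Commute.all p q)]

theorem bin_natCast (n k : ℕ) : bin n k = (n.choose k : ℂ) := by
  simp [bin, Ring.choose_natCast]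

theorem bin_neg (q : ℚ) (n : ℕ) : bin (-q) n = (-1) ^ n * bin (q + n - 1) n := by
  simp [bin, Ring.choose_neg, Int.negOnePow, Units.smul_def]

theorem bin_succ_mul (q : ℚ) (n : ℕ) : ((n : ℂ) + 1) * bin q (n + 1) = q * bin (q - 1) n := by
  have h := Ring.choose_smul_choose q (n := n + 1) (k := 1) (by omega)
  simp only [Nat.choose_one_right, Ring.choose_one_right, nsmul_eq_mul, Nat.cast_one,
    Nat.add_sub_cancel] at h
  have h' := congrArg (fun x : ℚ => (x : ℂ)) h
  push_cast at h'
  simpa [bin] using h'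

theorem bin_mul_bin (p : ℚ) (i k : ℕ) (h : k ≤ i) :
    bin p i * bin i k = bin p k * bin (p - k) (i - k) := by
  have h := Ring.choose_smul_choose p h
  have h' := congrArg (fun x : ℚ => (x : ℂ)) h
  rw [bin_natCast]
  simp only [bin, nsmul_eq_mul] at h' ⊢
  push_cast at h'
  rw [← h', mul_comm]

theorem commutator (a b c : V) (i : ℕ) (n : ℤ) :
    md i a (md n b c) - md n b (md i a c) =
      ∑ k ∈ Finset.range (i + 1), bin i k • md (i + n - k) (md k a b) c := by
  have h := VertexOperatorAlgebra.jacobi a b c 0 i n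
  rw [finsum_eq_range _ (i + 1), finsum_eq_range _ 1] at h
  · simp only [md_apply]
    simpa [bin_zero_right] using h.symm
  · intro j hj
    rw [Int.cast_zero, bin_zero_succ j (by omega)]; simp
  · intro j hj
    rw [Int.cast_natCast, bin_natCast, Nat.choose_eq_zero_of_lt (by omega)]; simp

theorem skew (a b : V) (j : ℕ) (N : ℕ) (hN : ∀ i : ℤ, (N : ℤ) ≤ i → md i a b = 0) :
    md j b a = ∑ k ∈ Finset.range N, (-1 : ℂ) ^ (j + k + 1) •
      md (-1 - k) (md (j + k) a b) (vac V) := by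
  have h := VertexOperatorAlgebra.jacobi a b (vac V) j (-1) 0
  rw [finsum_eq_range _ N, finsum_eq_range _ 1] at h
  · have h1 : ∀ n : ℕ, bin (-1) n = (-1) ^ n := by
      intro n
      have := bin_neg 1 n
      rw [this]
      have h2 : (1 + n - 1 : ℚ) = n := by ring
      rw [h2, bin_natCast]; simp
    simp only [← md_apply, Finset.range_one, Finset.sum_singleton, Int.cast_neg, Int.cast_one, h1,
      bin_zero_right] at h
    have hc : md 0 b (vac V) = 0 := VertexOperatorAlgebra.creation_nonneg b _ le_rfl
    have hd : md (-1) a (vac V) = a := VertexOperatorAlgebra.creation a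
    simp only [Nat.cast_zero, add_zero, sub_zero, pow_zero, one_mul,
      one_smul, zero_add, hd, zpow_natCast] at h
    rw [hc, map_zero, zero_sub] at h
    have h3 : md j b a = (-1 : ℂ) ^ (j + 1) • -((-1 : ℂ) ^ j • md j b a) := by
      rw [smul_neg, smul_smul, ← neg_smul, ← pow_add,
        show j + 1 + j = 2 * j + 1 by ring, pow_succ, pow_mul]
      simp
    rw [h3, ← h, Finset.smul_sum]
    refine Finset.sum_congr rfl fun k _ => ?_
    rw [smul_smul, ← pow_add]
    congr 2
    ring
  · intro i hi
    have h1 : ((VertexOperatorAlgebra.Y b)[[(0 : ℤ) + i]]) (vac V) = 0 :=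
      VertexOperatorAlgebra.creation_nonneg b _ (by omega)
    have h2 : ((VertexOperatorAlgebra.Y a)[[(-1 : ℤ) + i]]) (vac V) = 0 :=
      VertexOperatorAlgebra.creation_nonneg a _ (by omega)
    rw [h1, h2]; simp
  · intro i hi
    rw [← md_apply, ← md_apply, hN _ (by omega)]; simp

/-- The operator `L(-1)`. -/
abbrev Lm1 (V : Type*) [AddCommGroup V] [Module ℂ V] [VertexOperatorAlgebra V] :
    Module.End ℂ V := vir V (-1)

theorem Lm1_apply (a : V) : Lm1 V a = md 0 VertexOperatorAlgebra.conf a := by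
  simp [Lm1, vir]

theorem md_Lm1 (n : ℤ) (a b : V) : md n (Lm1 V a) b = (-(n : ℂ)) • md (n - 1) a b := by
  rw [Lm1_apply]; exact VertexOperatorAlgebra.translation a b n

theorem Lm1_md (n : ℤ) (a b : V) :
    Lm1 V (md n a b) = (-(n : ℂ)) • md (n - 1) a b + md n a (Lm1 V b) := by
  have h := commutator (VertexOperatorAlgebra.conf : V) a b 0 n
  simp only [Nat.cast_zero, zero_add, Finset.range_one, Finset.sum_singleton, sub_zero,
    bin_zero_right, one_smul] at h
  rw [← md_Lm1, Lm1_apply, Lm1_apply, Lm1_apply]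
  rw [← h]; abel

theorem Lm1_vac : Lm1 V (vac V) = 0 := by
  rw [Lm1_apply]; exact VertexOperatorAlgebra.creation_nonneg _ _ le_rfl

theorem sum_antidiag_box {E : Type*} [AddCommMonoid E] (M : ℕ) (G : ℕ → ℕ → E)
    (h : ∀ x y, (M ≤ x ∨ M ≤ y) → G x y = 0) :
    ∑ n ∈ Finset.range (2 * M), ∑ x ∈ Finset.HasAntidiagonal.antidiagonal n, G x.1 x.2 =
      ∑ x ∈ Finset.range M, ∑ y ∈ Finset.range M, G x y := by
  rw [← Finset.sum_product']
  rw [← Finset.sum_fiberwise_of_maps_to (s := Finset.range M ×ˢ Finset.range M)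
    (t := Finset.range (2 * M)) (g := fun x => x.1 + x.2)]
  · refine Finset.sum_congr rfl fun n _ => ?_
    symm
    apply Finset.sum_subset
    · intro x hx
      simp only [Finset.mem_filter] at hx
      simpa using hx.2
    · intro x hx hx'
      apply h
      by_contra hc
      push Not at hc
      apply hx'
      simp only [Finset.mem_filter, Finset.mem_product, Finset.mem_range]
      exact ⟨hc, by simpa using hx⟩
  · intro x hx
    simp only [Finset.mem_product, Finset.mem_range] at hx ⊢
    omega

/-- The space `⨁_{q ∈ ℚ} t^q ⊗ V`; the element `t^q ⊗ a` is `Finsupp.single q a`. It contains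
`ℒ(V) = ℂ[t^(1/T), t^(-1/T)] ⊗ V` as the part with exponents in `(1/T)ℤ`. -/
abbrev Loop (V : Type*) [AddCommGroup V] := ℚ →₀ V

/-- The operator `D = d/dt ⊗ 1 + 1 ⊗ L(-1)`. -/
def loopD (V : Type*) [AddCommGroup V] [Module ℂ V] [VertexOperatorAlgebra V] :
    Loop V →ₗ[ℂ] Loop V :=
  Finsupp.lsum ℂ fun q : ℚ =>
    (q : ℂ) • Finsupp.lsingle (q - 1) + Finsupp.lsingle q ∘ₗ Lm1 V

theorem loopD_single (q : ℚ) (a : V) : loopD V (Finsupp.single q a) =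
    (q : ℂ) • Finsupp.single (q - 1) a + Finsupp.single q (Lm1 V a) := by
  simp [loopD]

/-- The product `(t^p ⊗ a)_0 (t^q ⊗ b) = ∑_i (p choose i) t^(p+q-i) ⊗ a_i b` for fixed `p`, `q`. -/
def brTerm (p q : ℚ) : V →ₗ[ℂ] V →ₗ[ℂ] Loop V :=
  LinearMap.mk₂ ℂ
    (fun a b => ∑ᶠ i : ℕ, bin p i • Finsupp.single (p + q - i) (md (i : ℤ) a b))
    (fun a a' b => by
      obtain ⟨N, hN⟩ := exists_trunc a b
      obtain ⟨N', hN'⟩ := exists_trunc a' b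
      rw [finsum_eq_range _ (N + N'), finsum_eq_range _ (N + N'), finsum_eq_range _ (N + N'),
        ← Finset.sum_add_distrib]
      · simp
      · intro i hi; rw [hN' _ (by omega)]; simp
      · intro i hi; rw [hN _ (by omega)]; simp
      · intro i hi; rw [map_add, LinearMap.add_apply, hN _ (by omega), hN' _ (by omega)]; simp)
    (fun c a b => by
      obtain ⟨N, hN⟩ := exists_trunc a b
      rw [finsum_eq_range _ N, finsum_eq_range _ N, Finset.smul_sum]
      · refine Finset.sum_congr rfl fun i _ => ?_
        rw [map_smul, LinearMap.smul_apply, ← Finsupp.smul_single, smul_comm]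
      · intro i hi; rw [hN _ (by omega)]; simp
      · intro i hi; rw [map_smul, LinearMap.smul_apply, hN _ (by omega)]; simp)
    (fun a b b' => by
      obtain ⟨N, hN⟩ := exists_trunc a b
      obtain ⟨N', hN'⟩ := exists_trunc a b'
      rw [finsum_eq_range _ (N + N'), finsum_eq_range _ (N + N'), finsum_eq_range _ (N + N'),
        ← Finset.sum_add_distrib]
      · simp
      · intro i hi; rw [hN' _ (by omega)]; simp
      · intro i hi; rw [hN _ (by omega)]; simp
      · intro i hi; rw [map_add, hN _ (by omega), hN' _ (by omega)]; simp)
    (fun c a b => by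
      obtain ⟨N, hN⟩ := exists_trunc a b
      rw [finsum_eq_range _ N, finsum_eq_range _ N, Finset.smul_sum]
      · refine Finset.sum_congr rfl fun i _ => ?_
        rw [map_smul, ← Finsupp.smul_single, smul_comm]
      · intro i hi; rw [hN _ (by omega)]; simp
      · intro i hi; rw [map_smul, hN _ (by omega)]; simp)

/-- The bilinear product `(x, y) ↦ x_0 y`, the coefficient of `z^(-1)` of `Y(x, z) y` in the tensor
product of the vertex algebra of powers of `t`, where `Y(f(t), z) h(t) = f(t + z) h(t)`,
and `V`. -/
def loopBr : Loop V →ₗ[ℂ] Loop V →ₗ[ℂ] Loop V :=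
  Finsupp.lsum ℂ fun p : ℚ =>
    LinearMap.flip (Finsupp.lsum ℂ fun q : ℚ => LinearMap.flip (brTerm p q))

theorem loopBr_single (p q : ℚ) (a b : V) :
    loopBr (Finsupp.single p a) (Finsupp.single q b) = brTerm p q a b := by
  simp [loopBr]

theorem brTerm_eq (p q : ℚ) (a b : V) (N : ℕ) (h : ∀ i : ℕ, N ≤ i → md i a b = 0) :
    brTerm p q a b =
      ∑ i ∈ Finset.range N, bin p i • Finsupp.single (p + q - i) (md (i : ℤ) a b) := by
  change ∑ᶠ i : ℕ, bin p i • Finsupp.single (p + q - i) (md (i : ℤ) a b) = _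
  apply finsum_eq_range
  intro i hi
  rw [h i hi]; simp

theorem loopBr_D_left (x y : Loop V) : loopBr (loopD V x) y = 0 := by
  suffices h : loopBr ∘ₗ loopD V = 0 by
    exact congrArg (fun f => f y) (LinearMap.congr_fun h x)
  ext p a : 2
  refine Finsupp.lhom_ext' fun q => LinearMap.ext fun b => ?_
  simp only [LinearMap.comp_apply, Finsupp.lsingle_apply, loopD_single, map_add, map_smul,
    LinearMap.add_apply, LinearMap.smul_apply, loopBr_single, LinearMap.zero_apply]
  obtain ⟨N, hN⟩ := exists_trunc a b
  rw [brTerm_eq _ _ _ _ N (fun i hi => hN _ (by omega)), brTerm_eq _ _ _ _ (N + 1),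
    Finset.sum_range_succ']
  · rw [Finset.smul_sum, ← add_assoc, ← Finset.sum_add_distrib]
    simp only [md_Lm1]
    simp only [Nat.cast_zero, Int.cast_zero, neg_zero, zero_smul, Finsupp.single_zero, smul_zero,
      add_zero]
    apply Finset.sum_eq_zero
    intro i _
    rw [← Finsupp.smul_single, smul_smul, smul_smul]
    have e : p - 1 + q - i = p + q - ((i + 1 : ℕ) : ℚ) := by push_cast; ring
    have e' : ((i + 1 : ℕ) : ℤ) - 1 = i := by push_cast; ring
    rw [e, e', ← add_smul]
    have := bin_succ_mul p i
    have h0 : (p : ℂ) * bin (p - 1) i + bin p (i + 1) * -(((i + 1 : ℕ) : ℤ) : ℂ) = 0 := by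
      rw [← this]; push_cast; ring
    rw [h0, zero_smul]
  · intro i hi
    rw [md_Lm1, hN _ (by omega), smul_zero]

theorem loopBr_D_right (x y : Loop V) : loopBr x (loopD V y) = loopD V (loopBr x y) := by
  suffices h : loopBr.compl₂ (loopD V) = loopBr.compr₂ (loopD V) by
    exact congrArg (fun f => f y) (LinearMap.congr_fun h x)
  ext p a : 2
  refine Finsupp.lhom_ext' fun q => LinearMap.ext fun b => ?_
  simp only [LinearMap.comp_apply, Finsupp.lsingle_apply, loopD_single, map_add, map_smul,
    LinearMap.compl₂_apply, LinearMap.compr₂_apply,  loopBr_single]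
  obtain ⟨N, hN⟩ := exists_trunc a b
  obtain ⟨N', hN'⟩ := exists_trunc a (Lm1 V b)
  rw [brTerm_eq _ _ _ _ (N + N' + 1) (fun i hi => hN _ (by omega)),
    brTerm_eq _ _ _ _ (N + N' + 1) (fun i hi => hN _ (by omega)),
    brTerm_eq _ _ _ _ (N + N' + 1) (fun i hi => hN' _ (by omega))]
  simp only [map_sum, map_smul, loopD_single, Lm1_md, Finsupp.single_add, smul_add,
    Finset.sum_add_distrib]
  rw [← add_assoc]
  congr 1
  rw [Finset.smul_sum]
  have h0 : ∑ i ∈ Finset.range (N + N' + 1),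
        bin p i • Finsupp.single (p + q - i) (-((i : ℤ) : ℂ) • md ((i : ℤ) - 1) a b) =
      ∑ i ∈ Finset.range (N + N' + 1),
        (-(p : ℂ) * bin (p - 1) i) • Finsupp.single (p + q - i - 1) (md i a b) := by
    rw [Finset.sum_range_succ']
    rw [Finset.sum_range_succ _ (N + N')]
    rw [hN ((N + N' : ℕ) : ℤ) (by omega)]
    simp only [Nat.cast_zero, Int.cast_zero, neg_zero, zero_smul, Finsupp.single_zero, smul_zero,
      add_zero]
    refine Finset.sum_congr rfl fun i _ => ?_
    rw [← Finsupp.smul_single, smul_smul]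
    have e : p + q - ((i + 1 : ℕ) : ℚ) = p + q - i - 1 := by push_cast; ring
    have e' : ((i + 1 : ℕ) : ℤ) - 1 = i := by push_cast; ring
    rw [e, e']
    congr 1
    have := bin_succ_mul p i
    push_cast
    linear_combination -this
  rw [h0, ← Finset.sum_add_distrib]
  refine Finset.sum_congr rfl fun i _ => ?_
  have e : p + (q - 1) - i = p + q - i - 1 := by ring
  rw [e, smul_smul, smul_smul, ← add_smul]
  congr 1
  have h1 := bin_succ_mul p i
  have h2 : ((i : ℂ) + 1) * bin p (i + 1) = (p - i) * bin p i := by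
    have := bin_mul_bin p (i + 1) i (by omega)
    rw [bin_natCast, Nat.choose_succ_self_right] at this
    have e2 : bin (p - i) (i + 1 - i) = p - i := by
      simp [bin]
    rw [e2] at this
    push_cast at this
    linear_combination this
  push_cast
  linear_combination h2 - h1

theorem exists_trunc₃ (a b c : V) : ∃ M : ℕ, ∀ i j : ℕ, (M ≤ i ∨ M ≤ j) →
    md i a (md j b c) = 0 ∧ md i b (md j a c) = 0 ∧ md j (md i a b) c = 0 := by
  have key : ∀ a b c : V, ∃ M : ℕ, ∀ i j : ℕ, (M ≤ i ∨ M ≤ j) → md i a (md j b c) = 0 := by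
    intro a b c
    obtain ⟨N, hN⟩ := exists_trunc b c
    choose f hf using fun j : ℕ => exists_trunc a (md j b c)
    refine ⟨N + ∑ j ∈ Finset.range N, f j, fun i j h => ?_⟩
    by_cases hj : N ≤ j
    · rw [hN _ (by omega), map_zero]
    · have := Finset.single_le_sum (f := f) (fun _ _ => Nat.zero_le _)
        (Finset.mem_range.2 (not_le.1 hj))
      exact hf j _ (by omega)
  have key' : ∀ a b c : V, ∃ M : ℕ, ∀ i j : ℕ, (M ≤ i ∨ M ≤ j) → md j (md i a b) c = 0 := by
    intro a b c
    obtain ⟨N, hN⟩ := exists_trunc a b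
    choose f hf using fun j : ℕ => exists_trunc (md j a b) c
    refine ⟨N + ∑ j ∈ Finset.range N, f j, fun j i h => ?_⟩
    by_cases hj : N ≤ j
    · rw [hN _ (by omega), map_zero, LinearMap.zero_apply]
    · have := Finset.single_le_sum (f := f) (fun _ _ => Nat.zero_le _)
        (Finset.mem_range.2 (not_le.1 hj))
      exact hf j _ (by omega)
  obtain ⟨M, hM⟩ := key a b c
  obtain ⟨M', hM'⟩ := key b a c
  obtain ⟨M'', hM''⟩ := key' a b c
  exact ⟨M + M' + M'', fun i j h =>
    ⟨hM i j (by omega), hM' i j (by omega), hM'' i j (by omega)⟩⟩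

theorem brTerm_brTerm_right (p q s : ℚ) (a b c : V) (M : ℕ)
    (h : ∀ i j : ℕ, (M ≤ i ∨ M ≤ j) → md i a (md j b c) = 0) :
    loopBr (Finsupp.single p a) (brTerm q s b c) =
      ∑ i ∈ Finset.range M, ∑ j ∈ Finset.range M,
        (bin p i * bin q j) • Finsupp.single (p + q + s - i - j) (md i a (md j b c)) := by
  obtain ⟨N, hN⟩ := exists_trunc b c
  rw [brTerm_eq _ _ _ _ (M + N) (fun i hi => hN _ (by omega)), map_sum]
  rw [Finset.sum_comm]
  symm
  rw [Finset.sum_subset (Finset.range_mono (Nat.le_add_right M N))]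
  · refine Finset.sum_congr rfl fun j _ => ?_
    rw [map_smul, loopBr_single, brTerm_eq _ _ _ _ M (fun i hi => h i j (Or.inl hi)),
      Finset.smul_sum]
    refine Finset.sum_congr rfl fun i _ => ?_
    rw [smul_smul, mul_comm]
    congr 2
    ring
  · intro j _ hj
    apply Finset.sum_eq_zero
    intro i _
    rw [h i j (Or.inr (by simpa using hj))]; simp

theorem brTerm_brTerm_left (p q s : ℚ) (a b c : V) (M : ℕ)
    (h : ∀ i j : ℕ, (M ≤ i ∨ M ≤ j) → md j (md i a b) c = 0) :
    loopBr (brTerm p q a b) (Finsupp.single s c) =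
      ∑ k ∈ Finset.range M, ∑ l ∈ Finset.range M,
        (bin p k * bin (p + q - k) l) •
          Finsupp.single (p + q + s - k - l) (md l (md k a b) c) := by
  obtain ⟨N, hN⟩ := exists_trunc a b
  rw [brTerm_eq _ _ _ _ (M + N) (fun i hi => hN _ (by omega)), map_sum, LinearMap.sum_apply]
  symm
  rw [Finset.sum_subset (Finset.range_mono (Nat.le_add_right M N))]
  · refine Finset.sum_congr rfl fun j _ => ?_
    rw [map_smul, LinearMap.smul_apply, loopBr_single,
      brTerm_eq _ _ _ _ M (fun i hi => h j i (Or.inr hi)), Finset.smul_sum]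
    refine Finset.sum_congr rfl fun i _ => ?_
    rw [smul_smul]
    congr 2
    ring
  · intro j _ hj
    apply Finset.sum_eq_zero
    intro i _
    rw [h j i (Or.inl (by simpa using hj))]; simp

theorem loopBr_leibniz (x y z : Loop V) :
    loopBr x (loopBr y z) = loopBr (loopBr x y) z + loopBr y (loopBr x z) := by
  suffices h : ∀ (p q s : ℚ) (a b c : V),
      loopBr (Finsupp.single p a) (loopBr (Finsupp.single q b) (Finsupp.single s c)) =
      loopBr (loopBr (Finsupp.single p a) (Finsupp.single q b)) (Finsupp.single s c) +
      loopBr (Finsupp.single q b) (loopBr (Finsupp.single p a) (Finsupp.single s c)) by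
    induction x using Finsupp.induction_linear with
    | zero => simp
    | add x x' hx hx' => simp only [map_add, LinearMap.add_apply, hx, hx']; abel
    | single p a =>
      induction y using Finsupp.induction_linear with
      | zero => simp
      | add x x' hx hx' => simp only [map_add, LinearMap.add_apply, hx, hx']; abel
      | single q b =>
        induction z using Finsupp.induction_linear with
        | zero => simp
        | add x x' hx hx' => simp only [map_add, hx, hx']; abel
        | single s c => exact h p q s a b c
  intro p q s a b c
  rw [loopBr_single, loopBr_single, loopBr_single]
  obtain ⟨M, hM⟩ := exists_trunc₃ a b c
  rw [← sub_eq_iff_eq_add]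
  rw [brTerm_brTerm_right p q s a b c (2 * M) (fun i j h => (hM i j (by omega)).1),
    brTerm_brTerm_right q p s b a c (2 * M) (fun i j h => (hM i j (by omega)).2.1),
    brTerm_brTerm_left p q s a b c (2 * M) (fun i j h => (hM i j (by omega)).2.2)]
  let F : ℕ → ℕ → ℕ → Loop V := fun k i j =>
    (bin p k * bin (p - k) i * bin q j) •
      Finsupp.single (p + q + s - k - i - j) (md ((i + j : ℕ) : ℤ) (md k a b) c)
  have hF : ∀ k i j, (M ≤ k ∨ M ≤ i ∨ M ≤ j) → F k i j = 0 := by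
    intro k i j h
    simp only [F]
    rw [(hM k (i + j) (by omega)).2.2]; simp
  have h1 : ∀ i j : ℕ, (bin p i * bin q j) •
        Finsupp.single (p + q + s - i - j) (md i a (md j b c)) -
      (bin q j * bin p i) • Finsupp.single (q + p + s - j - i) (md j b (md i a c)) =
      ∑ x ∈ Finset.HasAntidiagonal.antidiagonal i, F x.1 x.2 j := by
    intro i j
    rw [Finset.Nat.sum_antidiagonal_eq_sum_range_succ (fun k i' => F k i' j)]
    have e : q + p + s - j - i = p + q + s - i - j := by ring
    rw [e, mul_comm (bin q j), ← smul_sub, ← Finsupp.single_sub, commutator,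
      Finsupp.single_finsetSum, Finset.smul_sum]
    refine Finset.sum_congr rfl fun k hk => ?_
    have hk' : k ≤ i := by simpa [Nat.lt_succ_iff] using hk
    simp only [F]
    rw [← Finsupp.smul_single, smul_smul, ← bin_mul_bin p i k hk']
    have e1 : (p + q + s - i - j : ℚ) = p + q + s - k - ((i - k : ℕ) : ℚ) - j := by
      rw [Nat.cast_sub hk']; ring
    have e2 : (i : ℤ) + j - k = ((i - k + j : ℕ) : ℤ) := by omega
    rw [e1, e2]
    congr 1
    ring
  rw [Finset.sum_comm (s := Finset.range (2 * M)) (t := Finset.range (2 * M))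
    (f := fun x y => (bin q x * bin p y) • Finsupp.single (q + p + s - x - y)
      (md x b (md y a c)))]
  simp only [← Finset.sum_sub_distrib, h1]
  have h2 : ∀ k l : ℕ, (bin p k * bin (p + q - k) l) •
      Finsupp.single (p + q + s - k - l) (md l (md k a b) c) =
      ∑ x ∈ Finset.HasAntidiagonal.antidiagonal l, F k x.1 x.2 := by
    intro k l
    have e : p + q - k = (p - k) + q := by ring
    rw [e, bin_add, Finset.mul_sum, Finset.sum_smul]
    refine Finset.sum_congr rfl fun x hx => ?_
    have hx' : x.1 + x.2 = l := by simpa using hx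
    simp only [F]
    have e1 : (p + q + s - k - l : ℚ) = p + q + s - k - x.1 - x.2 := by
      rw [← hx']; push_cast; ring
    rw [e1, hx', mul_assoc]
  simp only [h2]
  rw [Finset.sum_comm]
  have h3 : ∀ j, ∑ i ∈ Finset.range (2 * M),
      ∑ x ∈ Finset.HasAntidiagonal.antidiagonal i, F x.1 x.2 j =
      ∑ k ∈ Finset.range M, ∑ i ∈ Finset.range M, F k i j := fun j =>
    sum_antidiag_box M (fun k i => F k i j) (fun k i h => hF k i j (by omega))
  have h4 : ∀ k, ∑ l ∈ Finset.range (2 * M),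
      ∑ x ∈ Finset.HasAntidiagonal.antidiagonal l, F k x.1 x.2 =
      ∑ i ∈ Finset.range M, ∑ j ∈ Finset.range M, F k i j := fun k =>
    sum_antidiag_box M (fun i j => F k i j) (fun i j h => hF k i j (by omega))
  simp only [h3, h4]
  have h5 : M ≤ 2 * M := by omega
  rw [← Finset.sum_subset (Finset.range_mono h5), ← Finset.sum_subset (Finset.range_mono h5)]
  · rw [Finset.sum_comm]
    refine Finset.sum_congr rfl fun k _ => ?_
    rw [Finset.sum_comm]
  · intro k _ hk
    refine Finset.sum_eq_zero fun i _ => Finset.sum_eq_zero fun j _ => hF k i j ?_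
    exact Or.inl (by simpa using hk)
  · intro j _ hj
    refine Finset.sum_eq_zero fun k _ => Finset.sum_eq_zero fun i _ => hF k i j ?_
    exact Or.inr (Or.inr (by simpa using hj))

end Basic

section Twisted

variable {V : Type*} [AddCommGroup V] [Module ℂ V] [VertexOperatorAlgebra V] (g : FinAut V)

/-- The order `T` of the automorphism `g`. -/
def FinAut.T : ℕ := orderOf g.toEquiv

/-- The eigenspace of `g` for the eigenvalue `e^{2πiq}`. It is zero unless `q ∈ (1/T)ℤ`. -/
def sector (q : ℚ) : Submodule ℂ V :=
  Module.End.eigenspace (g.toEquiv : Module.End ℂ V) (Complex.exp (2 * Real.pi * Complex.I * q))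

/-- The eigenspace `V^r = {v | g v = e^{2πir/T} v}`. -/
def Vr (r : ℕ) : Submodule ℂ V := sector g ((r : ℚ) / g.T)

theorem mem_sector {q : ℚ} {a : V} :
    a ∈ sector g q ↔ g.toEquiv a = Complex.exp (2 * Real.pi * Complex.I * q) • a := by
  simp [sector]

theorem sector_sub_int (q : ℚ) (n : ℤ) : sector g (q - n) = sector g q := by
  unfold sector
  congr 1
  push_cast
  rw [mul_sub, mul_comm (2 * (Real.pi : ℂ) * Complex.I) (n : ℂ), Complex.exp_sub,
    Complex.exp_int_mul_two_pi_mul_I, div_one]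

theorem FinAut.T_pos : 0 < g.T := g.finite.orderOf_pos

theorem exp_T (q : ℚ) (h : ∃ k : ℤ, q * g.T = k) :
    Complex.exp (2 * Real.pi * Complex.I * q) ^ g.T = 1 := by
  obtain ⟨k, hk⟩ := h
  have hk' := congrArg (fun x : ℚ => (x : ℂ)) hk
  push_cast at hk'
  rw [← Complex.exp_nat_mul, ← Complex.exp_int_mul_two_pi_mul_I k, ← hk']
  congr 1
  ring

theorem sector_pow {q : ℚ} {a : V} (ha : a ∈ sector g q) (j : ℕ) :
    ((g.toEquiv : Module.End ℂ V) ^ j) a =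
      Complex.exp (2 * Real.pi * Complex.I * q) ^ j • a := by
  induction j with
  | zero => simp
  | succ j ih =>
    rw [pow_succ', Module.End.mul_apply, ih, map_smul, LinearEquiv.coe_coe, (mem_sector g).1 ha,
      smul_smul, pow_succ]

theorem pow_T (a : V) : ((g.toEquiv : Module.End ℂ V) ^ g.T) a = a := by
  have h : g.toEquiv ^ g.T = 1 := pow_orderOf_eq_one _
  have h' : ∀ j : ℕ, ((g.toEquiv : Module.End ℂ V) ^ j) a = (g.toEquiv ^ j) a := by
    intro j
    induction j with
    | zero => simp
    | succ j ih => rw [pow_succ', pow_succ', Module.End.mul_apply, ih]; rfl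
  rw [h', h]; rfl

/-- The eigenspace for `e^{2πiq}` is zero if `q` is not in `(1/T)ℤ`. -/
theorem sector_eq_bot {q : ℚ} (h : ¬ ∃ k : ℤ, q * g.T = k) : sector g q = ⊥ := by
  rw [Submodule.eq_bot_iff]
  intro a ha
  by_contra h0
  apply h
  have h1 := sector_pow g ha g.T
  rw [pow_T] at h1
  have h2 : Complex.exp (2 * Real.pi * Complex.I * q) ^ g.T = 1 := by
    have : (Complex.exp (2 * Real.pi * Complex.I * q) ^ g.T - 1) • a = 0 := by
      rw [sub_smul, ← h1, one_smul, sub_self]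
    rcases smul_eq_zero.1 this with h | h
    · exact sub_eq_zero.1 h
    · exact absurd h h0
  rw [← Complex.exp_nat_mul, Complex.exp_eq_one_iff] at h2
  obtain ⟨k, hk⟩ := h2
  refine ⟨k, ?_⟩
  have hpi : (2 * Real.pi * Complex.I : ℂ) ≠ 0 := Complex.two_pi_I_ne_zero
  have : (q : ℂ) * g.T = k := by
    apply mul_right_cancel₀ hpi
    rw [← hk]; ring
  exact_mod_cast this

/-- The projection of `V` onto the eigenspace of `g` for the eigenvalue `e^{2πiq}` along the other
eigenspaces; it is zero if `q` is not in `(1/T)ℤ`. -/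
def proj (q : ℚ) : V →ₗ[ℂ] V :=
  open Classical in
  if ∃ k : ℤ, q * g.T = k then
    (g.T : ℂ)⁻¹ • ∑ j ∈ Finset.range g.T,
      (Complex.exp (2 * Real.pi * Complex.I * q) ^ j)⁻¹ • (g.toEquiv : Module.End ℂ V) ^ j
  else 0

theorem proj_mem (q : ℚ) (a : V) : proj g q a ∈ sector g q := by
  unfold proj
  split_ifs with h
  · rw [mem_sector, LinearMap.smul_apply, map_smul, smul_comm (Complex.exp _)]
    congr 1
    rw [LinearMap.sum_apply, map_sum, Finset.smul_sum]
    set e := Complex.exp (2 * Real.pi * Complex.I * q) with he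
    have he0 : e ≠ 0 := Complex.exp_ne_zero _
    let f : ℕ → V := fun j => e • (e ^ j)⁻¹ • ((g.toEquiv : Module.End ℂ V) ^ j) a
    have h1 : ∀ j, g.toEquiv (((e ^ j)⁻¹ • (g.toEquiv : Module.End ℂ V) ^ j) a) = f (j + 1) := by
      intro j
      simp only [f]
      rw [LinearMap.smul_apply, map_smul, pow_succ' (g.toEquiv : Module.End ℂ V),
        Module.End.mul_apply, LinearEquiv.coe_coe, smul_smul]
      congr 1
      rw [pow_succ]
      field_simp
    have h2 : f g.T = f 0 := by
      simp only [f]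
      rw [exp_T g q h, pow_T]; simp
    rw [Finset.sum_congr rfl (fun j _ => h1 j)]
    have h3 := Finset.sum_range_succ f g.T
    rw [Finset.sum_range_succ', h2] at h3
    exact add_right_cancel h3
  · exact Submodule.zero_mem _

theorem proj_of_mem {q : ℚ} {a : V} (ha : a ∈ sector g q) : proj g q a = a := by
  unfold proj
  split_ifs with h
  · have h0 : (g.T : ℂ) ≠ 0 := by exact_mod_cast g.T_pos.ne'
    simp only [LinearMap.smul_apply, LinearMap.sum_apply, sector_pow g ha, smul_smul]
    rw [Finset.sum_congr rfl (fun j _ => by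
      rw [inv_mul_cancel₀ (pow_ne_zero j (Complex.exp_ne_zero _)), one_smul])]
    rw [Finset.sum_const, Finset.card_range, ← Nat.cast_smul_eq_nsmul ℂ, smul_smul,
      inv_mul_cancel₀ h0, one_smul]
  · rw [sector_eq_bot g h] at ha
    rw [(Submodule.mem_bot ℂ).1 ha, map_zero]

theorem md_mem_sector {p q : ℚ} {a b : V} (ha : a ∈ sector g p) (hb : b ∈ sector g q) (n : ℤ) :
    md n a b ∈ sector g (p + q) := by
  rw [mem_sector] at ha hb ⊢
  rw [g.map_md, ha, hb, map_smul, map_smul, LinearMap.smul_apply, smul_smul, ← Complex.exp_add]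
  congr 2
  push_cast
  ring

theorem Lm1_mem_sector {q : ℚ} {a : V} (ha : a ∈ sector g q) : Lm1 V a ∈ sector g q := by
  rw [Lm1_apply]
  rw [mem_sector] at ha ⊢
  rw [g.map_md, g.map_conf, ha, map_smul]

/-- `ℒ(V, g) = ⨁_q t^q ⊗ {a | g a = e^{2πiq} a} = ⨁_r t^(r/T) ℂ[t, t⁻¹] ⊗ V^r`, the invariants of `g`
acting by `g (t^q ⊗ a) = e^{-2πiq} t^q ⊗ g a`. Only exponents in `(1/T)ℤ` occur, the other
eigenspaces being zero. -/
def twLoop : Submodule ℂ (Loop V) where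
  carrier := {f | ∀ q, f q ∈ sector g q}
  add_mem' hf hh q := Submodule.add_mem _ (hf q) (hh q)
  zero_mem' _ := Submodule.zero_mem _
  smul_mem' c _ hf q := Submodule.smul_mem _ c (hf q)

theorem single_mem_twLoop {q : ℚ} {a : V} (ha : a ∈ sector g q) :
    Finsupp.single q a ∈ twLoop g := by
  intro p
  by_cases h : q = p
  · subst h; simpa using ha
  · rw [Finsupp.single_eq_of_ne (Ne.symm h)]; exact Submodule.zero_mem _

theorem loopD_mem {x : Loop V} (hx : x ∈ twLoop g) : loopD V x ∈ twLoop g := by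
  rw [← Finsupp.sum_single x, Finsupp.sum, map_sum]
  refine Submodule.sum_mem _ fun q _ => ?_
  rw [loopD_single]
  refine Submodule.add_mem _ (Submodule.smul_mem _ _ (single_mem_twLoop g ?_))
    (single_mem_twLoop g (Lm1_mem_sector g (hx q)))
  have := sector_sub_int g q 1
  rw [Int.cast_one] at this
  rw [this]
  exact hx q

theorem brTerm_mem {p q : ℚ} {a b : V} (ha : a ∈ sector g p) (hb : b ∈ sector g q) :
    brTerm p q a b ∈ twLoop g := by
  obtain ⟨N, hN⟩ := exists_trunc a b
  rw [brTerm_eq _ _ _ _ N (fun i hi => hN _ (by omega))]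
  refine Submodule.sum_mem _ fun i _ => Submodule.smul_mem _ _ (single_mem_twLoop g ?_)
  have := sector_sub_int g (p + q) i
  rw [Int.cast_natCast] at this
  rw [this]
  exact md_mem_sector g ha hb _

theorem loopBr_eq_sum (x y : Loop V) :
    loopBr x y = ∑ p ∈ x.support, ∑ q ∈ y.support, brTerm p q (x p) (y q) := by
  conv_lhs => rw [← Finsupp.sum_single x, ← Finsupp.sum_single y, Finsupp.sum, Finsupp.sum]
  simp only [map_sum, LinearMap.sum_apply, loopBr_single]
  rw [Finset.sum_comm]

theorem loopBr_mem {x y : Loop V} (hx : x ∈ twLoop g) (hy : y ∈ twLoop g) :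
    loopBr x y ∈ twLoop g := by
  rw [loopBr_eq_sum]
  exact Submodule.sum_mem _ fun p _ => Submodule.sum_mem _ fun q _ => brTerm_mem g (hx p) (hy q)

/-- The operator `D` on `ℒ(V, g)`. -/
def twD : twLoop g →ₗ[ℂ] twLoop g := (loopD V).restrict fun _ hx => loopD_mem g hx

/-- The product `(x, y) ↦ x_0 y` on `ℒ(V, g)`. -/
def twBr : twLoop g →ₗ[ℂ] twLoop g →ₗ[ℂ] twLoop g :=
  LinearMap.mk₂ ℂ (fun x y => ⟨loopBr x.1 y.1, loopBr_mem g x.2 y.2⟩)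
    (fun x x' y => by ext1; simp) (fun c x y => by ext1; simp)
    (fun x y y' => by ext1; simp) (fun c x y => by ext1; simp)

/-- The space `V[g] = ℒ(V, g) / D ℒ(V, g)`. -/
def Vg : Type _ := twLoop g ⧸ LinearMap.range (twD g)

instance : AddCommGroup (Vg g) :=
  inferInstanceAs (AddCommGroup (twLoop g ⧸ LinearMap.range (twD g)))

instance : Module ℂ (Vg g) :=
  inferInstanceAs (Module ℂ (twLoop g ⧸ LinearMap.range (twD g)))

/-- The quotient map `ℒ(V, g) → V[g]`. -/
def Vg.mk : twLoop g →ₗ[ℂ] Vg g := (LinearMap.range (twD g)).mkQ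

theorem Vg.mk_surjective : Function.Surjective (Vg.mk g) :=
  Submodule.mkQ_surjective _

theorem Vg.mk_eq_zero {x : twLoop g} : Vg.mk g x = 0 ↔ ∃ y, twD g y = x :=
  Submodule.Quotient.mk_eq_zero _

/-- The bracket `[x + D ℒ(V, g), y + D ℒ(V, g)] = x_0 y + D ℒ(V, g)` of `V[g]`. -/
def Vg.br : Vg g →ₗ[ℂ] Vg g →ₗ[ℂ] Vg g :=
  Submodule.liftQ _
    (LinearMap.flip (Submodule.liftQ _ (LinearMap.flip ((twBr g).compr₂ (Vg.mk g))) (by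
      rintro _ ⟨y, rfl⟩
      rw [LinearMap.mem_ker]
      ext1 x
      exact (Vg.mk_eq_zero g).2 ⟨twBr g x y, Subtype.ext (loopBr_D_right x.1 y.1).symm⟩)))
    (by
      rintro _ ⟨x, rfl⟩
      rw [LinearMap.mem_ker]
      ext1 y
      obtain ⟨y, rfl⟩ := Vg.mk_surjective g y
      exact (Vg.mk_eq_zero g).2 ⟨0, Subtype.ext (by
        rw [map_zero]; exact (loopBr_D_left x.1 y.1).symm)⟩)

theorem Vg.br_mk (x y : twLoop g) : Vg.br g (Vg.mk g x) (Vg.mk g y) = Vg.mk g (twBr g x y) := rfl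

theorem sum_bin_mul_bin (p q : ℚ) (n : ℕ) :
    ∑ x ∈ Finset.HasAntidiagonal.antidiagonal n,
      (-1) ^ x.1 * bin q x.1 * bin (p + q - x.1) x.2 = bin p n := by
  have h1 : bin p n = (-1) ^ n * bin (q + (n - 1 - p - q)) n := by
    have := bin_neg (-p) n
    rw [neg_neg] at this
    rw [this]
    congr 2
    ring
  rw [h1, bin_add, Finset.mul_sum]
  refine Finset.sum_congr rfl fun x hx => ?_
  have hx' : x.1 + x.2 = n := by simpa using hx
  have h2 := bin_neg (-(p + q - x.1)) x.2
  rw [neg_neg] at h2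
  rw [h2]
  have e : -(p + q - (x.1 : ℚ)) + x.2 - 1 = n - 1 - p - q := by
    rw [← hx']; push_cast; ring
  rw [e, ← hx', pow_add]
  ring

theorem md_vac_mem_sector {q : ℚ} {a : V} (ha : a ∈ sector g q) (n : ℤ) :
    md n a (vac V) ∈ sector g q := by
  rw [mem_sector] at ha ⊢
  rw [g.map_md, g.map_vac, ha, map_smul, LinearMap.smul_apply]

theorem shift_mem (a : V) (k : ℕ) : ∀ q : ℚ, a ∈ sector g q →
    Finsupp.single q (md (-1 - k) a (vac V)) - ((-1) ^ k * bin q k) • Finsupp.single (q - k) a ∈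
      (twLoop g).map (loopD V) := by
  induction k with
  | zero =>
    intro q _
    have hd : md (-1) a (vac V) = a := VertexOperatorAlgebra.creation a
    simp [hd, bin_zero_right]
  | succ k ih =>
    intro q ha
    have hs := sector_sub_int g q 1
    rw [Int.cast_one] at hs
    have h1 := ih (q - 1) (hs ▸ ha)
    have h2 : loopD V (Finsupp.single q (md (-1 - k) a (vac V))) ∈ (twLoop g).map (loopD V) :=
      Submodule.mem_map_of_mem (single_mem_twLoop g (md_vac_mem_sector g ha _))
    rw [loopD_single, Lm1_md, Lm1_vac, map_zero, add_zero] at h2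
    have e1 : (-1 - k : ℤ) - 1 = -1 - ((k + 1 : ℕ) : ℤ) := by push_cast; ring
    have e2 : q - 1 - k = q - ((k + 1 : ℕ) : ℚ) := by push_cast; ring
    rw [e1, ← Finsupp.smul_single] at h2
    rw [e2] at h1
    have hk : ((k : ℂ) + 1) ≠ 0 := by exact_mod_cast Nat.succ_ne_zero k
    have h3 := Submodule.smul_mem _ ((k : ℂ) + 1)⁻¹
      (Submodule.sub_mem _ h2 (Submodule.smul_mem _ (q : ℂ) h1))
    convert h3 using 1
    have hb := bin_succ_mul q k
    have hb' : bin q (k + 1) = ((k : ℂ) + 1)⁻¹ * (q * bin (q - 1) k) := by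
      rw [← hb, inv_mul_cancel_left₀ hk]
    rw [hb']
    have e3 : -((-1 - k : ℤ) : ℂ) = (k : ℂ) + 1 := by push_cast; ring
    rw [e3]
    simp only [smul_sub, smul_add, smul_smul]
    rw [inv_mul_cancel₀ hk, one_smul, pow_succ]
    module

theorem brTerm_skew {p q : ℚ} {a b : V} (ha : a ∈ sector g p) (hb : b ∈ sector g q) :
    brTerm p q a b + brTerm q p b a ∈ (twLoop g).map (loopD V) := by
  obtain ⟨N, hN⟩ := exists_trunc a b
  obtain ⟨N', hN'⟩ := exists_trunc b a
  rw [brTerm_eq _ _ _ _ (2 * (N + N')) (fun i hi => hN _ (by omega)),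
    brTerm_eq _ _ _ _ (N + N') (fun i hi => hN' _ (by omega))]
  let G : ℕ → ℕ → Loop V := fun j k =>
    ((-1) ^ j * bin q j * bin (p + q - j) k) •
      Finsupp.single (p + q - j - k) (md ((j : ℤ) + k) a b)
  have hG : ∑ i ∈ Finset.range (2 * (N + N')), bin p i • Finsupp.single (p + q - i) (md i a b) =
      ∑ j ∈ Finset.range (N + N'), ∑ k ∈ Finset.range (N + N'), G j k := by
    rw [← sum_antidiag_box]
    · refine Finset.sum_congr rfl fun n _ => ?_
      rw [← sum_bin_mul_bin p q n, Finset.sum_smul]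
      refine Finset.sum_congr rfl fun x hx => ?_
      have hx' : x.1 + x.2 = n := by simpa using hx
      simp only [G]
      have e : p + q - (n : ℚ) = p + q - x.1 - x.2 := by rw [← hx']; push_cast; ring
      have e' : (n : ℤ) = x.1 + x.2 := by rw [← hx']; push_cast; ring
      rw [e, e']
    · intro j k h
      simp only [G]
      rw [hN _ (by omega)]; simp
  rw [hG, ← Finset.sum_add_distrib]
  refine Submodule.sum_mem _ fun j _ => ?_
  rw [skew a b j (N + N') (fun i hi => hN i (by omega)), Finsupp.single_finsetSum,
    Finset.smul_sum, ← Finset.sum_add_distrib]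
  refine Submodule.sum_mem _ fun k _ => ?_
  have hc : md ((j : ℤ) + k) a b ∈ sector g (p + q - j) := by
    have := sector_sub_int g (p + q) j
    rw [Int.cast_natCast] at this
    rw [this]
    exact md_mem_sector g ha hb _
  have h := Submodule.smul_mem _ (bin q j * (-1 : ℂ) ^ (j + k + 1)) (shift_mem g _ k _ hc)
  convert h using 1
  simp only [G]
  rw [← Finsupp.smul_single, add_comm q p, smul_sub, smul_smul, smul_smul]
  have e : bin q j * (-1 : ℂ) ^ (j + k + 1) * ((-1) ^ k * bin (p + q - j) k) =
      -((-1) ^ j * bin q j * bin (p + q - j) k) := by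
    have : (-1 : ℂ) ^ k * (-1) ^ k = 1 := by rw [← mul_pow]; simp
    rw [pow_succ, pow_add]
    linear_combination (-(bin q j * (-1) ^ j * bin (p + q - j) k)) * this
  rw [e, neg_smul, sub_neg_eq_add, add_comm]

theorem Vg.mk_skew (x y : twLoop g) : Vg.mk g (twBr g x y) + Vg.mk g (twBr g y x) = 0 := by
  rw [← map_add, Vg.mk_eq_zero]
  have h : loopBr x.1 y.1 + loopBr y.1 x.1 ∈ (twLoop g).map (loopD V) := by
    rw [loopBr_eq_sum, loopBr_eq_sum, Finset.sum_comm (s := y.1.support),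
      ← Finset.sum_add_distrib]
    refine Submodule.sum_mem _ fun p _ => ?_
    rw [← Finset.sum_add_distrib]
    exact Submodule.sum_mem _ fun q _ => brTerm_skew g (x.2 p) (y.2 q)
  obtain ⟨z, hz, hz'⟩ := h
  exact ⟨⟨z, hz⟩, Subtype.ext hz'⟩

instance : LieRing (Vg g) where
  bracket x y := Vg.br g x y
  add_lie x y z := by simp
  lie_add x y z := by simp
  lie_self x := by
    obtain ⟨x, rfl⟩ := Vg.mk_surjective g x
    change Vg.br g _ _ = 0
    rw [Vg.br_mk]
    have h := Vg.mk_skew g x x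
    rw [← two_smul ℂ] at h
    exact (smul_eq_zero.1 h).resolve_left two_ne_zero
  leibniz_lie x y z := by
    obtain ⟨x, rfl⟩ := Vg.mk_surjective g x
    obtain ⟨y, rfl⟩ := Vg.mk_surjective g y
    obtain ⟨z, rfl⟩ := Vg.mk_surjective g z
    change Vg.br g _ (Vg.br g _ _) = Vg.br g (Vg.br g _ _) _ + Vg.br g _ (Vg.br g _ _)
    simp only [Vg.br_mk, ← map_add]
    congr 1
    exact Subtype.ext (loopBr_leibniz x.1 y.1 z.1)

instance : LieAlgebra ℂ (Vg g) where
  lie_smul c x y := by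
    change Vg.br g _ _ = c • Vg.br g _ _
    rw [map_smul]

/-- The element `v(m) = t^m ⊗ v + D ℒ(V, g)` of `V[g]`, with the convention that, for `v` in an
eigenspace of `g`, `v(m) = 0` unless `t^m ⊗ v` lies in `ℒ(V, g)`; extended linearly in `v`. -/
def vmode (m : ℚ) : V →ₗ[ℂ] Vg g :=
  Vg.mk g ∘ₗ LinearMap.codRestrict (twLoop g) (Finsupp.lsingle m ∘ₗ proj g m)
    (fun v => single_mem_twLoop g (proj_mem g m v))

theorem vmode_of_mem {m : ℚ} {v : V} (hv : v ∈ sector g m) :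
    vmode g m v = Vg.mk g ⟨Finsupp.single m v, single_mem_twLoop g hv⟩ := by
  simp [vmode, LinearMap.codRestrict, proj_of_mem g hv]

theorem loopBr_single_eq (p q : ℚ) (a b : V) :
    loopBr (Finsupp.single p a) (Finsupp.single q b) =
      ∑ᶠ i : ℕ, bin p i • Finsupp.single (p + q - i) (md (i : ℤ) a b) :=
  loopBr_single p q a b

/-- The homogeneous subspace `V[g]_d`, where `deg (t^m ⊗ a) = wt a - m - 1`. -/
def VgDeg (d : ℚ) : Submodule ℂ (Vg g) :=
  Submodule.span ℂ {x | ∃ (n : ℤ) (m : ℚ) (a : V),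
    a ∈ wtSpace V n ∧ a ∈ sector g m ∧ (n : ℚ) - m - 1 = d ∧ x = vmode g m a}

/-! ### The algebra `A_g(V)` and its modules -/

/-- `δ_r`, which is `1` if `r = 0` and `0` otherwise. -/
def del (r : ℕ) : ℕ := if r = 0 then 1 else 0

/-- The exponent `wt u - 1 + δ_r + r/T` for `u ∈ V^r` of weight `n`. -/
def cexp (n : ℤ) (r : ℕ) : ℚ := n - 1 + del r + r / g.T

/-- The product `u ∘_g v = Res_z (1+z)^(wt u - 1 + δ_r + r/T) z^(-1-δ_r) Y(u, z) v`, for `u ∈ V^r` of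
weight `n`. -/
def circ (n : ℤ) (r : ℕ) (u v : V) : V :=
  ∑ᶠ i : ℕ, bin (cexp g n r) i • md ((i : ℤ) - 1 - del r) u v

/-- The product `u *_g v` for `u ∈ V^r` of weight `n`: it is `Res_z (1+z)^(wt u) z⁻¹ Y(u, z) v` if
`r = 0`, and `0` if `r > 0`. -/
def star (n : ℤ) (r : ℕ) (u v : V) : V :=
  if r = 0 then ∑ᶠ i : ℕ, bin n i • md ((i : ℤ) - 1) u v else 0

/-- The subspace `O_g(V)`, spanned by all `u ∘_g v`. -/
def Og : Submodule ℂ V :=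
  Submodule.span ℂ {x | ∃ (n : ℤ) (r : ℕ) (u v : V),
    r < g.T ∧ u ∈ wtSpace V n ∧ u ∈ Vr g r ∧ x = circ g n r u v}

/-- The underlying space of the associative algebra `A_g(V) = V / O_g(V)`. -/
abbrev Ag : Type _ := V ⧸ Og g

/-- The class of a vector in `A_g(V)`. -/
abbrev Ag.mk : V →ₗ[ℂ] Ag g := (Og g).mkQ

/-- A module over the associative algebra `A_g(V)` (product induced by `*_g`, unit the class of the
vacuum) on a vector space `U`, as a unital representation. Since homogeneous vectors of the `V^r`
span `V`, and `*_g` is defined by linear extension from these, it is enough to ask multiplicativity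
for them. -/
structure AgModule (U : Type*) [AddCommGroup U] [Module ℂ U] where
  /-- the action of `A_g(V)` -/
  act : Ag g →ₗ[ℂ] Module.End ℂ U
  act_one : act (Ag.mk g (vac V)) = 1
  act_mul : ∀ (n : ℤ) (r : ℕ) (u v : V), r < g.T → u ∈ wtSpace V n → u ∈ Vr g r →
    act (Ag.mk g (star n r u v)) = act (Ag.mk g u) * act (Ag.mk g v)

/-! ### Twisted modules -/

section Modules

variable {M N : Type*} [AddCommGroup M] [Module ℂ M] [AddCommGroup N] [Module ℂ N]

/-- `M` is a weak `g`-twisted `V`-module with the vertex operators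
`Y_M(v, z) = ∑_{m ∈ ℚ} v_m z^(-m-1)`, where `v_m = Y v m`. The twisted Jacobi identity is stated by
its coefficients, the coefficient of `z₀^(-l-1) z₁^(-m-1) z₂^(-n-1)`, where `m ∈ r/T + ℤ` (the other
coefficients vanish on both sides); all sums are finite because of the truncation condition. -/
structure IsWeakTwisted (Y : V →ₗ[ℂ] ℚ → Module.End ℂ M) : Prop where
  exponents : ∀ r < g.T, ∀ u ∈ Vr g r, ∀ m : ℚ, (¬ ∃ k : ℤ, m = r / g.T + k) → Y u m = 0
  truncation : ∀ (v : V) (w : M), ∃ B : ℚ, ∀ l : ℚ, B ≤ l → Y v l w = 0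
  vacuum : ∀ m : ℚ, Y (vac V) m = if m = -1 then 1 else 0
  jacobi : ∀ r < g.T, ∀ u ∈ Vr g r, ∀ (v : V) (w : M) (l : ℤ) (m n : ℚ),
    (∃ k : ℤ, m = r / g.T + k) →
    ∑ᶠ i : ℕ, bin m i • Y (md (l + i) u v) (m + n - i) w =
      ∑ᶠ i : ℕ, ((-1) ^ i * bin l i) •
        (Y u (m + l - i) (Y v (n + i) w) - (-1 : ℂ) ^ l • Y v (n + l - i) (Y u (m + i) w))

/-- `M` with vertex operators `Y` and the grading `M = ⨁ M(q)`, where `M(q) = gr q` and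
`q ∈ (1/T)ℤ_{≥0}`, is an admissible `g`-twisted `V`-module. -/
structure IsAdmissible (Y : V →ₗ[ℂ] ℚ → Module.End ℂ M) (gr : ℚ → Submodule ℂ M) : Prop where
  weak : IsWeakTwisted g Y
  internal : DirectSum.IsInternal gr
  support : ∀ q : ℚ, (¬ ∃ k : ℕ, q = k / g.T) → gr q = ⊥
  degree : ∀ (n : ℤ) (v : V), v ∈ wtSpace V n → ∀ (m q : ℚ) (x : M), x ∈ gr q →
    Y v m x ∈ gr (q + n - m - 1)

/-- `f` is a morphism of weak `g`-twisted modules: `f Y_M(u, z) = Y_N(u, z) f`. -/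
def IsHom (Y : V →ₗ[ℂ] ℚ → Module.End ℂ M) (Y' : V →ₗ[ℂ] ℚ → Module.End ℂ N)
    (f : M →ₗ[ℂ] N) : Prop :=
  ∀ (u : V) (m : ℚ) (x : M), f (Y u m x) = Y' u m (f x)

/-- The space `Ω(M)` of lowest weight vectors, killed by all `v_m` of degree
`wt v - m - 1 < 0`, `v` homogeneous. -/
def Omega (Y : V →ₗ[ℂ] ℚ → Module.End ℂ M) : Submodule ℂ M where
  carrier := {w | ∀ (n : ℤ) (v : V), v ∈ wtSpace V n → ∀ m : ℚ, (n : ℚ) - m - 1 < 0 → Y v m w = 0}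
  add_mem' hx hy n v hv m hm := by rw [map_add, hx n v hv m hm, hy n v hv m hm, add_zero]
  zero_mem' n v hv m hm := map_zero _
  smul_mem' c x hx n v hv m hm := by rw [map_smul, hx n v hv m hm, smul_zero]

/-- `φ` is a morphism of `A_g(V)`-modules `U → Ω(M)`. The class of a homogeneous `a ∈ V^0` of weight
`n` acts on `Ω(M)` by `o(a) = a_{n-1}`, and these classes span `A_g(V)`. -/
structure IsAgHom {g : FinAut V} {U : Type*} [AddCommGroup U] [Module ℂ U] (ρ : AgModule g U)
    (Y : V →ₗ[ℂ] ℚ → Module.End ℂ M) (φ : U →ₗ[ℂ] M) : Prop where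
  mem_Omega : ∀ u : U, φ u ∈ Omega Y
  map_act : ∀ (n : ℤ) (a : V), a ∈ wtSpace V n → a ∈ Vr g 0 → ∀ u : U,
    φ (ρ.act (Ag.mk g a) u) = Y a ((n : ℚ) - 1) (φ u)

end Modules

/-! ### The generalized Verma module -/

/-- The universal enveloping algebra `U(V[g])`. -/
abbrev UVg : Type _ := UniversalEnvelopingAlgebra ℂ (Vg g)

/-- The canonical map `V[g] → U(V[g])`. -/
def uι : Vg g →ₗ[ℂ] UVg g where
  toFun x := UniversalEnvelopingAlgebra.ι ℂ x
  map_add' x y := by simp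
  map_smul' c x := by simp

/-- The image of `v(m)` in `U(V[g])`. -/
def uMode (m : ℚ) : V →ₗ[ℂ] UVg g :=
  uι g ∘ₗ vmode g m

/-- The homogeneous subspace of degree `q` of `U(V[g])`, spanned by the products of homogeneous
elements of `V[g]` of total degree `q`. -/
def uDeg (q : ℚ) : Submodule ℂ (UVg g) :=
  Submodule.span ℂ {x | ∃ l : List (ℚ × Vg g), (∀ p ∈ l, p.2 ∈ VgDeg g p.1) ∧
    (l.map Prod.fst).sum = q ∧ x = (l.map fun p => uι g p.2).prod}

/-- The operators by which the `v(m)` act on a `V[g]`-module, as coefficients of vertex operators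
`Y(v, z) = ∑_m v(m) z^(-m-1)`. -/
def actY (M : Type*) [AddCommGroup M] [Module ℂ M] [Module (UVg g) M]
    [IsScalarTower ℂ (UVg g) M] : V →ₗ[ℂ] ℚ → Module.End ℂ M :=
  LinearMap.pi fun m => (Algebra.lsmul ℂ ℂ M).toLinearMap ∘ₗ uMode g m

variable {g} {U : Type*} [AddCommGroup U] [Module ℂ U] (ρ : AgModule g U)

/-- The `U(V[g])`-submodule of `U(V[g]) ⊗_ℂ U` by which one divides to get the tensor product over
`U(P)`, where `P = V[g]_- ⊕ V[g]_0`. It is generated by the elements `p ⊗ u - 1 ⊗ p u` with `p` in a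
spanning set of `P`; here `p u = 0` for `p ∈ V[g]_-`, and `o(a) = a(wt a - 1) ∈ V[g]_0`, for
homogeneous `a ∈ V^0`, acts on `U` as the class of `a` in `A_g(V)`. -/
def indRel : Submodule (UVg g) (UVg g ⊗[ℂ] U) :=
  Submodule.span (UVg g)
    ({z | ∃ d < 0, ∃ p ∈ VgDeg g d, ∃ u : U, z = uι g p ⊗ₜ[ℂ] u} ∪
     {z | ∃ (n : ℤ) (a : V) (u : U), a ∈ wtSpace V n ∧ a ∈ Vr g 0 ∧
        z = uMode g ((n : ℚ) - 1) a ⊗ₜ[ℂ] u - 1 ⊗ₜ[ℂ] (ρ.act (Ag.mk g a) u)})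

/-- The induced module `M(U) = Ind_P^{V[g]} U = U(V[g]) ⊗_{U(P)} U`. -/
abbrev Verma : Type _ := (UVg g ⊗[ℂ] U) ⧸ indRel ρ

/-- The map `U → M(U)`, `u ↦ 1 ⊗ u`. -/
def vermaIn : U →ₗ[ℂ] Verma ρ :=
  ((indRel ρ).mkQ.restrictScalars ℂ) ∘ₗ (TensorProduct.mk ℂ (UVg g) U 1)

/-- The homogeneous subspace `M(U)(q)`, where `U` has degree `0`. -/
def vermaGr (q : ℚ) : Submodule ℂ (Verma ρ) :=
  Submodule.span ℂ {y | ∃ x ∈ uDeg g q, ∃ u : U, y = x • vermaIn ρ u}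

/-- The coefficient of `z₀^α z₂^β` in
`(z₀+z₂)^c Y(a, z₀+z₂) Y(b, z₂) u - (z₂+z₀)^c Y(Y(a, z₀) b, z₂) u`, where
`c = wt a - 1 + δ_r + r/T`, for `a ∈ V^r` of weight `n`. Here `(z₀+z₂)^s` is expanded in nonnegative
powers of `z₂`, and `(z₂+z₀)^s` in nonnegative powers of `z₀`. -/
def assocCoeff (n : ℤ) (r : ℕ) (a b : V) (u : U) (α : ℤ) (β : ℚ) : Verma ρ :=
  (∑ᶠ i : ℕ, bin (α + i) i •
    actY g (Verma ρ) a (cexp g n r - 1 - α - i)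
      (actY g (Verma ρ) b (i - β - 1) (vermaIn ρ u))) -
  ∑ᶠ i : ℕ, bin (cexp g n r) i •
    actY g (Verma ρ) (md ((i : ℤ) - α - 1) a b) (cexp g n r - i - β - 1) (vermaIn ρ u)

/-- The subspace `W` of `M(U)`, spanned by the coefficients of the associativity relations. -/
def assocRel : Submodule ℂ (Verma ρ) :=
  Submodule.span ℂ {y | ∃ (n : ℤ) (r : ℕ) (a b : V) (u : U) (α : ℤ) (β : ℚ),
    r < g.T ∧ a ∈ wtSpace V n ∧ a ∈ Vr g r ∧ y = assocCoeff ρ n r a b u α β}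

/-- The submodule `U(V[g]) W` of `M(U)`. -/
def assocSub : Submodule (UVg g) (Verma ρ) :=
  Submodule.span (UVg g) (assocRel ρ : Set (Verma ρ))

/-- The generalized Verma module `M̄(U) = M(U) / U(V[g]) W`. -/
abbrev VermaBar : Type _ := Verma ρ ⧸ assocSub ρ

/-- The vertex operators of `M̄(U)`. -/
def barY : V →ₗ[ℂ] ℚ → Module.End ℂ (VermaBar ρ) := actY g (VermaBar ρ)

/-- The grading of `M̄(U)` induced by that of `M(U)`. -/
def barGr (q : ℚ) : Submodule ℂ (VermaBar ρ) :=
  (vermaGr ρ q).map ((assocSub ρ).mkQ.restrictScalars ℂ)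

/-- The natural map `U → M̄(U)`. -/
def barIn : U →ₗ[ℂ] VermaBar ρ := ((assocSub ρ).mkQ.restrictScalars ℂ) ∘ₗ vermaIn ρ

end Twisted

end TwistedVOA

end

noncomputable section

namespace TwistedVOA

open scoped VertexOperator TensorProduct

/-! ### Weights of products, of the vacuum and of the conformal vector -/

section Basic

variable {V : Type*} [AddCommGroup V] [Module ℂ V] [VertexOperatorAlgebra V]

/-! The main difficulty is that `U` survives the passage to `M̄(U)`. For this one constructs a
projection `vermaProj` of `M(U)` onto `U` which is the identity on `U`, is equivariant for `V[g]_0 ⊕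
V[g]_+` (with `V[g]_+` acting on `U` by zero), and kills `U(V[g])W`. No Poincaré–Birkhoff–Witt
theorem is used. Instead `M(U)` is mapped to the module coinduced from `V[g]_0 ⊕ V[g]_+`, realised
as functions on words in `V[g]`, and the result is evaluated at the empty word. The lowest weight
vectors of the coinduced module are the correlation functions `corr`: in a word applied to `u`, the
negative part of the leftmost letter is commuted to the right until it kills `u`. That `U` is a
module for `V[g]_0` rests on the congruence `a * b - b * a ≡ Res (1+z)^(wt a - 1) Y(a,z) b` modulo
`O_g(V)` (`commutator_mem_Og`).

The projection kills `W` (`vermaProj_assocDefect`) because a projected associativity relation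
becomes, according to the power of `z₀`, a consequence of the commutator formula, the product rule
of `A_g(V)`, or the vanishing of a residue lying in `O_g(V)`. Moreover `W` is stable under `V[g]_- ⊕
V[g]_0` (`smul_mem_assocRel`): elements of `V[g]` act as derivations of all products `a_n b`, so an
associativity relation is sent to a combination of such relations. Hence in a word applied to `W`, a
leftmost letter of nonnegative degree can be pulled out of the projection, and one of nonpositive
degree can be moved right and absorbed into `W`. By induction on the length, the projection kills
`U(V[g])W` (`vermaProj_assocSub`), so `U → M̄(U)` is injective.

For the twisted Jacobi identity, associativity holds on `U` by the definition of `M̄(U)` and the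
commutator formula holds everywhere. Together they give the Jacobi identity on `U`
(`IsLocalAction.jacobiDefect_eq_zero_of_assoc`), and the derivation property carries it to the whole
module (`barY_jacobiDefect`).

The grading of `M̄(U)` is direct because its pieces lie in eigenspaces of `ω(1)` minus the module
endomorphism induced by the action of `ω` on `U` (`exists_degree_operator`). The universal property
holds because every weak twisted module is a `V[g]`-module in which lowest weight vectors satisfy
the relations `W`. -/

theorem mem_wtSpace {n : ℤ} {a : V} :
    a ∈ wtSpace V n ↔ md 1 VertexOperatorAlgebra.conf a = (n : ℂ) • a := by
  simp [wtSpace, vir]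

theorem wtSpace_isInternal (V : Type*) [AddCommGroup V] [Module ℂ V] [VertexOperatorAlgebra V] :
    DirectSum.IsInternal (wtSpace V) :=
  VertexOperatorAlgebra.grading

/-- The commutator formula reads `[ω_1, a_n] = (ω_0 a)_{n+1} + (ω_1 a)_n`. Here `ω_0 a = L(-1) a`,
so the first term contributes `-(n+1) a_n` and the second `p a_n`. -/
theorem md_mem_wtSpace {p q : ℤ} {a b : V} (ha : a ∈ wtSpace V p) (hb : b ∈ wtSpace V q) (n : ℤ) :
    md n a b ∈ wtSpace V (p + q - n - 1) := by
  have h := commutator (VertexOperatorAlgebra.conf : V) a b 1 n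
  rw [mem_wtSpace] at ha hb ⊢
  simp only [Finset.sum_range_succ, Finset.range_zero, Finset.sum_empty, zero_add, Nat.cast_one,
    Nat.cast_zero, sub_zero, bin_zero_right, one_smul, ← Lm1_apply, md_Lm1, hb, ha,
    map_smul, LinearMap.smul_apply] at h
  have h1 : bin 1 1 = 1 := by simp [bin]
  rw [h1, one_smul] at h
  have e : 1 + n - 1 = n := by ring
  rw [e, sub_eq_iff_eq_add] at h
  rw [h]
  push_cast
  module

theorem Lm1_mem_wtSpace {p : ℤ} {a : V} (ha : a ∈ wtSpace V p) : Lm1 V a ∈ wtSpace V (p + 1) := by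
  have h := commutator (VertexOperatorAlgebra.conf : V) VertexOperatorAlgebra.conf a 0 1
  have h2 := VertexOperatorAlgebra.virasoro (V := V) 0 (-1) a
  simp only [← md_apply] at h2
  norm_num at h2
  rw [mem_wtSpace] at ha ⊢
  rw [Lm1_apply, sub_eq_iff_eq_add.1 h2, ha, map_smul]
  push_cast
  module

theorem vac_mem_wtSpace : vac V ∈ wtSpace V 0 := by
  rw [mem_wtSpace, Int.cast_zero, zero_smul]
  exact VertexOperatorAlgebra.creation_nonneg _ _ (by norm_num)

/-- The Virasoro relation `[L(0), L(-2)] = 2 L(-2)` is applied to the vacuum, where `L(0) 𝟏 = 0` and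
`L(-2) 𝟏 = ω`. -/
theorem conf_mem_wtSpace : (VertexOperatorAlgebra.conf : V) ∈ wtSpace V 2 := by
  have h2 := VertexOperatorAlgebra.virasoro (V := V) 0 (-2) (vac V)
  have h3 : md 1 (VertexOperatorAlgebra.conf : V) (vac V) = 0 :=
    VertexOperatorAlgebra.creation_nonneg _ _ (by norm_num)
  have h4 : md (-1) (VertexOperatorAlgebra.conf : V) (vac V) = VertexOperatorAlgebra.conf :=
    VertexOperatorAlgebra.creation _
  simp only [← md_apply] at h2
  norm_num [h3, h4] at h2
  rw [mem_wtSpace, h2]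
  norm_num

theorem md_vac_left (n : ℤ) (b : V) : md n (vac V) b = if n = -1 then b else 0 :=
  VertexOperatorAlgebra.vacuum n b

theorem md_neg_one_vac (a : V) : md (-1) a (vac V) = a :=
  VertexOperatorAlgebra.creation a

theorem md_nonneg_vac (a : V) {n : ℤ} (hn : 0 ≤ n) : md n a (vac V) = 0 :=
  VertexOperatorAlgebra.creation_nonneg a n hn

theorem md_neg_two_vac (a : V) : md (-2) a (vac V) = Lm1 V a := by
  have := md_Lm1 (-1) a (vac V)
  rw [md_neg_one_vac] at this
  rw [this]
  norm_num

end Basic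

/-! ### Linear maps and induction on internal direct sums -/

section Internal

theorem exists_linearMap_of_isInternal {ι E F : Type*} [DecidableEq ι] [AddCommGroup E]
    [Module ℂ E] [AddCommGroup F] [Module ℂ F] {A : ι → Submodule ℂ E}
    (h : DirectSum.IsInternal A) (φ : ι → E →ₗ[ℂ] F) :
    ∃ f : E →ₗ[ℂ] F, ∀ i, ∀ x ∈ A i, f x = φ i x := by
  let e := LinearEquiv.ofBijective (DirectSum.coeLinearMap A) h
  refine ⟨(DirectSum.toModule ℂ ι F fun i => φ i ∘ₗ (A i).subtype) ∘ₗ e.symm.toLinearMap,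
    fun i x hx => ?_⟩
  have : e.symm x = DirectSum.lof ℂ ι (fun i => A i) i ⟨x, hx⟩ := by
    rw [LinearEquiv.symm_apply_eq]
    exact (DirectSum.coeLinearMap_lof A i ⟨x, hx⟩).symm
  simp only [LinearMap.comp_apply, LinearEquiv.coe_coe, this, DirectSum.toModule_lof]
  rfl

theorem induction_of_iSup_eq_top {ι E : Type*} [AddCommGroup E] [Module ℂ E]
    {A : ι → Submodule ℂ E} (h : ⨆ i, A i = ⊤) {P : E → Prop} (x : E)
    (mem : ∀ i, ∀ x ∈ A i, P x) (zero : P 0) (add : ∀ x y, P x → P y → P (x + y)) : P x :=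
  Submodule.iSup_induction A (motive := P) (h ▸ Submodule.mem_top : x ∈ ⨆ i, A i) mem zero add

end Internal

/-! ### Projections onto the weight spaces -/

section Weights

variable (V : Type*) [AddCommGroup V] [Module ℂ V] [VertexOperatorAlgebra V]

theorem exists_wtProj (n : ℤ) : ∃ f : V →ₗ[ℂ] V, ∀ i, ∀ x ∈ wtSpace V i,
    f x = (if i = n then LinearMap.id else 0 : V →ₗ[ℂ] V) x :=
  exists_linearMap_of_isInternal (wtSpace_isInternal V) fun i =>
    (if i = n then LinearMap.id else 0 : V →ₗ[ℂ] V)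

/-- The projection of `V` onto the weight space `V_n`. -/
def wtProj (n : ℤ) : V →ₗ[ℂ] V := (exists_wtProj V n).choose

variable {V}

theorem wtProj_of_mem {n i : ℤ} {a : V} (ha : a ∈ wtSpace V i) :
    wtProj V n a = if i = n then a else 0 := by
  rw [wtProj, (exists_wtProj V n).choose_spec i a ha]
  split_ifs <;> simp

theorem wt_induction {P : V → Prop} (x : V) (mem : ∀ n : ℤ, ∀ x ∈ wtSpace V n, P x) (zero : P 0)
    (add : ∀ x y, P x → P y → P (x + y)) : P x :=
  induction_of_iSup_eq_top (wtSpace_isInternal V).submodule_iSup_eq_top x mem zero add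

end Weights

/-! ### Eigenspaces of the automorphism -/

section Sectors

variable {V : Type*} [AddCommGroup V] [Module ℂ V] [VertexOperatorAlgebra V] (g : FinAut V)

theorem sector_add_int (q : ℚ) (n : ℤ) : sector g (q + n) = sector g q := by
  have := sector_sub_int g (q + n) n
  rw [add_sub_cancel_right] at this
  exact this.symm

theorem vac_mem_sector : vac V ∈ sector g 0 := by
  rw [mem_sector, g.map_vac]; simp

theorem conf_mem_sector : (VertexOperatorAlgebra.conf : V) ∈ sector g 0 := by
  rw [mem_sector, g.map_conf]; simp

theorem Vr_zero : Vr g 0 = sector g 0 := by simp [Vr]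

theorem sector_intCast (n : ℤ) : sector g n = sector g 0 := by
  have := sector_add_int g 0 n
  rwa [zero_add] at this

theorem mem_sector_of_Vr {r : ℕ} {a : V} (ha : a ∈ Vr g r) {m : ℚ}
    (hm : ∃ k : ℤ, m = r / g.T + k) : a ∈ sector g m := by
  obtain ⟨k, rfl⟩ := hm
  rw [sector_add_int]
  exact ha

theorem exp_eq_iff (p q : ℚ) : Complex.exp (2 * Real.pi * Complex.I * p) =
    Complex.exp (2 * Real.pi * Complex.I * q) ↔ ∃ k : ℤ, p = q + k := by
  rw [Complex.exp_eq_exp_iff_exists_int]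
  refine exists_congr fun k => ?_
  have hpi : (2 * Real.pi * Complex.I : ℂ) ≠ 0 := Complex.two_pi_I_ne_zero
  constructor
  · intro h
    have : (p : ℂ) = q + k := by
      apply mul_left_cancel₀ hpi
      rw [h]; ring
    exact_mod_cast this
  · intro h
    rw [h]; push_cast; ring

theorem eq_zero_of_mem_sector {p q : ℚ} {a : V} (hp : a ∈ sector g p) (hq : a ∈ sector g q)
    (h : ¬ ∃ k : ℤ, p = q + k) : a = 0 := by
  rw [mem_sector] at hp hq
  rw [hp] at hq
  rw [← exp_eq_iff] at h
  by_contra h0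
  exact h (smul_left_injective ℂ h0 hq)

theorem proj_eq_zero {p q : ℚ} {a : V} (hp : a ∈ sector g p) (h : ¬ ∃ k : ℤ, p = q + k) :
    proj g q a = 0 := by
  refine eq_zero_of_mem_sector g ?_ (proj_mem g q a) h
  unfold proj
  split_ifs with hq
  · rw [LinearMap.smul_apply, LinearMap.sum_apply]
    refine Submodule.smul_mem _ _ (Submodule.sum_mem _ fun j _ => ?_)
    rw [LinearMap.smul_apply, sector_pow g hp]
    exact Submodule.smul_mem _ _ (Submodule.smul_mem _ _ hp)
  · exact Submodule.zero_mem _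

/-- The coefficient of `g^j a` in the sum is `T⁻¹ ∑_r ζ^(-jr)` with `ζ` a primitive `T`-th root of
unity. It is a vanishing geometric sum unless `j = 0`. -/
theorem sum_proj (a : V) : ∑ r ∈ Finset.range g.T, proj g ((r : ℚ) / g.T) a = a := by
  have hT : (g.T : ℂ) ≠ 0 := by exact_mod_cast g.T_pos.ne'
  have hTq : (g.T : ℚ) ≠ 0 := by exact_mod_cast g.T_pos.ne'
  set ζ := Complex.exp (2 * Real.pi * Complex.I / g.T) with hζ
  have hprim : IsPrimitiveRoot ζ g.T := Complex.isPrimitiveRoot_exp g.T g.T_pos.ne'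
  have h1 : ∀ r : ℕ, proj g ((r : ℚ) / g.T) a = (g.T : ℂ)⁻¹ • ∑ j ∈ Finset.range g.T,
      (ζ ^ j)⁻¹ ^ r • ((g.toEquiv : Module.End ℂ V) ^ j) a := by
    intro r
    unfold proj
    rw [if_pos ⟨r, by field_simp; simp⟩, LinearMap.smul_apply, LinearMap.sum_apply]
    congr 1
    refine Finset.sum_congr rfl fun j _ => ?_
    rw [LinearMap.smul_apply]
    congr 1
    have : Complex.exp (2 * Real.pi * Complex.I * ((r / g.T : ℚ) : ℂ)) = ζ ^ r := by
      rw [hζ, ← Complex.exp_nat_mul]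
      congr 1
      push_cast
      ring
    rw [this, ← pow_mul, inv_pow, ← pow_mul, mul_comm]
  simp only [h1]
  rw [← Finset.smul_sum, Finset.sum_comm]
  simp only [← Finset.sum_smul]
  rw [Finset.sum_eq_single 0]
  · simp [smul_smul, inv_mul_cancel₀ hT, ← Nat.cast_smul_eq_nsmul ℂ]
  · intro j hj hj0
    have hj' : j < g.T := by simpa using hj
    have hne : (ζ ^ j)⁻¹ ≠ 1 := by
      rw [ne_eq, inv_eq_one]
      exact hprim.pow_ne_one_of_pos_of_lt hj0 hj'
    have : ∑ r ∈ Finset.range g.T, (ζ ^ j)⁻¹ ^ r = 0 := by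
      rw [geom_sum_eq hne, inv_pow, ← pow_mul, mul_comm, pow_mul, hprim.pow_eq_one]
      simp
    rw [this, zero_smul]
  · intro h
    exact absurd (Finset.mem_range.2 g.T_pos) h

theorem map_mem_wtSpace {n : ℤ} {a : V} (ha : a ∈ wtSpace V n) : g.toEquiv a ∈ wtSpace V n := by
  rw [mem_wtSpace] at ha ⊢
  have := g.map_md 1 VertexOperatorAlgebra.conf a
  rw [g.map_conf] at this
  rw [← this, ha, map_smul]

theorem proj_mem_wtSpace {n : ℤ} {a : V} (ha : a ∈ wtSpace V n) (q : ℚ) :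
    proj g q a ∈ wtSpace V n := by
  unfold proj
  split_ifs with hq
  · rw [LinearMap.smul_apply, LinearMap.sum_apply]
    refine Submodule.smul_mem _ _ (Submodule.sum_mem _ fun j _ => Submodule.smul_mem _ _ ?_)
    clear * - ha
    induction j with
    | zero => simpa using ha
    | succ j ih =>
      rw [pow_succ', Module.End.mul_apply]
      exact map_mem_wtSpace g ih
  · exact Submodule.zero_mem _

/-- Since `g` fixes `ω`, its eigenprojections preserve weights, so the two decompositions of `V`
have a common refinement. -/
theorem homogeneous_induction {P : V → Prop} (x : V)
    (mem : ∀ (n : ℤ) (r : ℕ), r < g.T → ∀ x ∈ wtSpace V n, x ∈ Vr g r → P x) (zero : P 0)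
    (add : ∀ x y, P x → P y → P (x + y)) : P x := by
  refine wt_induction x (fun n x hx => ?_) zero add
  rw [← sum_proj g x]
  have : ∀ N ≤ g.T, P (∑ r ∈ Finset.range N, proj g ((r : ℚ) / g.T) x) := by
    intro N
    induction N with
    | zero => intro _; simpa using zero
    | succ N ih =>
      intro hN
      rw [Finset.sum_range_succ]
      exact add _ _ (ih (by omega)) (mem n N (by omega) _ (proj_mem_wtSpace g hx _) (proj_mem g _ _))
  exact this _ le_rfl

/-- A vector of weight `n` in the eigenspace for `e^{2πiq}`, `q` a rational number, lies in one of
the `V^r`, with `q ∈ r/T + ℤ`, or vanishes. -/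
theorem sector_cases {q : ℚ} {a : V} (ha : a ∈ sector g q) :
    a = 0 ∨ ∃ r < g.T, a ∈ Vr g r ∧ ∃ k : ℤ, q = r / g.T + k := by
  by_cases h : ∃ k : ℤ, q * g.T = k
  · right
    obtain ⟨k, hk⟩ := h
    have hT : (g.T : ℤ) ≠ 0 := by exact_mod_cast g.T_pos.ne'
    have hTq : (g.T : ℚ) ≠ 0 := by exact_mod_cast g.T_pos.ne'
    have h1 := Int.emod_nonneg k hT
    have h2 := Int.emod_lt_of_pos k (by exact_mod_cast g.T_pos : (0 : ℤ) < g.T)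
    have h3 : q = ((k % g.T).toNat : ℚ) / g.T + ((k / g.T : ℤ) : ℚ) := by
      have e : (((k % g.T).toNat : ℤ) : ℚ) = ((k % g.T : ℤ) : ℚ) := by rw [Int.toNat_of_nonneg h1]
      rw [Int.cast_natCast] at e
      rw [e, div_add' _ _ _ hTq, eq_div_iff hTq, hk]
      exact_mod_cast (Int.emod_add_ediv_mul k g.T).symm
    refine ⟨(k % g.T).toNat, by omega, ?_, _, h3⟩
    unfold Vr
    rw [← sector_add_int g _ (k / g.T), ← h3]
    exact ha
  · left
    rw [sector_eq_bot g h] at ha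
    exact (Submodule.mem_bot ℂ).1 ha

end Sectors

/-! ### Recursions for binomial coefficients -/

section Binomials

theorem succ_mul_bin (q : ℚ) (i : ℕ) : ((i : ℂ) + 1) * bin q (i + 1) = (q - i) * bin q i := by
  have := bin_mul_bin q (i + 1) i (by omega)
  rw [bin_natCast, Nat.choose_succ_self_right] at this
  have e2 : bin (q - i) (i + 1 - i) = q - i := by simp [bin]
  rw [e2] at this
  push_cast at this
  linear_combination this

theorem bin_add_one (q : ℚ) (i : ℕ) : bin (q + 1) (i + 1) = bin q (i + 1) + bin q i := by
  have hi : ((i : ℂ) + 1) ≠ 0 := by exact_mod_cast Nat.succ_ne_zero i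
  apply mul_left_cancel₀ hi
  have h1 := bin_succ_mul (q + 1) i
  have h2 := succ_mul_bin q i
  rw [add_sub_cancel_right] at h1
  push_cast at h1
  linear_combination h1 - h2

theorem bin_one_right (q : ℚ) : bin q 1 = q := by simp [bin]

end Binomials

/-! ### Residues of vertex operators -/

section Residues

variable {V : Type*} [AddCommGroup V] [Module ℂ V] [VertexOperatorAlgebra V]

/-- The residue `Res_z (1+z)^c z^(-k) Y(a, z) b`. -/
def resid (c : ℚ) (k : ℤ) (a b : V) : V := ∑ᶠ i : ℕ, bin c i • md ((i : ℤ) - k) a b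

theorem resid_eq (c : ℚ) (k : ℤ) (a b : V) (N : ℕ)
    (hN : ∀ i : ℕ, N ≤ i → md ((i : ℤ) - k) a b = 0) :
    resid c k a b = ∑ i ∈ Finset.range N, bin c i • md ((i : ℤ) - k) a b :=
  finsum_eq_range _ N fun i hi => by rw [hN i hi, smul_zero]

theorem exists_trunc_shift (k : ℤ) (a b : V) :
    ∃ N : ℕ, ∀ i : ℤ, (N : ℤ) ≤ i → md (i - k) a b = 0 := by
  obtain ⟨N, hN⟩ := exists_trunc a b
  refine ⟨N + k.toNat, fun i hi => hN _ ?_⟩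
  have := Int.self_le_toNat k
  push_cast at hi
  omega

/-- This is `(1+z)^(c+1) z^(-k-1) = (1+z)^c z^(-k-1) + (1+z)^c z^(-k)` under the residue. -/
theorem resid_succ (c : ℚ) (k : ℤ) (a b : V) :
    resid (c + 1) (k + 1) a b = resid c (k + 1) a b + resid c k a b := by
  obtain ⟨N, hN⟩ := exists_trunc_shift (k + 1) a b
  rw [resid_eq _ _ _ _ (N + 1) (fun i hi => hN _ (by omega)),
    resid_eq _ _ _ _ (N + 1) (fun i hi => hN _ (by omega)),
    resid_eq c k a b N (fun i hi => by
      have := hN (i + 1) (by omega)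
      rwa [add_sub_add_right_eq_sub] at this)]
  rw [Finset.sum_range_succ' _ N, Finset.sum_range_succ' _ N]
  simp only [bin_add_one, bin_zero_right, add_smul, Finset.sum_add_distrib]
  have : ∀ i : ℕ, ((i + 1 : ℕ) : ℤ) - (k + 1) = i - k := by intro i; push_cast; ring
  simp only [this]
  abel

/-- Integration by parts: `Y(L(-1)a, z)` is the derivative of `Y(a, z)`, and a derivative has
residue zero. -/
theorem resid_Lm1 (c : ℚ) (k : ℤ) (a b : V) :
    resid (c + 1) k (Lm1 V a) b =
      (k : ℂ) • resid (c + 1) (k + 1) a b - ((c : ℂ) + 1) • resid c k a b := by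
  obtain ⟨N, hN⟩ := exists_trunc_shift (k + 1) a b
  rw [resid_eq _ _ _ _ (N + 1) (fun i hi => by
      rw [md_Lm1, sub_sub, hN _ (by omega), smul_zero]),
    resid_eq _ _ _ _ (N + 1) (fun i hi => hN _ (by omega)),
    resid_eq c k a b N (fun i hi => by
      have := hN (i + 1) (by omega)
      rwa [add_sub_add_right_eq_sub] at this)]
  have h : ∀ i : ℕ, bin (c + 1) i • md ((i : ℤ) - k) (Lm1 V a) b =
      (k : ℂ) • bin (c + 1) i • md ((i : ℤ) - (k + 1)) a b -
        ((i : ℂ) * bin (c + 1) i) • md ((i : ℤ) - (k + 1)) a b := by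
    intro i
    rw [md_Lm1, sub_sub, smul_smul, smul_smul, ← sub_smul]
    congr 1
    push_cast
    ring
  simp only [h, Finset.sum_sub_distrib, ← Finset.smul_sum]
  congr 1
  rw [Finset.sum_range_succ' _ N, Finset.smul_sum]
  simp only [Nat.cast_zero, zero_mul, zero_smul, add_zero]
  refine Finset.sum_congr rfl fun i _ => ?_
  have e : ((i + 1 : ℕ) : ℤ) - (k + 1) = i - k := by push_cast; ring
  have h2 := bin_succ_mul (c + 1) i
  rw [add_sub_cancel_right] at h2
  rw [e, smul_smul]
  congr 1
  push_cast at h2 ⊢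
  exact h2

/-- These are the coefficients of `Y(b,z)a = e^{zL(-1)} Y(a,-z)b`, with `L(-1)^k x / k!` written as
`x_{-1-k} 𝟏`. They come from the Jacobi identity applied to the vacuum. Negative `j` is needed for
the product of `A_g(V)`, which involves `b_{-1} a`. -/
theorem skew_int (a b : V) (j : ℤ) (N : ℕ) (hN : ∀ k : ℕ, N ≤ k → md (j + k) a b = 0) :
    md j b a = ∑ k ∈ Finset.range N, (-1 : ℂ) ^ (j + k + 1) •
      md (-1 - k) (md (j + k) a b) (vac V) := by
  have h := VertexOperatorAlgebra.jacobi a b (vac V) j (-1) 0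
  rw [finsum_eq_range _ N, finsum_eq_range _ 1] at h
  · have h1 : ∀ n : ℕ, bin (-1) n = (-1) ^ n := by
      intro n
      rw [bin_neg 1 n, show (1 + n - 1 : ℚ) = n by ring, bin_natCast]; simp
    simp only [← md_apply, Finset.range_one, Finset.sum_singleton, Int.cast_neg, Int.cast_one, h1,
      bin_zero_right] at h
    have hc : md 0 b (vac V) = 0 := md_nonneg_vac b le_rfl
    simp only [Nat.cast_zero, add_zero, sub_zero, pow_zero, one_mul,
      one_smul, zero_add, md_neg_one_vac] at h
    rw [hc, map_zero, zero_sub] at h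
    have h3 : md j b a = (-1 : ℂ) ^ (j + 1) • -((-1 : ℂ) ^ j • md j b a) := by
      rw [smul_neg, smul_smul, ← neg_smul, ← zpow_add₀ (by norm_num : (-1 : ℂ) ≠ 0),
        show j + 1 + j = 2 * j + 1 by ring, zpow_add₀ (by norm_num : (-1 : ℂ) ≠ 0), zpow_mul]
      simp
    rw [h3, ← h, Finset.smul_sum]
    refine Finset.sum_congr rfl fun k _ => ?_
    rw [smul_smul, ← zpow_natCast, ← zpow_add₀ (by norm_num : (-1 : ℂ) ≠ 0)]
    congr 2
    ring
  · intro i hi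
    have h1 : ((VertexOperatorAlgebra.Y b)[[(0 : ℤ) + i]]) (vac V) = 0 :=
      VertexOperatorAlgebra.creation_nonneg b _ (by omega)
    have h2 : ((VertexOperatorAlgebra.Y a)[[(-1 : ℤ) + i]]) (vac V) = 0 :=
      VertexOperatorAlgebra.creation_nonneg a _ (by omega)
    rw [h1, h2]; simp
  · intro i hi
    rw [← md_apply, ← md_apply, hN _ hi]; simp

end Residues

/-! ### Congruences modulo `O_g(V)` and commutators in `A_g(V)` -/

section ZhuAlgebra

variable {V : Type*} [AddCommGroup V] [Module ℂ V] [VertexOperatorAlgebra V] (g : FinAut V)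

theorem circ_eq_resid (n : ℤ) (r : ℕ) (u v : V) :
    circ g n r u v = resid (cexp g n r) (1 + del r) u v := by
  simp only [circ, resid, sub_sub]

theorem cexp_zero (n : ℤ) : cexp g n 0 = n := by simp [cexp, del]

theorem cexp_succ (n : ℤ) (r : ℕ) : cexp g (n + 1) r = cexp g n r + 1 := by
  simp only [cexp]; push_cast; ring

theorem star_zero_eq_resid (n : ℤ) (u v : V) : star n 0 u v = resid n 1 u v := by
  simp [star, resid]

theorem Lm1_mem_Vr {r : ℕ} {a : V} (ha : a ∈ Vr g r) : Lm1 V a ∈ Vr g r :=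
  Lm1_mem_sector g ha

variable {g}

/-- Zhu's argument that poles of higher order also give elements of `O_g(V)`: replacing `a` by
`L(-1)a` raises the order by one through integration by parts. -/
theorem resid_mem_Og {r : ℕ} (hr : r < g.T) (b : V) (k : ℕ) : ∀ {n : ℤ} {a : V}, a ∈ wtSpace V n →
    a ∈ Vr g r → resid (cexp g n r) (1 + del r + k) a b ∈ Og g := by
  induction k with
  | zero =>
    intro n a ha hr'
    rw [Nat.cast_zero, add_zero, ← circ_eq_resid]
    exact Submodule.subset_span ⟨n, r, a, b, hr, ha, hr', rfl⟩
  | succ k ih =>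
    intro n a ha hr'
    have h1 := ih ha hr'
    -- With `c` the exponent for `a`, the exponent for `L(-1)a` is `c + 1`. With `K` the current
    -- pole order, `h2` becomes `K Res_{K+1} + (K - c - 1) Res_K ∈ O_g(V)`, where both residues have
    -- exponent `c` and `K ≥ 1` can be divided out.
    have h2 := ih (Lm1_mem_wtSpace ha) (Lm1_mem_Vr g hr')
    rw [cexp_succ, resid_Lm1, resid_succ, smul_add] at h2
    set K : ℤ := 1 + del r + k with hK
    have hK0 : (K : ℂ) ≠ 0 := by
      rw [Int.cast_ne_zero]; omega
    have e : (1 + del r + ((k + 1 : ℕ) : ℤ) : ℤ) = K + 1 := by push_cast; ring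
    rw [e]
    rw [← Submodule.smul_mem_iff _ hK0]
    have h3 := Submodule.add_mem _ h2 (Submodule.smul_mem _ ((cexp g n r : ℂ) + 1 - K) h1)
    convert h3 using 1
    module

/-- For `r ≠ 0` one has `δ_r = 0`, so `a ∘_g 𝟏` reduces to `a_{-1} 𝟏 = a`. -/
theorem mem_Og_of_pos {r : ℕ} (hr : r < g.T) (h0 : r ≠ 0) {n : ℤ} {a : V} (ha : a ∈ wtSpace V n)
    (har : a ∈ Vr g r) : a ∈ Og g := by
  have h := resid_mem_Og hr (vac V) 0 ha har
  rw [resid_eq _ _ _ _ 1] at h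
  · simpa [del, h0, bin_zero_right, md_neg_one_vac] using h
  · intro i hi
    simp only [del, h0, if_false]
    exact md_nonneg_vac _ (by push_cast; omega)

/-- For `r = 0` the pole has order two, so `a ∘_g 𝟏 = a_{-2} 𝟏 + n a_{-1} 𝟏`. -/
theorem Lm1_add_mem_Og {n : ℤ} {a : V} (ha : a ∈ wtSpace V n) (ha0 : a ∈ Vr g 0) :
    Lm1 V a + (n : ℂ) • a ∈ Og g := by
  have h := resid_mem_Og g.T_pos (vac V) 0 ha ha0
  rw [resid_eq _ _ _ _ 2] at h
  · simp only [Finset.sum_range_succ, Finset.range_zero, Finset.sum_empty, zero_add,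
      bin_zero_right, one_smul, bin_one_right, cexp_zero] at h
    simpa [del, md_neg_one_vac, md_neg_two_vac] using h
  · intro i hi
    simp only [del, if_true]
    exact md_nonneg_vac _ (by push_cast; omega)

theorem md_mem_Vr_zero {a b : V} (ha : a ∈ Vr g 0) (hb : b ∈ Vr g 0) (n : ℤ) :
    md n a b ∈ Vr g 0 := by
  rw [Vr_zero] at *
  have := md_mem_sector g ha hb n
  rwa [add_zero] at this

theorem vac_mem_Vr : vac V ∈ Vr g 0 := by
  rw [Vr_zero]; exact vac_mem_sector g

/-- The vector on the left is `L(-1)^k c / k!`. Modulo `O_g(V)` each `L(-1)` acts as minus the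
weight, which grows by one at every step, so the factors are `-p, -p-1, …`. -/
theorem md_vac_sub_mem_Og {p : ℤ} {c : V} (hc : c ∈ wtSpace V p) (hc0 : c ∈ Vr g 0) (k : ℕ) :
    md (-1 - k) c (vac V) - bin (-p) k • c ∈ Og g := by
  induction k with
  | zero => simp [md_neg_one_vac, bin_zero_right]
  | succ k ih =>
    have h1 : md (-1 - k) c (vac V) ∈ wtSpace V (p + k) := by
      have := md_mem_wtSpace hc vac_mem_wtSpace (-1 - k)
      convert this using 2
      ring
    have h2 := Lm1_add_mem_Og h1 (md_mem_Vr_zero hc0 vac_mem_Vr _)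
    rw [Lm1_md, Lm1_vac, map_zero, add_zero] at h2
    have hk : ((k : ℂ) + 1) ≠ 0 := by exact_mod_cast Nat.succ_ne_zero k
    rw [← Submodule.smul_mem_iff _ hk]
    have h3 := Submodule.sub_mem _ h2 (Submodule.smul_mem _ ((p : ℂ) + k) ih)
    convert h3 using 1
    have e1 : (-1 - k : ℤ) - 1 = -1 - ((k + 1 : ℕ) : ℤ) := by push_cast; ring
    rw [e1, smul_sub, smul_smul, succ_mul_bin]
    push_cast
    module

/-- In `Y(b,z)a = e^{zL(-1)} Y(a,-z)b` the operator `e^{zL(-1)}` may be replaced by `(1+z)^(-wt)`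
modulo `O_g(V)`. The substitution `z ↦ -z/(1+z)` then turns `(1+z)^m / z` into `(1+z)^(n-1) / z`. In
coefficients this is an upper negation followed by Vandermonde's identity. -/
theorem star_swap_mem_Og {n m : ℤ} {a b : V} (ha : a ∈ wtSpace V n) (ha0 : a ∈ Vr g 0)
    (hb : b ∈ wtSpace V m) (hb0 : b ∈ Vr g 0) :
    resid m 1 b a - resid (n - 1) 1 a b ∈ Og g := by
  obtain ⟨N₁, h₁⟩ := exists_trunc_shift 1 a b
  obtain ⟨N₂, h₂⟩ := exists_trunc_shift 1 b a
  set N := N₁ + N₂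
  rw [resid_eq _ _ _ _ N (fun i hi => h₂ _ (by omega)),
    resid_eq _ _ _ _ (2 * N) (fun i hi => h₁ _ (by omega))]
  let G : ℕ → ℕ → V := fun i k =>
    (bin m i * (-1) ^ (i + k) * bin (i + k - n - m) k) • md ((i : ℤ) + k - 1) a b
  have hG : ∑ s ∈ Finset.range (2 * N), bin (n - 1) s • md ((s : ℤ) - 1) a b =
      ∑ i ∈ Finset.range N, ∑ k ∈ Finset.range N, G i k := by
    rw [← sum_antidiag_box]
    · refine Finset.sum_congr rfl fun s _ => ?_
      -- Upper negation gives `(-1)^s (n-1 choose s) = (s-n choose s)`. Vandermonde is applied to `s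
      -- - n = m + (s-n-m)`, where `s-n-m` is minus the weight of `a_{s-1} b`.
      have e : bin (n - 1) s = ∑ x ∈ Finset.HasAntidiagonal.antidiagonal s,
          bin m x.1 * (-1) ^ s * bin (s - n - m) x.2 := by
        have h1 := bin_add m (s - n - m) s
        have h2 := bin_neg (n - s) s
        rw [show -((n : ℚ) - s) = m + (s - n - m) by ring,
          show (n : ℚ) - s + s - 1 = n - 1 by ring, h1] at h2
        have h3 : ((-1 : ℂ) ^ s) * (-1) ^ s = 1 := by rw [← mul_pow]; simp
        calc bin (n - 1) s = (-1) ^ s * ((-1) ^ s * bin (n - 1) s) := by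
              rw [← mul_assoc, h3, one_mul]
          _ = _ := by
              rw [← h2, Finset.mul_sum]
              exact Finset.sum_congr rfl fun x _ => by ring
      rw [e, Finset.sum_smul]
      refine Finset.sum_congr rfl fun x hx => ?_
      have hx' : x.1 + x.2 = s := by simpa using hx
      simp only [G]
      have e1 : (s : ℤ) = x.1 + x.2 := by rw [← hx']; push_cast; ring
      have e2 : (s : ℚ) = x.1 + x.2 := by rw [← hx']; push_cast; ring
      rw [e1, e2, hx']
    · intro i k h
      simp only [G]
      rw [h₁ _ (by omega), smul_zero]
  rw [hG, ← Finset.sum_sub_distrib]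
  refine Submodule.sum_mem _ fun i _ => ?_
  rw [skew_int a b (i - 1) N (fun k hk => by
    have := h₁ (i + k) (by omega)
    rwa [show (i : ℤ) - 1 + k = i + k - 1 by ring]), Finset.smul_sum, ← Finset.sum_sub_distrib]
  refine Submodule.sum_mem _ fun k _ => ?_
  have hw := md_mem_wtSpace ha hb (i - 1 + k)
  have h := Submodule.smul_mem _ (bin m i * (-1) ^ (i + k))
    (md_vac_sub_mem_Og hw (md_mem_Vr_zero ha0 hb0 _) k)
  convert h using 1
  simp only [G]
  rw [show (i : ℤ) - 1 + k + 1 = ((i + k : ℕ) : ℤ) by push_cast; ring, zpow_natCast, smul_sub,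
    smul_smul, smul_smul, show (i : ℤ) - 1 + k = i + k - 1 by ring]
  congr 4
  push_cast
  ring

/-- The two products are given by `(1+z)^n / z` and, by `star_swap_mem_Og`, by `(1+z)^(n-1) / z`.
The difference of these kernels is `(1+z)^(n-1)`. -/
theorem commutator_mem_Og {n m : ℤ} {a b : V} (ha : a ∈ wtSpace V n) (ha0 : a ∈ Vr g 0)
    (hb : b ∈ wtSpace V m) (hb0 : b ∈ Vr g 0) :
    star n 0 a b - star m 0 b a - resid (n - 1) 0 a b ∈ Og g := by
  rw [star_zero_eq_resid, star_zero_eq_resid]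
  have h := resid_succ (n - 1) 0 a b
  rw [sub_add_cancel, zero_add] at h
  rw [h]
  have h2 := Submodule.neg_mem _ (star_swap_mem_Og ha ha0 hb hb0)
  convert h2 using 1
  abel

variable {U : Type*} [AddCommGroup U] [Module ℂ U] (ρ : AgModule g U)

theorem AgModule.act_eq_zero {a : V} (h : a ∈ Og g) : ρ.act (Ag.mk g a) = 0 := by
  have : Ag.mk g a = 0 := (Submodule.Quotient.mk_eq_zero _).2 h
  rw [this, map_zero]

/-- The residue on the right is `∑ (n-1 choose i) a_i b`, the combination that appears in the
bracket of `a(n-1)` and `b(m-1)`. This is why an `A_g(V)`-module is a module for the Lie algebra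
`V[g]_0`. -/
theorem AgModule.act_commutator {n m : ℤ} {a b : V} (ha : a ∈ wtSpace V n) (ha0 : a ∈ Vr g 0)
    (hb : b ∈ wtSpace V m) (hb0 : b ∈ Vr g 0) :
    ρ.act (Ag.mk g a) * ρ.act (Ag.mk g b) - ρ.act (Ag.mk g b) * ρ.act (Ag.mk g a) =
      ρ.act (Ag.mk g (resid (n - 1) 0 a b)) := by
  have h := ρ.act_eq_zero (commutator_mem_Og ha ha0 hb hb0)
  rw [map_sub, map_sub, map_sub, map_sub, sub_eq_zero] at h
  rw [← h, ρ.act_mul n 0 a b g.T_pos ha ha0, ρ.act_mul m 0 b a g.T_pos hb hb0]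

end ZhuAlgebra

/-! ### The graded Lie algebra `V[g]` -/

section LieAlgebra

variable {V : Type*} [AddCommGroup V] [Module ℂ V] [VertexOperatorAlgebra V] (g : FinAut V)

theorem vmode_eq_zero {s q : ℚ} {a : V} (ha : a ∈ sector g s) (h : ¬ ∃ k : ℤ, s = q + k) :
    vmode g q a = 0 := by
  have h0 : (⟨Finsupp.single q (proj g q a), single_mem_twLoop g (proj_mem g q a)⟩ : twLoop g) =
      0 := Subtype.ext (by simp [proj_eq_zero g ha h])
  change Vg.mk g ⟨Finsupp.single q (proj g q a), single_mem_twLoop g (proj_mem g q a)⟩ = 0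
  rw [h0, map_zero]

theorem vmode_proj (q : ℚ) (a : V) : vmode g q (proj g q a) = vmode g q a := by
  rw [vmode_of_mem g (proj_mem g q a)]
  rfl

theorem Vg.induction {P : Vg g → Prop} (x : Vg g)
    (mem : ∀ (n : ℤ) (m : ℚ) (a : V), a ∈ wtSpace V n → a ∈ sector g m → P (vmode g m a))
    (zero : P 0) (add : ∀ x y, P x → P y → P (x + y)) : P x := by
  obtain ⟨⟨f, hf⟩, rfl⟩ := Vg.mk_surjective g x
  have key : ∀ q a, P (vmode g q a) := by
    intro q a
    refine wt_induction (P := fun a => P (vmode g q a)) a (fun n a ha => ?_) (by rwa [map_zero])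
      (fun a b h h' => by rw [map_add]; exact add _ _ h h')
    rw [← vmode_proj]
    exact mem n q _ (proj_mem_wtSpace g ha q) (proj_mem g q a)
  have h : Vg.mk g ⟨f, hf⟩ = ∑ q ∈ f.support, vmode g q (f q) := by
    have : (⟨f, hf⟩ : twLoop g) =
        ∑ q ∈ f.support, ⟨Finsupp.single q (f q), single_mem_twLoop g (hf q)⟩ := by
      apply Subtype.ext
      rw [AddSubmonoidClass.coe_finsetSum]
      exact (Finsupp.sum_single f).symm
    rw [this, map_sum]
    exact Finset.sum_congr rfl fun q _ => (vmode_of_mem g (hf q)).symm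
  rw [h]
  induction f.support using Finset.induction_on with
  | empty => simpa using zero
  | insert q s hq ih => rw [Finset.sum_insert hq]; exact add _ _ (key _ _) ih

theorem vmode_Lm1 (m : ℚ) (a : V) : vmode g m (Lm1 V a) = (-(m : ℂ)) • vmode g (m - 1) a := by
  refine homogeneous_induction g (P := fun a =>
      vmode g m (Lm1 V a) = (-(m : ℂ)) • vmode g (m - 1) a) a (fun n r _ a _ ha => ?_) (by simp)
    (fun a b h h' => by simp only [map_add, h, h', smul_add])
  by_cases h : ∃ k : ℤ, m = r / g.T + k
  · have hm := mem_sector_of_Vr g ha h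
    have hm' : a ∈ sector g (m - 1) := by
      have := sector_sub_int g m 1
      rw [Int.cast_one] at this
      rwa [this]
    rw [vmode_of_mem g hm', vmode_of_mem g (Lm1_mem_sector g hm), ← map_smul, ← sub_eq_zero,
      ← map_sub, Vg.mk_eq_zero]
    refine ⟨⟨Finsupp.single m a, single_mem_twLoop g hm⟩, Subtype.ext ?_⟩
    change loopD V (Finsupp.single m a) = Finsupp.single m (Lm1 V a) -
      (-(m : ℂ)) • Finsupp.single (m - 1) a
    rw [loopD_single]
    module
  · have h1 : ¬ ∃ k : ℤ, (r / g.T : ℚ) = m + k := by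
      rintro ⟨k, hk⟩; exact h ⟨-k, by rw [hk]; push_cast; ring⟩
    have h2 : ¬ ∃ k : ℤ, (r / g.T : ℚ) = m - 1 + k := by
      rintro ⟨k, hk⟩; exact h ⟨1 - k, by rw [hk]; push_cast; ring⟩
    rw [vmode_eq_zero g ha h2, vmode_eq_zero g (Lm1_mem_sector g ha) h1, smul_zero]

/-- Only `a` has to lie in the eigenspace belonging to its exponent. A component of `b` in a wrong
eigenspace gives zero on both sides, since `a_i b` is then in a wrong eigenspace as well. -/
theorem lie_vmode {p : ℚ} (q : ℚ) {a : V} (ha : a ∈ sector g p) (b : V) (N : ℕ)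
    (hN : ∀ i : ℕ, N ≤ i → md i a b = 0) :
    ⁅vmode g p a, vmode g q b⁆ =
      ∑ i ∈ Finset.range N, bin p i • vmode g (p + q - i) (md i a b) := by
  have key : ∃ N₀ : ℕ, ∀ N' ≥ N₀, ⁅vmode g p a, vmode g q b⁆ =
      ∑ i ∈ Finset.range N', bin p i • vmode g (p + q - i) (md i a b) := by
    refine homogeneous_induction g (P := fun b => ∃ N₀ : ℕ, ∀ N' ≥ N₀,
      ⁅vmode g p a, vmode g q b⁆ =
        ∑ i ∈ Finset.range N', bin p i • vmode g (p + q - i) (md i a b)) b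
      (fun n r _ b _ hb => ?_) ⟨0, fun N' _ => by simp⟩ ?_
    · obtain ⟨N₀, h₀⟩ := exists_trunc a b
      refine ⟨N₀, fun N' hN' => ?_⟩
      by_cases h : ∃ k : ℤ, q = r / g.T + k
      · have hq := mem_sector_of_Vr g hb h
        have hi : ∀ i : ℕ, md i a b ∈ sector g (p + q - i) := fun i => by
          have := sector_sub_int g (p + q) i
          rw [Int.cast_natCast] at this
          rw [this]
          exact md_mem_sector g ha hq _
        rw [vmode_of_mem g ha, vmode_of_mem g hq]
        simp only [vmode_of_mem g (hi _), ← map_smul, ← map_sum]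
        change Vg.mk g (twBr g _ _) = _
        congr 1
        apply Subtype.ext
        rw [AddSubmonoidClass.coe_finsetSum]
        change loopBr (Finsupp.single p a) (Finsupp.single q b) = _
        rw [loopBr_single, brTerm_eq _ _ _ _ N' (fun i hi => h₀ _ (by omega))]
        rfl
      · have h1 : ¬ ∃ k : ℤ, (r / g.T : ℚ) = q + k := by
          rintro ⟨k, hk⟩; exact h ⟨-k, by rw [hk]; push_cast; ring⟩
        rw [vmode_eq_zero g hb h1, lie_zero]
        symm
        refine Finset.sum_eq_zero fun i _ => ?_
        have h2 : ¬ ∃ k : ℤ, (p + r / g.T : ℚ) = p + q - i + k := by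
          rintro ⟨k, hk⟩
          exact h1 ⟨k - i, by push_cast; linear_combination hk⟩
        rw [vmode_eq_zero g (md_mem_sector g ha hb _) h2, smul_zero]
    · rintro b b' ⟨N₁, h₁⟩ ⟨N₂, h₂⟩
      refine ⟨N₁ + N₂, fun N' hN' => ?_⟩
      simp only [map_add, lie_add, smul_add, Finset.sum_add_distrib]
      rw [h₁ N' (by omega), h₂ N' (by omega)]
  obtain ⟨N₀, h₀⟩ := key
  rw [h₀ (N + N₀) (by omega)]
  symm
  apply Finset.sum_subset (Finset.range_mono (by omega))
  intro i _ hi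
  rw [hN i (by simpa using hi), map_zero, smul_zero]

theorem vmode_mem_VgDeg {n : ℤ} {a : V} (ha : a ∈ wtSpace V n) (m : ℚ) :
    vmode g m a ∈ VgDeg g (n - m - 1) := by
  rw [← vmode_proj]
  exact Submodule.subset_span ⟨n, m, _, proj_mem_wtSpace g ha m, proj_mem g m a, rfl, rfl⟩

theorem lie_mem_VgDeg {d e : ℚ} {x y : Vg g} (hx : x ∈ VgDeg g d) (hy : y ∈ VgDeg g e) :
    ⁅x, y⁆ ∈ VgDeg g (d + e) := by
  induction hx using Submodule.span_induction with
  | zero => rw [zero_lie]; exact Submodule.zero_mem _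
  | add x x' _ _ h h' => rw [add_lie]; exact Submodule.add_mem _ h h'
  | smul c x _ h => rw [smul_lie]; exact Submodule.smul_mem _ _ h
  | mem x hx =>
    obtain ⟨n, p, a, han, hap, rfl, rfl⟩ := hx
    induction hy using Submodule.span_induction with
    | zero => rw [lie_zero]; exact Submodule.zero_mem _
    | add x x' _ _ h h' => rw [lie_add]; exact Submodule.add_mem _ h h'
    | smul c x _ h => rw [lie_smul]; exact Submodule.smul_mem _ _ h
    | mem y hy =>
      obtain ⟨m, q, b, hbm, hbq, rfl, rfl⟩ := hy
      obtain ⟨N, hN⟩ := exists_trunc a b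
      rw [lie_vmode g q hap b N (fun i hi => hN _ (by omega))]
      refine Submodule.sum_mem _ fun i _ => Submodule.smul_mem _ _ ?_
      convert vmode_mem_VgDeg g (md_mem_wtSpace han hbm i) (p + q - i) using 2
      push_cast
      ring

/-- The element `ω(1)` of `V[g]`, whose adjoint action is the degree. -/
def eul : Vg g := vmode g 1 VertexOperatorAlgebra.conf

theorem conf_mem_sector_one : (VertexOperatorAlgebra.conf : V) ∈ sector g 1 := by
  have := sector_intCast g 1
  rw [Int.cast_one] at this
  rw [this]
  exact conf_mem_sector g

/-- Only two terms of the bracket survive: `[ω(1), a(m)] = (L(-1)a)(m+1) + (L(0)a)(m)`, and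
`(L(-1)a)(m+1) = -(m+1) a(m)`. -/
theorem eul_lie {d : ℚ} {x : Vg g} (hx : x ∈ VgDeg g d) : ⁅eul g, x⁆ = (d : ℂ) • x := by
  induction hx using Submodule.span_induction with
  | zero => simp
  | add x x' _ _ h h' => rw [lie_add, h, h', smul_add]
  | smul c x _ h => rw [lie_smul, h, smul_comm]
  | mem x hx =>
    obtain ⟨n, m, a, han, ham, rfl, rfl⟩ := hx
    obtain ⟨N, hN⟩ := exists_trunc VertexOperatorAlgebra.conf a
    rw [eul, lie_vmode g m (conf_mem_sector_one g) a (N + 2) (fun i hi => hN _ (by omega)),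
      ← Finset.sum_subset (Finset.range_mono (by omega : 2 ≤ N + 2))]
    · have h1 := (mem_wtSpace).1 han
      simp only [Finset.sum_range_succ, Finset.range_zero, Finset.sum_empty, zero_add,
        bin_zero_right, one_smul, bin_one_right, Nat.cast_zero, Nat.cast_one, h1, ← Lm1_apply,
        vmode_Lm1, map_smul]
      rw [show (1 + m - 0 - 1 : ℚ) = m by ring, show (1 + m - 1 : ℚ) = m by ring, Rat.cast_one,
        one_smul, ← add_smul]
      congr 1
      push_cast
      ring
    · intro i _ hi
      have hi' : 1 < i := by simpa using hi
      have : bin 1 i = 0 := by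
        have h := bin_natCast 1 i
        rw [Nat.cast_one, Nat.choose_eq_zero_of_lt (by omega), Nat.cast_zero] at h
        exact h
      rw [this, zero_smul]

/-- The graded pieces of `V[g]` and of `M̄(U)` are given as spans inside quotients, so their
independence is not visible from the definition. It is obtained from a degree operator, as
eigenspaces are independent. -/
theorem iSupIndep_of_le_eigenspace {E : Type*} [AddCommGroup E] [Module ℂ E]
    (f : Module.End ℂ E) (A : ℚ → Submodule ℂ E) (h : ∀ d, A d ≤ f.eigenspace (d : ℂ)) :
    iSupIndep A :=
  (f.eigenspaces_iSupIndep.comp (Rat.cast_injective (α := ℂ))).mono h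

theorem iSup_VgDeg : ⨆ d, VgDeg g d = ⊤ := by
  rw [eq_top_iff]
  intro x _
  refine Vg.induction g (P := fun x => x ∈ ⨆ d, VgDeg g d) x (fun n m a ha _ => ?_)
    (Submodule.zero_mem _) (fun x y => Submodule.add_mem _)
  exact Submodule.mem_iSup_of_mem _ (vmode_mem_VgDeg g ha m)

theorem VgDeg_isInternal : DirectSum.IsInternal (VgDeg g) := by
  refine DirectSum.isInternal_submodule_of_iSupIndep_of_iSup_eq_top
    (iSupIndep_of_le_eigenspace (LieAlgebra.ad ℂ (Vg g) (eul g)) _ fun d x hx => ?_)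
    (iSup_VgDeg g)
  rw [Module.End.mem_eigenspace_iff]
  exact eul_lie g hx

theorem Vg.homogeneous_induction {P : Vg g → Prop} (x : Vg g)
    (mem : ∀ d, ∀ x ∈ VgDeg g d, P x) (zero : P 0) (add : ∀ x y, P x → P y → P (x + y)) : P x :=
  induction_of_iSup_eq_top (iSup_VgDeg g) x mem zero add

theorem exists_negPart : ∃ f : Vg g →ₗ[ℂ] Vg g, ∀ d, ∀ x ∈ VgDeg g d,
    f x = (if d < 0 then LinearMap.id else 0 : Vg g →ₗ[ℂ] Vg g) x :=
  exists_linearMap_of_isInternal (VgDeg_isInternal g) fun d =>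
    (if d < 0 then LinearMap.id else 0 : Vg g →ₗ[ℂ] Vg g)

/-- The projection of `V[g]` onto `V[g]_-` along `V[g]_0 ⊕ V[g]_+`. -/
def negPart : Vg g →ₗ[ℂ] Vg g := (exists_negPart g).choose

theorem negPart_of_neg {d : ℚ} (hd : d < 0) {x : Vg g} (hx : x ∈ VgDeg g d) :
    negPart g x = x := by
  rw [negPart, (exists_negPart g).choose_spec d x hx, if_pos hd, LinearMap.id_apply]

theorem negPart_of_nonneg {d : ℚ} (hd : 0 ≤ d) {x : Vg g} (hx : x ∈ VgDeg g d) :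
    negPart g x = 0 := by
  rw [negPart, (exists_negPart g).choose_spec d x hx, if_neg (not_lt.2 hd), LinearMap.zero_apply]

theorem VgDeg_eq_bot {d : ℚ} (hd : ¬ ∃ k : ℤ, d = k / g.T) : VgDeg g d = ⊥ := by
  rw [eq_bot_iff]
  refine Submodule.span_le.2 ?_
  rintro _ ⟨n, m, a, han, ham, rfl, rfl⟩
  have hT : (g.T : ℚ) ≠ 0 := by exact_mod_cast g.T_pos.ne'
  rw [sector_eq_bot g] at ham
  · rw [(Submodule.mem_bot ℂ).1 ham, map_zero]; exact Submodule.zero_mem _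
  · rintro ⟨k, hk⟩
    apply hd
    refine ⟨(n - 1) * g.T - k, ?_⟩
    rw [eq_div_iff hT]
    push_cast
    linear_combination -hk

end LieAlgebra

/-! ### The action of `V[g]_0` on `U` -/

section ZeroMode

variable {V : Type*} [AddCommGroup V] [Module ℂ V] [VertexOperatorAlgebra V] {g : FinAut V}

theorem wtProj_mem_wtSpace (n : ℤ) (a : V) : wtProj V n a ∈ wtSpace V n := by
  refine wt_induction (P := fun a => wtProj V n a ∈ wtSpace V n) a (fun i a ha => ?_)
    (by simp) (fun a b h h' => by rw [map_add]; exact Submodule.add_mem _ h h')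
  rw [wtProj_of_mem ha]
  split_ifs with h
  · exact h ▸ ha
  · exact Submodule.zero_mem _

theorem wtProj_mem_sector {q : ℚ} {a : V} (ha : a ∈ sector g q) (n : ℤ) :
    wtProj V n a ∈ sector g q := by
  rw [mem_sector] at ha ⊢
  rw [← map_smul, ← ha]
  refine wt_induction (P := fun a => g.toEquiv (wtProj V n a) = wtProj V n (g.toEquiv a)) a
    (fun i a ha => ?_) (by simp) (fun a b h h' => by simp only [map_add, h, h'])
  rw [wtProj_of_mem ha, wtProj_of_mem (map_mem_wtSpace g ha)]
  split_ifs <;> simp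

theorem wtProj_Lm1 (n : ℤ) (a : V) : wtProj V (n + 1) (Lm1 V a) = Lm1 V (wtProj V n a) := by
  refine wt_induction (P := fun a => wtProj V (n + 1) (Lm1 V a) = Lm1 V (wtProj V n a)) a
    (fun i a ha => ?_) (by simp) (fun a b h h' => by simp only [map_add, h, h'])
  rw [wtProj_of_mem ha, wtProj_of_mem (Lm1_mem_wtSpace ha)]
  simp only [add_left_inj]
  split_ifs <;> simp

variable {U : Type*} [AddCommGroup U] [Module ℂ U] (ρ : AgModule g U)

/-- The map `t^q ⊗ a ↦ [a_{q+1}]`, where `[a_{q+1}]` is the action on `U` of the class in `A_g(V)`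
of the component of `a` of weight `q + 1`. -/
def zeroLoop : Loop V →ₗ[ℂ] Module.End ℂ U :=
  Finsupp.lsum ℂ fun q : ℚ =>
    if (⌊q⌋ : ℚ) = q then ρ.act ∘ₗ Ag.mk g ∘ₗ wtProj V (⌊q⌋ + 1) else 0

theorem zeroLoop_intCast (n : ℤ) (a : V) : zeroLoop ρ (Finsupp.single (n : ℚ) a) =
    ρ.act (Ag.mk g (wtProj V (n + 1) a)) := by
  simp [zeroLoop]

theorem zeroLoop_of_ne {q : ℚ} (hq : (⌊q⌋ : ℚ) ≠ q) (a : V) :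
    zeroLoop ρ (Finsupp.single q a) = 0 := by
  simp [zeroLoop, hq]

/-- For `t^n ⊗ a` with `n` an integer, only the weight `n` component `a_n` of `a` matters, and `D`
produces the class of `n a_n + L(-1) a_n`. This lies in `O_g(V)` because membership in `ℒ(V, g)`
puts `a` in `V^0`. For other exponents both terms of `D` have non-integral exponent. -/
theorem zeroLoop_D {x : Loop V} (hx : x ∈ twLoop g) : zeroLoop ρ (loopD V x) = 0 := by
  rw [← Finsupp.sum_single x, Finsupp.sum, map_sum, map_sum]
  refine Finset.sum_eq_zero fun q _ => ?_
  have ha := hx q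
  rw [loopD_single, map_add, map_smul]
  by_cases hq : (⌊q⌋ : ℚ) = q
  · set n := ⌊q⌋ with hn
    rw [← hq] at ha ⊢
    have e : (n : ℚ) - 1 = ((n - 1 : ℤ) : ℚ) := by push_cast; ring
    rw [e, zeroLoop_intCast, zeroLoop_intCast, sub_add_cancel, wtProj_Lm1, ← map_smul,
      ← map_smul, ← map_add, ← map_add]
    apply ρ.act_eq_zero
    rw [add_comm]
    have h := Lm1_add_mem_Og (wtProj_mem_wtSpace n (x n)) (g := g) (by
      rw [sector_intCast] at ha
      rw [Vr_zero]
      exact wtProj_mem_sector ha n)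
    rwa [Rat.cast_intCast]
  · have h1 : (⌊q - 1⌋ : ℚ) ≠ q - 1 := by
      rw [Int.floor_sub_one]; push_cast
      intro h; exact hq (by linear_combination h)
    rw [zeroLoop_of_ne ρ hq, zeroLoop_of_ne ρ h1, smul_zero, add_zero]

/-- The action of `V[g]` on `U` by which `V[g]_0` acts through `A_g(V)`, and the other homogeneous
components act as `0`. -/
def zeroMode : Vg g →ₗ[ℂ] Module.End ℂ U :=
  Submodule.liftQ _ (zeroLoop ρ ∘ₗ (twLoop g).subtype) (by
    rintro _ ⟨x, rfl⟩
    rw [LinearMap.mem_ker]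
    exact zeroLoop_D ρ x.2)

theorem zeroMode_mk (x : twLoop g) : zeroMode ρ (Vg.mk g x) = zeroLoop ρ x.1 := rfl

theorem zeroMode_vmode {n : ℤ} {a : V} (ha : a ∈ wtSpace V n) (ha0 : a ∈ Vr g 0) :
    zeroMode ρ (vmode g ((n : ℚ) - 1) a) = ρ.act (Ag.mk g a) := by
  have e : (n : ℚ) - 1 = ((n - 1 : ℤ) : ℚ) := by push_cast; ring
  have h : a ∈ sector g ((n : ℚ) - 1) := by
    rw [e, sector_intCast, ← Vr_zero]; exact ha0
  rw [vmode_of_mem g h, zeroMode_mk]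
  change zeroLoop ρ (Finsupp.single _ a) = _
  rw [e, zeroLoop_intCast, sub_add_cancel, wtProj_of_mem ha, if_pos rfl]

theorem zeroMode_of_ne {d : ℚ} (hd : d ≠ 0) {x : Vg g} (hx : x ∈ VgDeg g d) :
    zeroMode ρ x = 0 := by
  induction hx using Submodule.span_induction with
  | zero => simp
  | add x x' _ _ h h' => rw [map_add, h, h', add_zero]
  | smul c x _ h => rw [map_smul, h, smul_zero]
  | mem x hx =>
    obtain ⟨n, m, a, han, ham, rfl, rfl⟩ := hx
    rw [vmode_of_mem g ham, zeroMode_mk]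
    change zeroLoop ρ (Finsupp.single _ a) = _
    by_cases hq : (⌊m⌋ : ℚ) = m
    · rw [← hq, zeroLoop_intCast, wtProj_of_mem han, if_neg, map_zero, map_zero]
      rintro rfl
      apply hd
      rw [← hq]; simp
    · rw [zeroLoop_of_ne ρ hq]

theorem exists_of_mem_VgDeg_zero {P : Vg g → Prop} {x : Vg g} (hx : x ∈ VgDeg g 0)
    (mem : ∀ (n : ℤ) (a : V), a ∈ wtSpace V n → a ∈ Vr g 0 → P (vmode g ((n : ℚ) - 1) a))
    (zero : P 0) (add : ∀ x y, P x → P y → P (x + y)) (smul : ∀ (c : ℂ) x, P x → P (c • x)) :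
    P x := by
  induction hx using Submodule.span_induction with
  | zero => exact zero
  | add x x' _ _ h h' => exact add _ _ h h'
  | smul c x _ h => exact smul _ _ h
  | mem x hx =>
    obtain ⟨n, m, a, han, ham, hm, rfl⟩ := hx
    have e : m = (n : ℚ) - 1 := by linarith
    rw [e] at ham ⊢
    refine mem n a han ?_
    rw [Vr_zero, ← sector_intCast g (n - 1)]
    push_cast
    exact ham

theorem zeroMode_lie_zero {x y : Vg g} (hx : x ∈ VgDeg g 0) (hy : y ∈ VgDeg g 0) :
    zeroMode ρ ⁅x, y⁆ = zeroMode ρ x * zeroMode ρ y - zeroMode ρ y * zeroMode ρ x := by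
  refine exists_of_mem_VgDeg_zero (P := fun x => zeroMode ρ ⁅x, y⁆ =
    zeroMode ρ x * zeroMode ρ y - zeroMode ρ y * zeroMode ρ x) hx (fun n a ha ha0 => ?_) (by simp)
    (fun x x' h h' => by rw [add_lie, map_add, h, h', map_add]; noncomm_ring)
    (fun c x h => by
      rw [smul_lie, map_smul, h, map_smul, smul_mul_assoc, mul_smul_comm, smul_sub])
  refine exists_of_mem_VgDeg_zero (P := fun y => zeroMode ρ ⁅vmode g ((n : ℚ) - 1) a, y⁆ =
    zeroMode ρ (vmode g ((n : ℚ) - 1) a) * zeroMode ρ y -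
      zeroMode ρ y * zeroMode ρ (vmode g ((n : ℚ) - 1) a)) hy (fun m b hb hb0 => ?_) (by simp)
    (fun x x' h h' => by rw [lie_add, map_add, h, h', map_add]; noncomm_ring)
    (fun c x h => by
      rw [lie_smul, map_smul, h, map_smul, smul_mul_assoc, mul_smul_comm, smul_sub])
  rw [zeroMode_vmode ρ ha ha0, zeroMode_vmode ρ hb hb0, ρ.act_commutator ha ha0 hb hb0]
  obtain ⟨N, hN⟩ := exists_trunc a b
  rw [lie_vmode g _ _ b N (fun i hi => hN _ (by omega)),
    resid_eq _ _ _ _ N (fun i hi => hN _ (by omega))]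
  · simp only [map_sum, map_smul]
    refine Finset.sum_congr rfl fun i _ => ?_
    rw [sub_zero, ← zeroMode_vmode ρ (md_mem_wtSpace ha hb i) (md_mem_Vr_zero ha0 hb0 _)]
    congr 4
    push_cast
    ring
  · rw [show (n : ℚ) - 1 = ((n - 1 : ℤ) : ℚ) by push_cast; ring, sector_intCast, ← Vr_zero]
    exact ha0

/-- The fact that `V[g]_0 ⊕ V[g]_+` acts on `U` is put in a form valid for all `x` and `y`, with a
correction through `negPart`. On homogeneous elements it is checked by the signs of the degrees. The
only case with content is degree zero for both. -/
theorem zeroMode_lie (x y : Vg g) :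
    zeroMode ρ x * zeroMode ρ y - zeroMode ρ y * zeroMode ρ x +
      zeroMode ρ (⁅negPart g x, y⁆ + ⁅x, negPart g y⁆) = zeroMode ρ ⁅x, y⁆ := by
  refine Vg.homogeneous_induction g (P := fun x =>
    zeroMode ρ x * zeroMode ρ y - zeroMode ρ y * zeroMode ρ x +
      zeroMode ρ (⁅negPart g x, y⁆ + ⁅x, negPart g y⁆) = zeroMode ρ ⁅x, y⁆) x (fun d x hx => ?_) (by simp) (fun x x' h h' => by
    rw [show zeroMode ρ ⁅x + x', y⁆ = zeroMode ρ ⁅x, y⁆ + zeroMode ρ ⁅x', y⁆ by rw [add_lie, map_add],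
      ← h, ← h']
    simp only [map_add, add_lie]
    noncomm_ring)
  refine Vg.homogeneous_induction g (P := fun y =>
    zeroMode ρ x * zeroMode ρ y - zeroMode ρ y * zeroMode ρ x +
      zeroMode ρ (⁅negPart g x, y⁆ + ⁅x, negPart g y⁆) = zeroMode ρ ⁅x, y⁆) y (fun e y hy => ?_) (by simp) (fun y y' h h' => by
    rw [show zeroMode ρ ⁅x, y + y'⁆ = zeroMode ρ ⁅x, y⁆ + zeroMode ρ ⁅x, y'⁆ by rw [lie_add, map_add],
      ← h, ← h']
    simp only [map_add, lie_add]
    noncomm_ring)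
  have hxy := lie_mem_VgDeg g hx hy
  rcases lt_or_ge d 0 with hd | hd <;> rcases lt_or_ge e 0 with he | he
  · rw [negPart_of_neg g hd hx, negPart_of_neg g he hy, map_add,
      zeroMode_of_ne ρ (by linarith) hxy, zeroMode_of_ne ρ hd.ne hx]
    simp
  · rw [negPart_of_neg g hd hx, negPart_of_nonneg g he hy, zeroMode_of_ne ρ hd.ne hx]
    simp
  · rw [negPart_of_nonneg g hd hx, negPart_of_neg g he hy, zeroMode_of_ne ρ he.ne hy]
    simp
  · rw [negPart_of_nonneg g hd hx, negPart_of_nonneg g he hy, zero_lie, lie_zero, add_zero,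
      map_zero, add_zero]
    rcases hd.eq_or_lt with rfl | hd
    · rcases he.eq_or_lt with rfl | he
      · exact (zeroMode_lie_zero ρ hx hy).symm
      · rw [zeroMode_of_ne ρ (by linarith) hxy, zeroMode_of_ne ρ he.ne' hy]; simp
    · rw [zeroMode_of_ne ρ (by linarith) hxy, zeroMode_of_ne ρ hd.ne' hx]; simp

/-- A Rota–Baxter identity. It expresses that both the image `V[g]_-` and the kernel `V[g]_0 ⊕
V[g]_+` of the projection are subalgebras. -/
theorem negPart_lie (x y : Vg g) :
    negPart g (⁅negPart g x, y⁆ + ⁅x, negPart g y⁆) - ⁅negPart g x, negPart g y⁆ =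
      negPart g ⁅x, y⁆ := by
  refine Vg.homogeneous_induction g (P := fun x =>
    negPart g (⁅negPart g x, y⁆ + ⁅x, negPart g y⁆) - ⁅negPart g x, negPart g y⁆ =
      negPart g ⁅x, y⁆) x (fun d x hx => ?_) (by simp) (fun x x' h h' => by
    rw [show negPart g ⁅x + x', y⁆ = negPart g ⁅x, y⁆ + negPart g ⁅x', y⁆ by rw [add_lie, map_add],
      ← h, ← h']
    simp only [map_add, add_lie]
    abel)
  refine Vg.homogeneous_induction g (P := fun y =>
    negPart g (⁅negPart g x, y⁆ + ⁅x, negPart g y⁆) - ⁅negPart g x, negPart g y⁆ =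
      negPart g ⁅x, y⁆) y (fun e y hy => ?_) (by simp) (fun y y' h h' => by
    rw [show negPart g ⁅x, y + y'⁆ = negPart g ⁅x, y⁆ + negPart g ⁅x, y'⁆ by rw [lie_add, map_add],
      ← h, ← h']
    simp only [map_add, lie_add]
    abel)
  have hxy := lie_mem_VgDeg g hx hy
  rcases lt_or_ge d 0 with hd | hd <;> rcases lt_or_ge e 0 with he | he
  · rw [negPart_of_neg g hd hx, negPart_of_neg g he hy, map_add,
      negPart_of_neg g (by linarith) hxy]
    simp
  · rw [negPart_of_neg g hd hx, negPart_of_nonneg g he hy]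
    simp
  · rw [negPart_of_nonneg g hd hx, negPart_of_neg g he hy]
    simp
  · rw [negPart_of_nonneg g hd hx, negPart_of_nonneg g he hy,
      negPart_of_nonneg g (by linarith) hxy]
    simp

end ZeroMode

/-! ### Functions on words and the adjoint action -/

section Words

variable {L A : Type*} [LieRing L] [AddCommGroup A]

/-- The sum over the positions of the word `w = x₁ ⋯ xₙ` of the values of `F` at the words obtained
from `w` by replacing `x_j` by `[y, x_j]`. -/
def adSum (y : L) : (List L → A) → List L → A
  | _, [] => 0
  | F, x :: w => F (⁅y, x⁆ :: w) + adSum y (fun v => F (x :: v)) w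

theorem adSum_nil (y : L) (F : List L → A) : adSum y F [] = 0 := rfl

theorem adSum_cons (y x : L) (F : List L → A) (w : List L) :
    adSum y F (x :: w) = F (⁅y, x⁆ :: w) + adSum y (fun v => F (x :: v)) w := rfl

/-- Substituting a bracket for a letter preserves the length. This is what allows `corr` to be
defined by recursion on the length. -/
theorem adSum_congr (y : L) (w : List L) : ∀ {F G : List L → A},
    (∀ v, v.length = w.length → F v = G v) → adSum y F w = adSum y G w := by
  induction w with
  | nil => intro F G _; rfl
  | cons x w ih =>
    intro F G h
    rw [adSum_cons, adSum_cons, h _ (by simp), ih fun v hv => h _ (by simp [hv])]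

theorem adSum_add (y : L) (w : List L) : ∀ F G : List L → A,
    adSum y (fun v => F v + G v) w = adSum y F w + adSum y G w := by
  induction w with
  | nil => intro F G; simp [adSum_nil]
  | cons x w ih =>
    intro F G
    simp only [adSum_cons, ih (fun v => F (x :: v)) (fun v => G (x :: v))]
    abel

theorem adSum_append (y x : L) (w : List L) : ∀ F : List L → A,
    adSum y F (w ++ [x]) = adSum y (fun v => F (v ++ [x])) w + F (w ++ [⁅y, x⁆]) := by
  induction w with
  | nil => intro F; simp [adSum_nil, adSum_cons]
  | cons z w ih =>
    intro F
    simp only [List.cons_append, adSum_cons, ih fun v => F (z :: v)]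
    abel

/-- On words of length `n`, `F` respects the relations `xy - yx = [x, y]` of the enveloping
algebra. -/
def WordLie (n : ℕ) (F : List L → A) : Prop :=
  ∀ (v w : List L) (x y : L), v.length + w.length + 2 = n →
    F (v ++ x :: y :: w) - F (v ++ y :: x :: w) = F (v ++ ⁅x, y⁆ :: w)

theorem WordLie.cons {n : ℕ} {F : List L → A} (h : WordLie (n + 1) F) (z : L) :
    WordLie n (fun v => F (z :: v)) := fun v w x y hn =>
  h (z :: v) w x y (by simp only [List.length_cons]; omega)

variable [Module ℂ A]

theorem adSum_map {B : Type*} [AddCommGroup B] [Module ℂ B] (f : A →ₗ[ℂ] B) (y : L) (w : List L) :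
    ∀ F : List L → A, adSum y (fun v => f (F v)) w = f (adSum y F w) := by
  induction w with
  | nil => intro F; simp [adSum_nil]
  | cons x w ih => intro F; rw [adSum_cons, adSum_cons, map_add, ih fun v => F (x :: v)]

theorem adSum_smul (c : ℂ) (y : L) (w : List L) (F : List L → A) :
    adSum y (fun v => c • F v) w = c • adSum y F w :=
  adSum_map (LinearMap.lsmul ℂ A c) y w F

theorem adSum_sub (y : L) (w : List L) (F G : List L → A) :
    adSum y (fun v => F v - G v) w = adSum y F w - adSum y G w := by
  have h := adSum_add y w F (fun v => (-1 : ℂ) • G v)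
  rw [adSum_smul] at h
  simpa [sub_eq_add_neg] using h

variable [LieAlgebra ℂ L]

/-- `F` is linear in each letter on words of length `n`. -/
def WordLinear (n : ℕ) (F : List L → A) : Prop :=
  ∀ (v w : List L) (c : ℂ) (x y : L), v.length + w.length + 1 = n →
    F (v ++ (c • x + y) :: w) = c • F (v ++ x :: w) + F (v ++ y :: w)

theorem WordLinear.cons {n : ℕ} {F : List L → A} (h : WordLinear (n + 1) F) (z : L) :
    WordLinear n (fun v => F (z :: v)) := fun v w c x y hn =>
  h (z :: v) w c x y (by simp only [List.length_cons]; omega)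

theorem WordLinear.head {n : ℕ} {F : List L → A} (h : WordLinear n F) {w : List L}
    (hw : w.length + 1 = n) (c : ℂ) (x y : L) :
    F ((c • x + y) :: w) = c • F (x :: w) + F (y :: w) :=
  h [] w c x y (by simpa using hw)

theorem WordLinear.head_add {n : ℕ} {F : List L → A} (h : WordLinear n F) {w : List L}
    (hw : w.length + 1 = n) (x y : L) : F ((x + y) :: w) = F (x :: w) + F (y :: w) := by
  have := h.head hw 1 x y
  rwa [one_smul, one_smul] at this

theorem WordLinear.adSum (z : L) : ∀ {n : ℕ} {F : List L → A}, WordLinear n F →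
    WordLinear n (adSum z F) := by
  intro n F h v
  induction v generalizing n F with
  | nil =>
    intro w c x y hn
    have hw : w.length + 1 = n := by simpa using hn
    simp only [List.nil_append, adSum_cons]
    rw [adSum_congr z w (G := fun v => c • F (x :: v) + F (y :: v))
      (fun v hv => h.head (by omega) c x y), adSum_add, adSum_smul, lie_add, lie_smul,
      h.head hw, smul_add]
    abel
  | cons z' v ih =>
    intro w c x y hn
    obtain ⟨n, rfl⟩ : ∃ k, n = k + 1 := ⟨n - 1, by omega⟩
    have hn' : v.length + w.length + 1 = n := by simp only [List.length_cons] at hn; omega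
    simp only [List.cons_append, adSum_cons]
    have h1 := h.cons ⁅z, z'⁆ v w c x y hn'
    have h2 := ih (h.cons z') w c x y hn'
    simp only [] at h1 h2
    rw [h1, h2, smul_add]
    abel

theorem WordLinear.adSum_left {n : ℕ} {F : List L → A} (h : WordLinear n F) (c : ℂ) (y y' : L)
    {w : List L} (hw : w.length = n) :
    TwistedVOA.adSum (c • y + y') F w =
      c • TwistedVOA.adSum y F w + TwistedVOA.adSum y' F w := by
  induction w generalizing n F with
  | nil => simp [adSum_nil]
  | cons x w ih =>
    obtain ⟨n, rfl⟩ : ∃ k, n = k + 1 := ⟨n - 1, by simp only [List.length_cons] at hw; omega⟩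
    simp only [adSum_cons]
    rw [ih (h.cons x) (by simpa using hw), add_lie, smul_lie, h.head (by simpa using hw), smul_add]
    abel

theorem WordLinear.head_neg {n : ℕ} {F : List L → A} (h : WordLinear n F) {w : List L}
    (hw : w.length + 1 = n) (x : L) : F ((-x) :: w) = -F (x :: w) := by
  have h1 := h.head_add hw (-x) x
  have h2 := h.head_add hw 0 0
  rw [neg_add_cancel] at h1
  rw [add_zero] at h2
  rw [eq_neg_iff_add_eq_zero, ← h1]
  simpa using h2

/-- The substitution of brackets with `z` is a derivation on words, and by the Leibniz rule it maps
the relation `xy - yx = [x, y]` to a sum of such relations. -/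
theorem WordLie.adSum (z : L) : ∀ {n : ℕ} {F : List L → A}, WordLie (n + 1) F → WordLinear n F →
    WordLie (n + 1) (adSum z F) := by
  intro n F h hl v
  induction v generalizing n F with
  | nil =>
    intro w x y hn
    have hw : w.length + 1 = n := by simp only [List.length_nil] at hn; omega
    simp only [List.nil_append, adSum_cons]
    have h1 := h [] w ⁅z, x⁆ y (by simp only [List.length_nil]; omega)
    have h2 := h [] w x ⁅z, y⁆ (by simp only [List.length_nil]; omega)
    have h3 : TwistedVOA.adSum z (fun v => F (x :: y :: v)) w -
        TwistedVOA.adSum z (fun v => F (y :: x :: v)) w =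
        TwistedVOA.adSum z (fun v => F (⁅x, y⁆ :: v)) w := by
      rw [← adSum_sub]
      exact adSum_congr z w fun v hv => h [] v x y (by simp only [List.length_nil]; omega)
    simp only [List.nil_append] at h1 h2
    rw [leibniz_lie, hl.head_add hw, ← h1, ← h2, ← h3]
    abel
  | cons z' v ih =>
    intro w x y hn
    simp only [List.length_cons] at hn
    obtain ⟨n, rfl⟩ : ∃ k, n = k + 1 := ⟨n - 1, by omega⟩
    have hn' : v.length + w.length + 2 = n + 1 := by omega
    simp only [List.cons_append, adSum_cons]
    have h1 := h.cons ⁅z, z'⁆ v w x y hn'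
    have h2 := ih (h.cons z') (hl.cons z') w x y hn'
    simp only [] at h1 h2
    rw [← h1, ← h2]
    abel

/-- The adjoint action on words is transported to functions by precomposition. This reverses the
order of composition and accounts for the sign. -/
theorem WordLinear.adSum_adSum (x y : L) (w : List L) : ∀ {F : List L → A},
    WordLinear w.length F → TwistedVOA.adSum x (TwistedVOA.adSum y F) w -
      TwistedVOA.adSum y (TwistedVOA.adSum x F) w = -TwistedVOA.adSum ⁅x, y⁆ F w := by
  induction w with
  | nil => intro F _; simp [adSum_nil]
  | cons z w ih =>
    intro F h
    have key : ∀ x y : L, TwistedVOA.adSum x (TwistedVOA.adSum y F) (z :: w) =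
        F (⁅y, ⁅x, z⁆⁆ :: w) + TwistedVOA.adSum y (fun v => F (⁅x, z⁆ :: v)) w +
          (TwistedVOA.adSum x (fun v => F (⁅y, z⁆ :: v)) w +
            TwistedVOA.adSum x (TwistedVOA.adSum y fun v => F (z :: v)) w) := by
      intro x y
      rw [adSum_cons, adSum_cons, ← adSum_add]
      rfl
    have hI := ih (WordLinear.cons (n := w.length) h z)
    rw [key, key, adSum_cons]
    have hz : ⁅x, ⁅y, z⁆⁆ = ⁅⁅x, y⁆, z⁆ + ⁅y, ⁅x, z⁆⁆ := leibniz_lie x y z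
    rw [hz, h.head_add (by simp), neg_add, ← hI]
    abel

end Words

/-! ### Correlation functions on a lowest weight space -/

section Correlations

variable {L A : Type*} [LieRing L] [LieAlgebra ℂ L] [Ring A] [Algebra ℂ A]
  (π : L →ₗ[ℂ] L) (o : L →ₗ[ℂ] A)

/-- The first `n` steps of the recursion for `corr`. -/
def corrAux : ℕ → List L → A
  | 0, _ => 1
  | _ + 1, [] => 1
  | n + 1, x :: w => o x * corrAux n w + adSum (π x) (corrAux n) w

/-- The values of words on a lowest weight space: a letter `x` on the left acts by `o`, and its
negative part `π x` is moved to the right, where it acts as `0`. -/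
def corr (w : List L) : A := corrAux π o w.length w

theorem corr_nil : corr π o [] = 1 := rfl

/-- This is the recursion to work with. Split `x` as `(x - π x) + π x`: the first part acts on the
outside through `o`, and the second passes through `w`, leaving one commutator per letter, and dies
on the lowest weight space. -/
theorem corr_cons (x : L) (w : List L) :
    corr π o (x :: w) = o x * corr π o w + adSum (π x) (corr π o) w := by
  change o x * corrAux π o w.length w + adSum (π x) (corrAux π o w.length) w = _
  congr 1
  refine adSum_congr _ _ fun v hv => ?_
  rw [corr, hv]

theorem corr_wordLinear (n : ℕ) : WordLinear n (corr π o) := by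
  induction n with
  | zero => intro v w c x y hn; omega
  | succ n ih =>
    intro v w c x y hn
    cases v with
    | nil =>
      have hw : w.length = n := by simpa using hn
      simp only [List.nil_append, corr_cons, map_add, map_smul]
      rw [ih.adSum_left c _ _ hw, smul_add, add_mul, smul_mul_assoc]
      abel
    | cons z v =>
      have hn' : v.length + w.length + 1 = n := by simp only [List.length_cons] at hn; omega
      simp only [List.cons_append, corr_cons]
      rw [ih v w c x y hn', ih.adSum (π z) v w c x y hn', mul_add, mul_smul_comm, smul_add]
      abel

/-- The exchanged pair matters only at the head of the word, the tail being covered by induction.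
Expanding both leading letters and antisymmetrising leaves a commutator of values of `o`, the two
correlations with `[π x, y]` and `[x, π y]` at the head, and the substitution of `-[π x, π y]` in
the tail. The hypotheses `h₁` and `h₂` say that these add up to the expansion of `[x, y]`. -/
theorem corr_wordLie (h₁ : ∀ x y, o x * o y - o y * o x + o (⁅π x, y⁆ + ⁅x, π y⁆) = o ⁅x, y⁆)
    (h₂ : ∀ x y, π (⁅π x, y⁆ + ⁅x, π y⁆) - ⁅π x, π y⁆ = π ⁅x, y⁆) (n : ℕ) : WordLie n (corr π o) := by
  induction n with
  | zero => intro v w x y hn; omega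
  | succ n ih =>
    intro v w x y hn
    cases v with
    | nil =>
      simp only [List.nil_append]
      have key : ∀ x y : L, corr π o (x :: y :: w) =
          o x * o y * corr π o w + o x * adSum (π y) (corr π o) w + corr π o (⁅π x, y⁆ :: w) +
            o y * adSum (π x) (corr π o) w + adSum (π x) (adSum (π y) (corr π o)) w := by
        intro x y
        have h3 : adSum (π x) (fun v => corr π o (y :: v)) w =
            o y * adSum (π x) (corr π o) w + adSum (π x) (adSum (π y) (corr π o)) w := by
          rw [← LinearMap.mulLeft_apply (R := ℂ), ← adSum_map, ← adSum_add]
          exact adSum_congr _ _ fun v _ => corr_cons π o y v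
        rw [corr_cons π o x, adSum_cons, h3, corr_cons π o y, mul_add, mul_assoc]
        abel
      have hlin := corr_wordLinear π o w.length
      have hl' := corr_wordLinear π o (w.length + 1)
      have hc := hlin.adSum_adSum (π x) (π y) w
      -- The remainder in the last bracket has value `[o x, o y]` under `o` by `h₁`, and `-[π x, π
      -- y]` under `π` by `h₂`.
      have e : ⁅x, y⁆ = (⁅π x, y⁆ + ⁅x, π y⁆) + (⁅x, y⁆ - (⁅π x, y⁆ + ⁅x, π y⁆)) := by abel
      have e1 : corr π o (⁅x, y⁆ :: w) = corr π o (⁅π x, y⁆ :: w) + corr π o (⁅x, π y⁆ :: w) +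
          corr π o ((⁅x, y⁆ - (⁅π x, y⁆ + ⁅x, π y⁆)) :: w) := by
        conv_lhs => rw [e]
        rw [hl'.head_add rfl, hl'.head_add rfl]
      have e2 : corr π o ((⁅x, y⁆ - (⁅π x, y⁆ + ⁅x, π y⁆)) :: w) =
          (o x * o y - o y * o x) * corr π o w - adSum ⁅π x, π y⁆ (corr π o) w := by
        have e3 : o (⁅x, y⁆ - (⁅π x, y⁆ + ⁅x, π y⁆)) = o x * o y - o y * o x := by
          rw [map_sub, ← h₁ x y]; abel
        have e4 : π (⁅x, y⁆ - (⁅π x, y⁆ + ⁅x, π y⁆)) = (-1 : ℂ) • ⁅π x, π y⁆ + (0 : ℂ) • 0 := by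
          rw [map_sub, ← h₂ x y, neg_one_smul, smul_zero]; abel
        rw [corr_cons, e3, e4, hlin.adSum_left _ _ _ rfl]
        have e6 := hlin.adSum_left (1 : ℂ) (0 : L) 0 (w := w) rfl
        simp only [smul_zero, add_zero, one_smul] at e6
        have e7 : adSum (0 : L) (corr π o) w = 0 := by simpa using e6
        rw [smul_zero, e7, neg_one_smul, add_zero, ← sub_eq_add_neg]
      have e8 : corr π o (⁅π y, x⁆ :: w) = -corr π o (⁅x, π y⁆ :: w) := by
        rw [← lie_skew, hl'.head_neg rfl]
      rw [← neg_inj, neg_neg, neg_sub] at hc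
      rw [e1, e2, key x y, key y x, e8, ← hc, sub_mul]
      abel
    | cons z v =>
      simp only [List.length_cons] at hn
      obtain ⟨n, rfl⟩ : ∃ k, n = k + 1 := ⟨n - 1, by omega⟩
      have hn' : v.length + w.length + 2 = n + 1 := by omega
      simp only [List.cons_append, corr_cons]
      rw [← ih v w x y hn', ← (ih.adSum (π z) (corr_wordLinear π o n)) v w x y hn', mul_sub]
      abel

/-- The condition on `x` is the form taken here by nonpositive degree. Every negative letter
commuted past such an `x` leaves a negative element at the right end, which `o` kills, so `x` simply
acts on the lowest weight space. -/
theorem corr_append (h₂ : ∀ x y, π ⁅π x, π y⁆ = ⁅π x, π y⁆) (h₃ : ∀ x, o (π x) = 0)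
    (w : List L) : ∀ x : L, (∀ z, π ⁅π z, x⁆ = ⁅π z, x⁆) →
    corr π o (w ++ [x]) = corr π o w * o x := by
  suffices h : ∀ (n : ℕ) (w : List L), w.length = n → ∀ x : L, (∀ z, π ⁅π z, x⁆ = ⁅π z, x⁆) →
      corr π o (w ++ [x]) = corr π o w * o x from h _ w rfl
  intro n
  induction n with
  | zero =>
    intro w hw x _
    rw [List.length_eq_zero_iff.1 hw]
    simp [corr_cons, corr_nil, adSum_nil]
  | succ n ih =>
    intro w hw x hx
    cases w with
    | nil => simp at hw
    | cons z w =>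
      have hw' : w.length = n := by simpa using hw
      rw [List.cons_append, corr_cons, adSum_append, ih w hw' x hx, ih w hw' ⁅π z, x⁆
        (fun z' => by rw [← hx z, h₂]), ← hx z, h₃, mul_zero, add_zero, corr_cons, add_mul,
        mul_assoc]
      congr 1
      rw [← LinearMap.mulRight_apply (R := ℂ), ← adSum_map]
      exact adSum_congr _ _ fun v hv => ih v (hv.trans hw') x hx

end Correlations

/-! ### The coinduced module -/

section Coinduced

variable {L U : Type*} [LieRing L] [LieAlgebra ℂ L] [AddCommGroup U] [Module ℂ U]
  (π : L →ₗ[ℂ] L) (o : L →ₗ[ℂ] Module.End ℂ U)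

/-- The `L`-module coinduced from the kernel of `π`, which acts on `U` by `o`, as a space of
functions on words. -/
def Coind : Submodule ℂ (List L → U) where
  carrier := {F | (∀ n, WordLinear n F) ∧ (∀ n, WordLie n F) ∧
    ∀ x w, π x = 0 → F (x :: w) = o x (F w)}
  zero_mem' := by
    refine ⟨fun n v w c x y _ => ?_, fun n v w x y _ => ?_, fun x w _ => ?_⟩ <;> simp
  add_mem' := by
    rintro F G ⟨h1, h2, h3⟩ ⟨h1', h2', h3'⟩
    refine ⟨fun n v w c x y h => ?_, fun n v w x y h => ?_, fun x w h => ?_⟩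
    · simp only [Pi.add_apply, h1 n v w c x y h, h1' n v w c x y h, smul_add]; abel
    · simp only [Pi.add_apply, ← h2 n v w x y h, ← h2' n v w x y h]; abel
    · simp only [Pi.add_apply, h3 x w h, h3' x w h, map_add]
  smul_mem' := by
    rintro a F ⟨h1, h2, h3⟩
    refine ⟨fun n v w c x y h => ?_, fun n v w x y h => ?_, fun x w h => ?_⟩
    · simp only [Pi.smul_apply, h1 n v w c x y h, smul_add, smul_comm a c]
    · simp only [Pi.smul_apply, ← h2 n v w x y h, smul_sub]
    · simp only [Pi.smul_apply, h3 x w h, map_smul]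

/-- The action of `L` on the coinduced module. -/
def Coind.act : L →ₗ[ℂ] Module.End ℂ (Coind π o) :=
  LinearMap.mk₂ ℂ
    (fun x F => ⟨fun w => F.1 (w ++ [x]), by
      obtain ⟨F, h1, h2, h3⟩ := F
      refine ⟨fun n v w c x' y h => ?_, fun n v w x' y h => ?_, fun x' w h => ?_⟩
      · simpa using h1 (n + 1) v (w ++ [x]) c x' y
          (by simp only [List.length_append, List.length_singleton]; omega)
      · simpa using h2 (n + 1) v (w ++ [x]) x' y
          (by simp only [List.length_append, List.length_singleton]; omega)
      · exact h3 x' (w ++ [x]) h⟩)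
    (fun x y F => by
      ext w
      have := F.2.1 _ w [] 1 x y rfl
      rwa [one_smul, one_smul] at this)
    (fun c x F => by
      ext w
      have h0 := F.2.1 _ w [] 1 0 0 rfl
      have := F.2.1 _ w [] c x 0 rfl
      rw [one_smul, one_smul, add_zero, left_eq_add] at h0
      rwa [h0, add_zero, add_zero] at this)
    (fun x F G => rfl) (fun c x F => rfl)

theorem Coind.act_apply (x : L) (F : Coind π o) (w : List L) :
    (Coind.act π o x F).1 w = F.1 (w ++ [x]) := rfl

theorem Coind.act_lie (x y : L) : Coind.act π o ⁅x, y⁆ =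
    Coind.act π o x * Coind.act π o y - Coind.act π o y * Coind.act π o x := by
  ext F w
  have := F.2.2.1 _ w [] x y rfl
  simp only [LinearMap.sub_apply, Module.End.mul_apply, AddSubgroupClass.coe_sub, Pi.sub_apply,
    Coind.act_apply, List.append_assoc, List.singleton_append]
  exact this.symm

/-- The value at the empty word. -/
def Coind.eval : Coind π o →ₗ[ℂ] U := LinearMap.proj [] ∘ₗ (Coind π o).subtype

/-- At the empty word there is no difference between a letter appended on the right, which is the
action, and a letter prepended on the left, where the equivariance is imposed. -/
theorem Coind.eval_act {x : L} (hx : π x = 0) (F : Coind π o) :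
    Coind.eval π o (Coind.act π o x F) = o x (Coind.eval π o F) :=
  F.2.2.2 x [] hx

variable {π o}

/-- The lowest weight vectors in the coinduced module. -/
def Coind.lowest (h₁ : ∀ x y, o x * o y - o y * o x + o (⁅π x, y⁆ + ⁅x, π y⁆) = o ⁅x, y⁆)
    (h₂ : ∀ x y, π (⁅π x, y⁆ + ⁅x, π y⁆) - ⁅π x, π y⁆ = π ⁅x, y⁆) : U →ₗ[ℂ] Coind π o :=
  LinearMap.codRestrict (Coind π o)
    (LinearMap.pi fun w => corr π o w)
    fun u => by
      refine ⟨fun n v w c x y h => ?_, fun n v w x y h => ?_, fun x w h => ?_⟩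
      · have := congrArg (fun f : Module.End ℂ U => f u) (corr_wordLinear π o n v w c x y h)
        simpa using this
      · have := congrArg (fun f : Module.End ℂ U => f u) (corr_wordLie π o h₁ h₂ n v w x y h)
        simpa using this
      · change corr π o (x :: w) u = o x (corr π o w u)
        have e := (corr_wordLinear π o w.length).adSum_left 1 0 0 (w := w) rfl
        rw [smul_zero, add_zero, one_smul, left_eq_add] at e
        rw [corr_cons, h, e, add_zero]
        rfl

theorem Coind.eval_lowest (h₁ h₂) (u : U) :
    Coind.eval π o (Coind.lowest (π := π) (o := o) h₁ h₂ u) = u := rfl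

/-- This is the compatibility that lets `U` be sent into the coinduced module as a map from the
induced one: letters of nonpositive degree act on the correlation functions as they do on `U`. -/
theorem Coind.act_lowest (h₁) (h₂ : ∀ x y, π (⁅π x, y⁆ + ⁅x, π y⁆) - ⁅π x, π y⁆ = π ⁅x, y⁆)
    (hπ : ∀ x, π (π x) = π x) (h₃ : ∀ x, o (π x) = 0) {x : L}
    (hx : ∀ z, π ⁅π z, x⁆ = ⁅π z, x⁆) (u : U) :
    Coind.act π o x (Coind.lowest h₁ h₂ u) = Coind.lowest h₁ h₂ (o x u) := by
  have h₄ : ∀ x y, π ⁅π x, π y⁆ = ⁅π x, π y⁆ := fun x y => by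
    have := h₂ (π x) (π y)
    rw [hπ, hπ, map_add, sub_eq_iff_eq_add, add_right_inj] at this
    exact this
  ext w
  exact congrArg (fun f : Module.End ℂ U => f u) (corr_append π o h₄ h₃ w x hx)

end Coinduced

attribute [local instance] LieRing.ofAssociativeRing

/-! ### Induction and representations of `U(V[g])` -/

section Enveloping

variable {V : Type*} [AddCommGroup V] [Module ℂ V] [VertexOperatorAlgebra V] {g : FinAut V}

theorem uι_lie (x y : Vg g) : uι g ⁅x, y⁆ = uι g x * uι g y - uι g y * uι g x := by
  change UniversalEnvelopingAlgebra.ι ℂ ⁅x, y⁆ = _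
  rw [LieHom.map_lie, LieRing.of_associative_ring_bracket]
  rfl

/-- The elements whose left multiplication preserves `P` form a subalgebra containing `V[g]`. By the
universal property the identity of `U(V[g])` factors through it. -/
theorem UVg.induction {P : UVg g → Prop} (x : UVg g) (one : P 1)
    (add : ∀ x y, P x → P y → P (x + y)) (smul : ∀ (c : ℂ) x, P x → P (c • x))
    (mul : ∀ (x : Vg g) y, P y → P (uι g x * y)) : P x := by
  let S : Subalgebra ℂ (UVg g) :=
    { carrier := {z | ∀ y, P y → P (z * y)}
      mul_mem' := fun {a b} ha hb y hy => by rw [mul_assoc]; exact ha _ (hb _ hy)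
      add_mem' := fun {a b} ha hb y hy => by rw [add_mul]; exact add _ _ (ha _ hy) (hb _ hy)
      algebraMap_mem' := fun r y hy => by rw [← Algebra.smul_def]; exact smul _ _ hy }
  let f : Vg g →ₗ⁅ℂ⁆ S :=
    { toFun := fun x => ⟨uι g x, fun y hy => mul x y hy⟩
      map_add' := fun x y => Subtype.ext (map_add _ _ _)
      map_smul' := fun c x => Subtype.ext (map_smul _ _ _)
      map_lie' := fun {x y} => Subtype.ext (uι_lie x y) }
  have h : S.val.comp (UniversalEnvelopingAlgebra.lift ℂ f) = AlgHom.id ℂ _ := by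
    apply UniversalEnvelopingAlgebra.hom_ext
    ext x
    change ((UniversalEnvelopingAlgebra.lift ℂ f (UniversalEnvelopingAlgebra.ι ℂ x) : S) : UVg g) =
      UniversalEnvelopingAlgebra.ι ℂ x
    rw [UniversalEnvelopingAlgebra.lift_ι_apply]
    rfl
  have h1 : ((UniversalEnvelopingAlgebra.lift ℂ f x : S) : UVg g) = x :=
    congrArg (fun F : UVg g →ₐ[ℂ] UVg g => F x) h
  have h2 := (UniversalEnvelopingAlgebra.lift ℂ f x).2 1 one
  rwa [h1, mul_one] at h2

theorem exists_algHom {N : Type*} [AddCommGroup N] [Module ℂ N] (τ : Vg g →ₗ[ℂ] Module.End ℂ N)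
    (h : ∀ x y, τ ⁅x, y⁆ = τ x * τ y - τ y * τ x) :
    ∃ θ : UVg g →ₐ[ℂ] Module.End ℂ N, ∀ x, θ (uι g x) = τ x := by
  let f : Vg g →ₗ⁅ℂ⁆ Module.End ℂ N := { τ with map_lie' := fun {x y} => h x y }
  exact ⟨UniversalEnvelopingAlgebra.lift ℂ f,
    fun x => UniversalEnvelopingAlgebra.lift_ι_apply ℂ f x⟩

end Enveloping

/-! ### The universal property of `M(U)` and the projection onto `U` -/

section Universal

variable {V : Type*} [AddCommGroup V] [Module ℂ V] [VertexOperatorAlgebra V] {g : FinAut V}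
  {U : Type*} [AddCommGroup U] [Module ℂ U] (ρ : AgModule g U)

theorem vermaIn_eq (u : U) : vermaIn ρ u = (indRel ρ).mkQ (1 ⊗ₜ[ℂ] u) := rfl

theorem smul_vermaIn (x : UVg g) (u : U) : x • vermaIn ρ u = (indRel ρ).mkQ (x ⊗ₜ[ℂ] u) := by
  rw [vermaIn_eq, ← map_smul, TensorProduct.smul_tmul', smul_eq_mul, mul_one]

theorem neg_smul_vermaIn {d : ℚ} (hd : d < 0) {x : Vg g} (hx : x ∈ VgDeg g d) (u : U) :
    uι g x • vermaIn ρ u = 0 := by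
  rw [smul_vermaIn]
  exact (Submodule.Quotient.mk_eq_zero _).2
    (Submodule.subset_span (Or.inl ⟨d, hd, x, hx, u, rfl⟩))

theorem zero_smul_vermaIn {x : Vg g} (hx : x ∈ VgDeg g 0) (u : U) :
    uι g x • vermaIn ρ u = vermaIn ρ (zeroMode ρ x u) := by
  refine exists_of_mem_VgDeg_zero (P := fun x => uι g x • vermaIn ρ u =
    vermaIn ρ (zeroMode ρ x u)) hx (fun n a ha ha0 => ?_) (by simp)
    (fun x y h h' => by simp only [map_add, add_smul, h, h', LinearMap.add_apply])
    (fun c x h => by simp only [map_smul, smul_assoc, h, LinearMap.smul_apply])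
  rw [zeroMode_vmode ρ ha ha0, smul_vermaIn, vermaIn_eq, ← sub_eq_zero, ← map_sub]
  exact (Submodule.Quotient.mk_eq_zero _).2
    (Submodule.subset_span (Or.inr ⟨n, a, u, ha, ha0, rfl⟩))

theorem verma_induction {P : Verma ρ → Prop} (z : Verma ρ) (base : ∀ u, P (vermaIn ρ u))
    (add : ∀ x y, P x → P y → P (x + y)) (smul : ∀ (c : ℂ) x, P x → P (c • x))
    (lie : ∀ (x : Vg g) z, P z → P (uι g x • z)) : P z := by
  obtain ⟨t, rfl⟩ := (indRel ρ).mkQ_surjective z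
  induction t using TensorProduct.induction_on with
  | zero => rw [map_zero, ← zero_smul ℂ (vermaIn ρ 0)]; exact smul _ _ (base 0)
  | add s t hs ht => rw [map_add]; exact add _ _ hs ht
  | tmul x u =>
    rw [← smul_vermaIn]
    refine UVg.induction (P := fun x => P (x • vermaIn ρ u)) x ?_ ?_ ?_ ?_
    · rw [one_smul]; exact base u
    · intro x y hx hy; rw [add_smul]; exact add _ _ hx hy
    · intro c x hx; rw [smul_assoc]; exact smul _ _ hx
    · intro x y hy; rw [mul_smul]; exact lie _ _ hy

/-- The universal property of the induced module. -/
theorem exists_vermaLift {N : Type*} [AddCommGroup N] [Module ℂ N]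
    (θ : UVg g →ₐ[ℂ] Module.End ℂ N) (φ : U →ₗ[ℂ] N)
    (hneg : ∀ d < 0, ∀ x ∈ VgDeg g d, ∀ u, θ (uι g x) (φ u) = 0)
    (hzero : ∀ x ∈ VgDeg g 0, ∀ u, θ (uι g x) (φ u) = φ (zeroMode ρ x u)) :
    ∃ f : Verma ρ →ₗ[ℂ] N, (∀ x z, f (x • z) = θ x (f z)) ∧ ∀ u, f (vermaIn ρ u) = φ u := by
  let _ : Module (UVg g) N := Module.compHom N θ.toRingHom
  have hs : ∀ (x : UVg g) (w : N), x • w = θ x w := fun _ _ => rfl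
  have : IsScalarTower ℂ (UVg g) N := ⟨fun c x w => by rw [hs, hs, map_smul]; rfl⟩
  let F : UVg g ⊗[ℂ] U →ₗ[UVg g] N := TensorProduct.AlgebraTensorModule.lift
    { toFun := fun x =>
        { toFun := fun u => θ x (φ u)
          map_add' := fun u v => by simp
          map_smul' := fun c u => by simp }
      map_add' := fun x y => by ext u; simp
      map_smul' := fun x y => by ext u; simp [hs] }
  have hF : ∀ x u, F (x ⊗ₜ[ℂ] u) = θ x (φ u) := fun _ _ => rfl
  have hk : indRel ρ ≤ LinearMap.ker F := by
    refine Submodule.span_le.2 ?_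
    rintro _ (⟨d, hd, p, hp, u, rfl⟩ | ⟨n, a, u, ha, ha0, rfl⟩)
    · exact hneg d hd p hp u
    · change F _ = 0
      have h0 : vmode g ((n : ℚ) - 1) a ∈ VgDeg g 0 := by
        convert vmode_mem_VgDeg g ha ((n : ℚ) - 1) using 2
        ring
      have h1 : θ (uMode g ((n : ℚ) - 1) a) (φ u) = φ (zeroMode ρ (vmode g ((n : ℚ) - 1) a) u) :=
        hzero _ h0 u
      rw [map_sub, hF, hF, h1, zeroMode_vmode ρ ha ha0, map_one, Module.End.one_apply, sub_self]
  let G : Verma ρ →ₗ[UVg g] N := (indRel ρ).liftQ F hk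
  refine ⟨G.restrictScalars ℂ, fun x z => G.map_smul x z, fun u => ?_⟩
  change F (1 ⊗ₜ[ℂ] u) = φ u
  rw [hF, map_one, Module.End.one_apply]

theorem negPart_negPart (x : Vg g) : negPart g (negPart g x) = negPart g x := by
  refine Vg.homogeneous_induction g (P := fun x => negPart g (negPart g x) = negPart g x) x
    (fun d x hx => ?_) (by simp) (fun x y h h' => by simp only [map_add, h, h'])
  rcases lt_or_ge d 0 with hd | hd
  · rw [negPart_of_neg g hd hx, negPart_of_neg g hd hx]
  · rw [negPart_of_nonneg g hd hx, map_zero]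

theorem zeroMode_negPart (x : Vg g) : zeroMode ρ (negPart g x) = 0 := by
  refine Vg.homogeneous_induction g (P := fun x => zeroMode ρ (negPart g x) = 0) x
    (fun d x hx => ?_) (by simp) (fun x y h h' => by simp only [map_add, h, h', add_zero])
  rcases lt_or_ge d 0 with hd | hd
  · rw [negPart_of_neg g hd hx, zeroMode_of_ne ρ hd.ne hx]
  · rw [negPart_of_nonneg g hd hx, map_zero]

/-- This supplies the condition of `corr_append`: the bracket of a negative element with one of
nonpositive degree is again negative. -/
theorem negPart_lie_of_nonpos {d : ℚ} (hd : d ≤ 0) {x : Vg g} (hx : x ∈ VgDeg g d) (z : Vg g) :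
    negPart g ⁅negPart g z, x⁆ = ⁅negPart g z, x⁆ := by
  refine Vg.homogeneous_induction g (P := fun z => negPart g ⁅negPart g z, x⁆ = ⁅negPart g z, x⁆) z
    (fun e z hz => ?_) (by simp) (fun x y h h' => by simp only [map_add, add_lie, h, h'])
  rcases lt_or_ge e 0 with he | he
  · rw [negPart_of_neg g he hz, negPart_of_neg g (by linarith) (lie_mem_VgDeg g hz hx)]
  · rw [negPart_of_nonneg g he hz, zero_lie, map_zero]

/-- The projection of `M(U)` onto its component `U` of degree `0`. -/
theorem exists_vermaProj : ∃ f : Verma ρ →ₗ[ℂ] U, (∀ u, f (vermaIn ρ u) = u) ∧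
    ∀ d, 0 ≤ d → ∀ x ∈ VgDeg g d, ∀ z, f (uι g x • z) = zeroMode ρ x (f z) := by
  have h₁ := zeroMode_lie ρ
  have h₂ := negPart_lie (g := g)
  -- The projection is the composite of the map from `M(U)` to the coinduced module, sending `u` to
  -- its correlation function, with evaluation at the empty word. The induced side controls letters
  -- of nonpositive degree on `U`, and the coinduced side controls letters of nonnegative degree on
  -- all of `M(U)`.
  obtain ⟨θ, hθ⟩ := exists_algHom (Coind.act (negPart g) (zeroMode ρ)) (Coind.act_lie _ _)
  have hlow : ∀ d ≤ 0, ∀ x ∈ VgDeg g d, ∀ u, θ (uι g x) (Coind.lowest h₁ h₂ u) =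
      Coind.lowest h₁ h₂ (zeroMode ρ x u) := fun d hd x hx u => by
    rw [hθ, Coind.act_lowest h₁ h₂ negPart_negPart (zeroMode_negPart ρ)
      (negPart_lie_of_nonpos hd hx)]
  obtain ⟨f, hf, hf'⟩ := exists_vermaLift ρ θ (Coind.lowest h₁ h₂)
    (fun d hd x hx u => by
      rw [hlow d hd.le x hx, zeroMode_of_ne ρ hd.ne hx, LinearMap.zero_apply, map_zero])
    (fun x hx u => hlow 0 le_rfl x hx u)
  refine ⟨Coind.eval _ _ ∘ₗ f, fun u => ?_, fun d hd x hx z => ?_⟩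
  · rw [LinearMap.comp_apply, hf', Coind.eval_lowest]
  · rw [LinearMap.comp_apply, hf, hθ, Coind.eval_act _ _ (negPart_of_nonneg g hd hx)]
    rfl

end Universal

/-! ### Products on `ℒ(V)` and derivations -/

section LoopProducts

variable {V : Type*} [AddCommGroup V] [Module ℂ V] [VertexOperatorAlgebra V]

/-- The product `(t^p ⊗ a)_l (t^q ⊗ b) = ∑_i (p choose i) t^(p+q-i) ⊗ a_{l+i} b`. -/
def loopProd (l : ℤ) (p q : ℚ) (a b : V) : Loop V :=
  ∑ᶠ i : ℕ, bin p i • Finsupp.single (p + q - i) (md (l + i) a b)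

theorem loopProd_eq (l : ℤ) (p q : ℚ) (a b : V) (N : ℕ)
    (h : ∀ i : ℕ, N ≤ i → md (l + i) a b = 0) : loopProd l p q a b =
      ∑ i ∈ Finset.range N, bin p i • Finsupp.single (p + q - i) (md (l + i) a b) :=
  finsum_eq_range _ _ fun i hi => by rw [h i hi]; simp

theorem exists_trunc_add (l : ℤ) (a b : V) :
    ∃ N : ℕ, ∀ i : ℤ, (N : ℤ) ≤ i → md (l + i) a b = 0 := by
  obtain ⟨N, hN⟩ := exists_trunc_shift (-l) a b
  exact ⟨N, fun i hi => by rw [← hN i hi]; congr 3; ring⟩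

/-- Only finitely many `c_s a` and `c_s b` are nonzero, so a single bound serves for all of them. -/
theorem exists_trunc_leibniz (l : ℤ) (a b c : V) : ∃ M : ℕ,
    (∀ t : ℕ, M ≤ t → md t c a = 0 ∧ md t c b = 0) ∧ ∀ s : ℕ, ∀ i : ℤ, (M : ℤ) ≤ i →
      md (l + i) (md s c a) b = 0 ∧ md (l + i) a (md s c b) = 0 ∧ md (l + i) a b = 0 := by
  obtain ⟨N, hN⟩ := exists_trunc c a
  obtain ⟨N', hN'⟩ := exists_trunc c b
  obtain ⟨N'', hN''⟩ := exists_trunc_add l a b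
  choose f hf using fun s : ℕ => exists_trunc_add l (md s c a) b
  choose f' hf' using fun s : ℕ => exists_trunc_add l a (md s c b)
  have h1 : ∀ s ∈ Finset.range (N + N'), f s + f' s ≤ ∑ j ∈ Finset.range (N + N'), (f j + f' j) :=
    fun s hs => Finset.single_le_sum (f := fun j => f j + f' j) (fun _ _ => Nat.zero_le _) hs
  refine ⟨N + N' + N'' + ∑ j ∈ Finset.range (N + N'), (f j + f' j),
    fun t ht => ⟨hN _ (by omega), hN' _ (by omega)⟩, fun s i hi => ⟨?_, ?_, hN'' _ (by omega)⟩⟩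
  · by_cases hs : s < N + N'
    · have := h1 s (Finset.mem_range.2 hs)
      exact hf s i (by omega)
    · rw [hN s (by omega), map_zero, LinearMap.zero_apply]
  · by_cases hs : s < N + N'
    · have := h1 s (Finset.mem_range.2 hs)
      exact hf' s i (by omega)
    · rw [hN' s (by omega), map_zero]

/-- The operator `x_0`, for `x = t^k ⊗ c`, is a derivation of all the products. -/
theorem loopBr_loopProd (l : ℤ) (k p q : ℚ) (a b c : V) (M : ℕ)
    (hM : ∀ t : ℕ, M ≤ t → md t c a = 0 ∧ md t c b = 0)
    (hM' : ∀ s : ℕ, ∀ i : ℤ, (M : ℤ) ≤ i →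
      md (l + i) (md s c a) b = 0 ∧ md (l + i) a (md s c b) = 0 ∧ md (l + i) a b = 0) :
    loopBr (Finsupp.single k c) (loopProd l p q a b) =
      ∑ j ∈ Finset.range M, bin k j • (loopProd l (p + k - j) q (md j c a) b +
        loopProd l p (q + k - j) a (md j c b)) := by
  have hz : ∀ i t : ℕ, 2 * M ≤ t → md t c (md (l + i) a b) = 0 := by
    intro i t ht
    rw [sub_eq_iff_eq_add.1 (commutator c a b t (l + i)), (hM t (by omega)).2, map_zero, add_zero]
    refine Finset.sum_eq_zero fun s _ => ?_
    by_cases hs : s < M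
    · rw [show (t : ℤ) + (l + i) - s = l + (t + i - s) by ring, (hM' s _ (by omega)).1, smul_zero]
    · rw [(hM s (by omega)).1, map_zero, LinearMap.zero_apply, smul_zero]
  -- After commuting `c_t` past `a_{l+i}`, the terms `F` have `c_s` acting on `a`, with `u = t - s`,
  -- and the terms `G` have `c_t` acting on `b`.
  let F : ℕ → ℕ → ℕ → Loop V := fun s i u =>
    (bin k s * bin (k - s) u * bin p i) •
      Finsupp.single (k + p + q - s - i - u) (md (l + (i + u : ℕ)) (md s c a) b)
  let G : ℕ → ℕ → Loop V := fun t i =>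
    (bin k t * bin p i) • Finsupp.single (k + p + q - t - i) (md (l + i) a (md t c b))
  have hF : ∀ s i u, (M ≤ s ∨ M ≤ i ∨ M ≤ u) → F s i u = 0 := by
    intro s i u h
    simp only [F]
    rcases h with h | h
    · rw [(hM s h).1]; simp
    · rw [(hM' s _ (by omega)).1]; simp
  have hG : ∀ t i, (M ≤ t ∨ M ≤ i) → G t i = 0 := by
    intro t i h
    simp only [G]
    rcases h with h | h
    · rw [(hM t h).2]; simp
    · rw [(hM' t _ (by omega)).2.1]; simp
  have h1 : ∀ i t : ℕ, (bin p i * bin k t) •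
      Finsupp.single (k + (p + q - i) - t) (md t c (md (l + i) a b)) =
      G t i + ∑ x ∈ Finset.HasAntidiagonal.antidiagonal t, F x.1 i x.2 := by
    intro i t
    rw [Finset.Nat.sum_antidiagonal_eq_sum_range_succ (fun s u => F s i u),
      sub_eq_iff_eq_add'.1 (commutator c a b t (l + i)), Finsupp.single_add,
      Finsupp.single_finsetSum, smul_add, Finset.smul_sum]
    congr 1
    · simp only [G]
      rw [mul_comm (bin p i)]
      congr 2
      ring
    · refine Finset.sum_congr rfl fun s hs => ?_
      have hs' : s ≤ t := by simpa [Nat.lt_succ_iff] using hs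
      simp only [F]
      rw [← Finsupp.smul_single, smul_smul, ← bin_mul_bin k t s hs']
      have e1 : (k + (p + q - i) - t : ℚ) = k + p + q - s - i - ((t - s : ℕ) : ℚ) := by
        rw [Nat.cast_sub hs']; ring
      have e2 : (t : ℤ) + (l + i) - s = l + ((i + (t - s) : ℕ) : ℤ) := by omega
      rw [e1, e2]
      congr 1
      ring
  have hL : loopBr (Finsupp.single k c) (loopProd l p q a b) =
      ∑ i ∈ Finset.range (2 * M), ∑ t ∈ Finset.range (2 * M),
        (G t i + ∑ x ∈ Finset.HasAntidiagonal.antidiagonal t, F x.1 i x.2) := by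
    rw [loopProd_eq _ _ _ _ _ (2 * M) (fun i hi => (hM' 0 i (by omega)).2.2), map_sum]
    refine Finset.sum_congr rfl fun i _ => ?_
    rw [map_smul, loopBr_single, brTerm_eq _ _ _ _ (2 * M) (fun t ht => hz i t ht),
      Finset.smul_sum]
    refine Finset.sum_congr rfl fun t _ => ?_
    rw [smul_smul, h1]
  have h2 : M ≤ 2 * M := by omega
  have hL1 : ∑ i ∈ Finset.range (2 * M), ∑ t ∈ Finset.range (2 * M), G t i =
      ∑ j ∈ Finset.range M, bin k j • loopProd l p (q + k - j) a (md j c b) := by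
    rw [Finset.sum_comm, ← Finset.sum_subset (Finset.range_mono h2)]
    · refine Finset.sum_congr rfl fun j _ => ?_
      rw [loopProd_eq _ _ _ _ _ (2 * M) (fun i hi => (hM' j i (by omega)).2.1), Finset.smul_sum]
      refine Finset.sum_congr rfl fun i _ => ?_
      simp only [G]
      rw [smul_smul]
      congr 2
      ring
    · intro j _ hj
      exact Finset.sum_eq_zero fun i _ => hG j i (Or.inl (by simpa using hj))
  -- The terms with `i + u = v` have the same vector and exponent. Vandermonde sums their
  -- coefficients to `(p+k-s choose v)`, the coefficient in the product of `t^(p+k-s) ⊗ c_s a` with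
  -- `t^q ⊗ b`.
  have hL2 : ∑ i ∈ Finset.range (2 * M), ∑ t ∈ Finset.range (2 * M),
      ∑ x ∈ Finset.HasAntidiagonal.antidiagonal t, F x.1 i x.2 =
      ∑ j ∈ Finset.range M, bin k j • loopProd l (p + k - j) q (md j c a) b := by
    have h3 : ∀ i, ∑ t ∈ Finset.range (2 * M),
        ∑ x ∈ Finset.HasAntidiagonal.antidiagonal t, F x.1 i x.2 =
        ∑ s ∈ Finset.range M, ∑ u ∈ Finset.range M, F s i u := fun i =>
      sum_antidiag_box M (fun s u => F s i u) fun s u h => hF s i u (by omega)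
    simp only [h3]
    rw [Finset.sum_comm]
    refine Finset.sum_congr rfl fun s _ => ?_
    rw [← Finset.sum_subset (Finset.range_mono h2)
      (fun i _ hi => Finset.sum_eq_zero fun u _ => hF s i u (Or.inr (Or.inl (by simpa using hi)))),
      ← sum_antidiag_box M (fun i u => F s i u) fun i u h => hF s i u (by omega),
      loopProd_eq _ _ _ _ _ (2 * M) (fun i hi => (hM' s i (by omega)).1), Finset.smul_sum]
    refine Finset.sum_congr rfl fun v _ => ?_
    rw [show p + k - s = p + (k - s) by ring, bin_add, Finset.sum_smul, Finset.smul_sum]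
    refine Finset.sum_congr rfl fun x hx => ?_
    have hx' : x.1 + x.2 = v := by simpa using hx
    simp only [F]
    have e1 : (k + p + q - s - x.1 - x.2 : ℚ) = p + (k - s) + q - v := by
      rw [← hx']; push_cast; ring
    rw [e1, hx', smul_smul]
    congr 1
    ring
  simp only [hL, Finset.sum_add_distrib, smul_add, hL1, hL2]
  rw [add_comm]

end LoopProducts

/-! ### The sums in the Jacobi identity -/

section Sums

variable {E : Type*} [AddCommGroup E] [Module ℂ E]

/-- The sum `∑_i (-1)^i (l choose i) Z(m + l - i, n + i)`. -/
def prodSum (l : ℤ) (m n : ℚ) (Z : ℚ → ℚ → E) : E :=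
  ∑ᶠ i : ℕ, ((-1) ^ i * bin l i) • Z (m + l - i) (n + i)

/-- The sum `∑_i (m choose i) X(l + i, m + n - i)`. -/
def iterSum (l : ℤ) (m n : ℚ) (X : ℤ → ℚ → E) : E :=
  ∑ᶠ i : ℕ, bin m i • X (l + i) (m + n - i)

theorem prodSum_eventually (l : ℤ) (m n : ℚ) {Z : ℚ → ℚ → E}
    (hZ : ∃ B : ℚ, ∀ p q, B ≤ q → Z p q = 0) :
    ∀ᶠ N : ℕ in Filter.atTop, prodSum l m n Z =
      ∑ i ∈ Finset.range N, ((-1) ^ i * bin l i) • Z (m + l - i) (n + i) := by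
  obtain ⟨B, hB⟩ := hZ
  obtain ⟨N₀, h₀⟩ := exists_nat_ge (B - n)
  filter_upwards [Filter.eventually_ge_atTop N₀] with N hN
  refine finsum_eq_range _ _ fun i hi => ?_
  rw [hB, smul_zero]
  have : (N₀ : ℚ) ≤ i := by exact_mod_cast hN.trans hi
  linarith

theorem iterSum_eventually (l : ℤ) (m n : ℚ) {X : ℤ → ℚ → E}
    (hX : ∃ B : ℤ, ∀ p q, B ≤ p → X p q = 0) :
    ∀ᶠ N : ℕ in Filter.atTop, iterSum l m n X =
      ∑ i ∈ Finset.range N, bin m i • X (l + i) (m + n - i) := by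
  obtain ⟨B, hB⟩ := hX
  filter_upwards [Filter.eventually_ge_atTop (B - l).toNat] with N hN
  refine finsum_eq_range _ _ fun i hi => ?_
  rw [hB, smul_zero]
  have := Int.self_le_toNat (B - l)
  omega

/-- In generating functions: `(z₁-z₂)^(l+1) = z₁ (z₁-z₂)^l - z₂ (z₁-z₂)^l`. -/
theorem prodSum_succ (l : ℤ) (m n : ℚ) {Z : ℚ → ℚ → E}
    (hZ : ∃ B : ℚ, ∀ p q, B ≤ q → Z p q = 0) :
    prodSum (l + 1) m n Z = prodSum l (m + 1) n Z - prodSum l m (n + 1) Z := by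
  have h1 := (Filter.tendsto_add_atTop_nat 1).eventually (prodSum_eventually (l + 1) m n hZ)
  have h2 := (Filter.tendsto_add_atTop_nat 1).eventually (prodSum_eventually l (m + 1) n hZ)
  obtain ⟨N, h1, h2, h3⟩ := (h1.and (h2.and (prodSum_eventually l m (n + 1) hZ))).exists
  rw [h1, h2, h3, Finset.sum_range_succ' _ N, Finset.sum_range_succ' _ N]
  rw [add_sub_right_comm (∑ k ∈ Finset.range N, _), ← Finset.sum_sub_distrib]
  congr 1
  · refine Finset.sum_congr rfl fun i _ => ?_
    push_cast
    rw [bin_add_one, show (m + (l + 1) - (i + 1) : ℚ) = m + l - i by ring,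
      show (m + 1 + l - (i + 1) : ℚ) = m + l - i by ring,
      show n + 1 + (i : ℚ) = n + (i + 1) by ring, ← sub_smul]
    congr 1
    ring
  · simp only [bin_zero_right]
    push_cast
    rw [show m + ((l : ℚ) + 1) = m + 1 + l by ring]

/-- The same recursion as for `prodSum`. Here `z₁` stands for `z₂ + z₀`, so that multiplying by `z₀`
is multiplying by `z₁ - z₂`; in coefficients it is Pascal's rule. -/
theorem iterSum_succ (l : ℤ) (m n : ℚ) {X : ℤ → ℚ → E}
    (hX : ∃ B : ℤ, ∀ p q, B ≤ p → X p q = 0) :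
    iterSum (l + 1) m n X = iterSum l (m + 1) n X - iterSum l m (n + 1) X := by
  have h1 := (Filter.tendsto_add_atTop_nat 1).eventually (iterSum_eventually l (m + 1) n hX)
  have h2 := (Filter.tendsto_add_atTop_nat 1).eventually (iterSum_eventually l m (n + 1) hX)
  obtain ⟨N, h1, h2, h3⟩ := (h1.and (h2.and (iterSum_eventually (l + 1) m n hX))).exists
  rw [h1, h2, h3, Finset.sum_range_succ' _ N, Finset.sum_range_succ' _ N]
  simp only [bin_zero_right]
  push_cast
  rw [show m + 1 + n - 0 = m + (n + 1) - 0 by ring, add_sub_add_right_eq_sub,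
    ← Finset.sum_sub_distrib]
  refine Finset.sum_congr rfl fun i _ => ?_
  rw [bin_add_one, ← add_assoc, show m + (n + 1) - ((i : ℚ) + 1) = m + n - i by ring,
    show m + 1 + n - ((i : ℚ) + 1) = m + n - i by ring, ← sub_smul, add_sub_cancel_left,
    show l + 1 + (i : ℤ) = l + i + 1 by ring]

theorem prodSum_add (l : ℤ) (m n : ℚ) {Z Z' : ℚ → ℚ → E}
    (hZ : ∃ B : ℚ, ∀ p q, B ≤ q → Z p q = 0) (hZ' : ∃ B : ℚ, ∀ p q, B ≤ q → Z' p q = 0) :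
    prodSum l m n (fun p q => Z p q + Z' p q) = prodSum l m n Z + prodSum l m n Z' := by
  have h : ∃ B : ℚ, ∀ p q, B ≤ q → Z p q + Z' p q = 0 := by
    obtain ⟨B, hB⟩ := hZ
    obtain ⟨B', hB'⟩ := hZ'
    exact ⟨max B B', fun p q hq => by
      rw [hB p q (le_of_max_le_left hq), hB' p q (le_of_max_le_right hq), add_zero]⟩
  obtain ⟨I, h1, h2, h3⟩ := ((prodSum_eventually l m n hZ).and
    ((prodSum_eventually l m n hZ').and (prodSum_eventually l m n h))).exists
  rw [h1, h2, h3, ← Finset.sum_add_distrib]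
  simp only [smul_add]

theorem map_prodSum {E' : Type*} [AddCommGroup E'] [Module ℂ E'] (f : E →ₗ[ℂ] E') (l : ℤ)
    (m n : ℚ) {Z : ℚ → ℚ → E} (hZ : ∃ B : ℚ, ∀ p q, B ≤ q → Z p q = 0) :
    f (prodSum l m n Z) = prodSum l m n fun p q => f (Z p q) := by
  have hf : ∃ B : ℚ, ∀ p q, B ≤ q → f (Z p q) = 0 := by
    obtain ⟨B, hB⟩ := hZ
    exact ⟨B, fun p q hq => by rw [hB p q hq, map_zero]⟩
  obtain ⟨I, h1, h2⟩ := ((prodSum_eventually l m n hZ).and (prodSum_eventually l m n hf)).exists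
  rw [h1, h2, map_sum]
  simp only [map_smul]

theorem map_iterSum {E' : Type*} [AddCommGroup E'] [Module ℂ E'] (f : E →ₗ[ℂ] E') (l : ℤ)
    (m n : ℚ) {X : ℤ → ℚ → E} (hX : ∃ B : ℤ, ∀ p q, B ≤ p → X p q = 0) :
    f (iterSum l m n X) = iterSum l m n fun p q => f (X p q) := by
  have hf : ∃ B : ℤ, ∀ p q, B ≤ p → f (X p q) = 0 := by
    obtain ⟨B, hB⟩ := hX
    exact ⟨B, fun p q hq => by rw [hB p q hq, map_zero]⟩
  obtain ⟨I, h1, h2⟩ := ((iterSum_eventually l m n hX).and (iterSum_eventually l m n hf)).exists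
  rw [h1, h2, map_sum]
  simp only [map_smul]

theorem iterSum_add (l : ℤ) (m n : ℚ) {X X' : ℤ → ℚ → E}
    (hX : ∃ B : ℤ, ∀ p q, B ≤ p → X p q = 0) (hX' : ∃ B : ℤ, ∀ p q, B ≤ p → X' p q = 0) :
    iterSum l m n (fun p q => X p q + X' p q) = iterSum l m n X + iterSum l m n X' := by
  have h : ∃ B : ℤ, ∀ p q, B ≤ p → X p q + X' p q = 0 := by
    obtain ⟨B, hB⟩ := hX
    obtain ⟨B', hB'⟩ := hX'
    exact ⟨max B B', fun p q hq => by
      rw [hB p q (le_of_max_le_left hq), hB' p q (le_of_max_le_right hq), add_zero]⟩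
  obtain ⟨I, h1, h2, h3⟩ := ((iterSum_eventually l m n hX).and
    ((iterSum_eventually l m n hX').and (iterSum_eventually l m n h))).exists
  rw [h1, h2, h3, ← Finset.sum_add_distrib]
  simp only [smul_add]

theorem prodSum_zero_left (m n : ℚ) (Z : ℚ → ℚ → E) : prodSum 0 m n Z = Z m n := by
  rw [prodSum, finsum_eq_range _ 1]
  · simp [bin_zero_right]
  · intro i hi
    rw [Int.cast_zero, bin_zero_succ i (by omega)]; simp

end Sums

/-! ### Defects of associativity and of the Jacobi identity -/

section LocalActions

variable {V : Type*} [AddCommGroup V] [Module ℂ V] [VertexOperatorAlgebra V] (g : FinAut V)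
  {N : Type*} [AddCommGroup N] [Module ℂ N]

/-- The operators `Y v m` satisfy the truncation condition and the commutator formula of `V[g]`. -/
structure IsLocalAction (Y : V →ₗ[ℂ] ℚ → Module.End ℂ N) : Prop where
  trunc : ∀ (v : V) (w : N), ∃ B : ℚ, ∀ l : ℚ, B ≤ l → Y v l w = 0
  comm : ∀ (m : ℚ) (a : V), a ∈ sector g m → ∀ (n : ℚ) (b : V) (J : ℕ),
    (∀ i : ℕ, J ≤ i → md i a b = 0) → ∀ w : N, Y a m (Y b n w) - Y b n (Y a m w) =
      ∑ i ∈ Finset.range J, bin m i • Y (md i a b) (m + n - i) w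

variable (Y : V →ₗ[ℂ] ℚ → Module.End ℂ N)

/-- The function `(p, q) ↦ a_p b_q w`. -/
def prodFun (a b : V) (w : N) (p q : ℚ) : N := Y a p (Y b q w)

/-- The function `(p, q) ↦ (a_p b)_q w`. -/
def iterFun (a b : V) (w : N) (p : ℤ) (q : ℚ) : N := Y (md p a b) q w

/-- The defect of associativity. -/
def assocDefect (a b : V) (w : N) (l : ℤ) (m n : ℚ) : N :=
  prodSum l m n (prodFun Y a b w) - iterSum l m n (iterFun Y a b w)

/-- The defect of the twisted Jacobi identity. -/
def jacobiDefect (a b : V) (w : N) (l : ℤ) (m n : ℚ) : N :=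
  prodSum l m n (prodFun Y a b w) - (-1 : ℂ) ^ l • prodSum l n m (prodFun Y b a w) -
    iterSum l m n (iterFun Y a b w)

theorem iterFun_trunc (a b : V) (w : N) : ∃ B : ℤ, ∀ p q, B ≤ p → iterFun Y a b w p q = 0 := by
  obtain ⟨B, hB⟩ := exists_trunc a b
  exact ⟨B, fun p q hp => by simp [iterFun, hB p hp]⟩

variable {g Y}

theorem prodFun_trunc (h : ∀ (v : V) (w : N), ∃ B : ℚ, ∀ l : ℚ, B ≤ l → Y v l w = 0)
    (a b : V) (w : N) : ∃ B : ℚ, ∀ p q, B ≤ q → prodFun Y a b w p q = 0 := by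
  obtain ⟨B, hB⟩ := h b w
  exact ⟨B, fun p q hq => by rw [prodFun, hB q hq, map_zero]⟩

theorem jacobiDefect_eq (h : ∀ (v : V) (w : N), ∃ B : ℚ, ∀ l : ℚ, B ≤ l → Y v l w = 0)
    (a b : V) (w : N) (l : ℤ) (m n : ℚ) :
    jacobiDefect Y a b w l m n = ∑ᶠ i : ℕ, ((-1) ^ i * bin l i) •
        (Y a (m + l - i) (Y b (n + i) w) - (-1 : ℂ) ^ l • Y b (n + l - i) (Y a (m + i) w)) -
      ∑ᶠ i : ℕ, bin m i • Y (md (l + i) a b) (m + n - i) w := by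
  unfold jacobiDefect
  congr 1
  obtain ⟨B, hB⟩ := h b w
  obtain ⟨B', hB'⟩ := h a w
  obtain ⟨N₁, h₁⟩ := exists_nat_ge (B - n)
  obtain ⟨N₂, h₂⟩ := exists_nat_ge (B' - m)
  obtain ⟨N, hN, hN', hN''⟩ := ((prodSum_eventually l m n (prodFun_trunc h a b w)).and
    ((prodSum_eventually l n m (prodFun_trunc h b a w)).and
      (Filter.eventually_ge_atTop (N₁ + N₂)))).exists
  rw [hN, hN', finsum_eq_range _ N, Finset.smul_sum, ← Finset.sum_sub_distrib]
  · refine Finset.sum_congr rfl fun i _ => ?_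
    rw [smul_sub, smul_comm]
    rfl
  · intro i hi
    have e1 : (N₁ : ℚ) ≤ i := by exact_mod_cast (by omega : N₁ ≤ i)
    have e2 : (N₂ : ℚ) ≤ i := by exact_mod_cast (by omega : N₂ ≤ i)
    rw [hB _ (by linarith), hB' _ (by linarith)]
    simp

/-- In the opposite product every term applies some `a_{m+i}` with `i ≥ 0` to `w` first, so that
product drops out. -/
theorem jacobiDefect_eq_assocDefect {a b : V} {w : N} {m : ℚ} (ha : ∀ i : ℕ, Y a (m + i) w = 0)
    (l : ℤ) (n : ℚ) : jacobiDefect Y a b w l m n = assocDefect Y a b w l m n := by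
  have : prodSum l n m (prodFun Y b a w) = 0 := by
    unfold prodSum
    rw [finsum_eq_zero_of_forall_eq_zero]
    intro i
    rw [prodFun, ha, map_zero, smul_zero]
  rw [jacobiDefect, this, smul_zero, sub_zero, assocDefect]

theorem IsLocalAction.assocDefect_succ (h : IsLocalAction g Y) (a b : V) (w : N) (l : ℤ)
    (m n : ℚ) : assocDefect Y a b w (l + 1) m n =
      assocDefect Y a b w l (m + 1) n - assocDefect Y a b w l m (n + 1) := by
  unfold assocDefect
  rw [prodSum_succ _ _ _ (prodFun_trunc h.trunc a b w), iterSum_succ _ _ _ (iterFun_trunc Y a b w)]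
  abel

theorem IsLocalAction.jacobiDefect_succ (h : IsLocalAction g Y) (a b : V) (w : N) (l : ℤ)
    (m n : ℚ) : jacobiDefect Y a b w (l + 1) m n =
      jacobiDefect Y a b w l (m + 1) n - jacobiDefect Y a b w l m (n + 1) := by
  unfold jacobiDefect
  rw [prodSum_succ _ _ _ (prodFun_trunc h.trunc a b w), iterSum_succ _ _ _ (iterFun_trunc Y a b w),
    prodSum_succ _ _ _ (prodFun_trunc h.trunc b a w), zpow_add_one₀ (by norm_num)]
  module

/-- For `l = 0` both product sums have a single term, and the identity is the commutator formula. -/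
theorem IsLocalAction.jacobiDefect_zero (h : IsLocalAction g Y) {a : V} {m : ℚ}
    (ha : a ∈ sector g m) (b : V) (w : N) (n : ℚ) : jacobiDefect Y a b w 0 m n = 0 := by
  obtain ⟨J, hJ⟩ := exists_trunc a b
  have hJ' : ∀ i : ℕ, J ≤ i → md i a b = 0 := fun i hi => hJ _ (by omega)
  rw [jacobiDefect, prodSum_zero_left, prodSum_zero_left, zpow_zero, one_smul, sub_eq_zero]
  refine (h.comm m a ha n b J hJ' w).trans ?_
  unfold iterSum iterFun
  rw [finsum_eq_range _ J]
  · simp only [zero_add]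
  · intro i hi
    rw [zero_add, hJ' i hi]; simp

/-- The commutator formula is the case `l = 0`. The recursion in `l` reaches all positive `l`. Going
down, it only says that the defect is constant along lines `m + n = const`, and associativity at the
one exponent `m` fixes the constant to be zero. -/
theorem IsLocalAction.jacobiDefect_eq_zero_of_assoc (h : IsLocalAction g Y) {a b : V} {w : N}
    {m : ℚ} (ha : a ∈ sector g m) (hw : ∀ i : ℕ, Y a (m + i) w = 0)
    (hass : ∀ l n, assocDefect Y a b w l m n = 0) (l : ℤ) (j : ℤ) (n : ℚ) :
    jacobiDefect Y a b w l (m + j) n = 0 := by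
  have hm : ∀ l n, jacobiDefect Y a b w l m n = 0 := fun l n =>
    (jacobiDefect_eq_assocDefect hw l n).trans (hass l n)
  revert j n
  induction l using Int.induction_on with
  | zero => exact fun j n => h.jacobiDefect_zero (by rwa [sector_add_int]) b w n
  | succ l ih =>
    intro j n
    have := ih (j + 1) n
    push_cast at this
    rw [h.jacobiDefect_succ, ih j, add_assoc, this, sub_zero]
  | pred l ih =>
    intro j
    -- The defect with upper index one larger vanishes by induction, so the recursion equates the
    -- two terms on its right-hand side.
    have step : ∀ (j : ℤ) n, jacobiDefect Y a b w (-l - 1) (m + j + 1) n =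
        jacobiDefect Y a b w (-l - 1) (m + j) (n + 1) := by
      intro j n
      have := h.jacobiDefect_succ a b w (-l - 1) (m + j) n
      rwa [sub_add_cancel, ih j n, eq_comm, sub_eq_zero] at this
    induction j using Int.induction_on with
    | zero => intro n; rw [Int.cast_zero, add_zero]; exact hm _ n
    | succ j ihj =>
      intro n
      push_cast
      rw [← add_assoc]
      exact (step j n).trans (ihj _)
    | pred j ihj =>
      intro n
      have := step (-j - 1) (n - 1)
      rw [sub_add_cancel] at this
      rw [← this]
      convert ihj (n - 1) using 2
      push_cast
      ring

theorem IsLocalAction.prodSum_leibniz (h : IsLocalAction g Y) {k : ℚ} {c : V}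
    (hc : c ∈ sector g k) (a b : V) (w : N) (l : ℤ) (m n : ℚ) (M : ℕ)
    (hM : ∀ t : ℕ, M ≤ t → md t c a = 0 ∧ md t c b = 0) :
    Y c k (prodSum l m n (prodFun Y a b w)) = prodSum l m n (prodFun Y a b (Y c k w)) +
      ∑ j ∈ Finset.range M, bin k j • (prodSum l (m + k - j) n (prodFun Y (md j c a) b w) +
        prodSum l m (n + k - j) (prodFun Y a (md j c b) w)) := by
  have ev := ((prodSum_eventually l m n (prodFun_trunc h.trunc a b w)).and
    ((prodSum_eventually l m n (prodFun_trunc h.trunc a b (Y c k w))).and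
    (((Filter.eventually_all_finset (Finset.range M)).2 fun j _ =>
      prodSum_eventually l (m + k - j) n (prodFun_trunc h.trunc (md j c a) b w)).and
    ((Filter.eventually_all_finset (Finset.range M)).2 fun j _ =>
      prodSum_eventually l m (n + k - j) (prodFun_trunc h.trunc a (md j c b) w)))))
  obtain ⟨I, h1, h2, h3, h4⟩ := ev.exists
  have key : ∀ p q : ℚ, Y c k (prodFun Y a b w p q) = prodFun Y a b (Y c k w) p q +
      ∑ j ∈ Finset.range M, bin k j • (prodFun Y (md j c a) b w (k + p - j) q +
        prodFun Y a (md j c b) w p (k + q - j)) := by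
    intro p q
    simp only [prodFun]
    have e1 := h.comm k c hc p a M (fun i hi => (hM i hi).1) (Y b q w)
    have e2 := h.comm k c hc q b M (fun i hi => (hM i hi).2) w
    rw [sub_eq_iff_eq_add] at e1 e2
    rw [e1, e2, map_add, map_sum]
    simp only [smul_add, Finset.sum_add_distrib, map_smul]
    abel
  have h5 : ∑ j ∈ Finset.range M, bin k j • (prodSum l (m + k - j) n (prodFun Y (md j c a) b w) +
        prodSum l m (n + k - j) (prodFun Y a (md j c b) w)) =
      ∑ j ∈ Finset.range M, ∑ i ∈ Finset.range I, ((-1) ^ i * bin l i) • bin k j •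
        (prodFun Y (md j c a) b w (k + (m + l - i) - j) (n + i) +
          prodFun Y a (md j c b) w (m + l - i) (k + (n + i) - j)) := by
    refine Finset.sum_congr rfl fun j hj => ?_
    rw [h3 j hj, h4 j hj, ← Finset.sum_add_distrib, Finset.smul_sum]
    refine Finset.sum_congr rfl fun i _ => ?_
    rw [← smul_add, smul_comm, show m + k - j + l - i = k + (m + l - i) - j by ring,
      show n + k - j + (i : ℚ) = k + (n + i) - j by ring]
  rw [h1, h2, h5, map_sum, Finset.sum_comm, ← Finset.sum_add_distrib]
  refine Finset.sum_congr rfl fun i _ => ?_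
  rw [map_smul, key, smul_add, Finset.smul_sum]

/-- The action of `ℒ(V)` on `N` by `t^q ⊗ v ↦ v_q`. -/
def actLoop (Y : V →ₗ[ℂ] ℚ → Module.End ℂ N) : Loop V →ₗ[ℂ] Module.End ℂ N :=
  Finsupp.lsum ℂ fun q : ℚ => LinearMap.proj q ∘ₗ Y

theorem actLoop_single (q : ℚ) (v : V) : actLoop Y (Finsupp.single q v) = Y v q := by
  simp [actLoop]

theorem IsLocalAction.actLoop_loopBr (h : IsLocalAction g Y) {k : ℚ} {c : V}
    (hc : c ∈ sector g k) (y : Loop V) (w : N) :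
    actLoop Y (loopBr (Finsupp.single k c) y) w =
      Y c k (actLoop Y y w) - actLoop Y y (Y c k w) := by
  induction y using Finsupp.induction_linear with
  | zero => simp
  | add x x' hx hx' => simp only [map_add, LinearMap.add_apply, hx, hx']; abel
  | single q b =>
    obtain ⟨J, hJ⟩ := exists_trunc c b
    rw [loopBr_single, brTerm_eq _ _ _ _ J (fun i hi => hJ _ (by omega)), actLoop_single,
      h.comm k c hc q b J (fun i hi => hJ _ (by omega)) w, map_sum, LinearMap.sum_apply]
    simp only [map_smul, LinearMap.smul_apply, actLoop_single]

theorem actLoop_loopProd (a b : V) (w : N) (l : ℤ) (m n : ℚ) :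
    actLoop Y (loopProd l m n a b) w = iterSum l m n (iterFun Y a b w) := by
  obtain ⟨J, hJ⟩ := exists_trunc_add l a b
  unfold iterSum iterFun
  rw [loopProd_eq _ _ _ _ _ J (fun i hi => hJ _ (by omega)), finsum_eq_range _ J
    (fun i hi => by rw [hJ _ (by omega)]; simp), map_sum, LinearMap.sum_apply]
  simp only [map_smul, LinearMap.smul_apply, actLoop_single]

/-- An iterate sum is the action of a product in `ℒ(V)`, and commuting with `c_k` is the action of
the derivation `(t^k ⊗ c)_0`. Thus `loopBr_loopProd` applies. -/
theorem IsLocalAction.iterSum_leibniz (h : IsLocalAction g Y) {k : ℚ} {c : V}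
    (hc : c ∈ sector g k) (a b : V) (w : N) (l : ℤ) (m n : ℚ) (M : ℕ)
    (hM : ∀ t : ℕ, M ≤ t → md t c a = 0 ∧ md t c b = 0)
    (hM' : ∀ s : ℕ, ∀ i : ℤ, (M : ℤ) ≤ i →
      md (l + i) (md s c a) b = 0 ∧ md (l + i) a (md s c b) = 0 ∧ md (l + i) a b = 0) :
    Y c k (iterSum l m n (iterFun Y a b w)) = iterSum l m n (iterFun Y a b (Y c k w)) +
      ∑ j ∈ Finset.range M, bin k j • (iterSum l (m + k - j) n (iterFun Y (md j c a) b w) +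
        iterSum l m (n + k - j) (iterFun Y a (md j c b) w)) := by
  simp only [← actLoop_loopProd]
  rw [← sub_eq_iff_eq_add', ← h.actLoop_loopBr hc, loopBr_loopProd l k m n a b c M hM hM', map_sum,
    LinearMap.sum_apply]
  simp only [map_smul, map_add, LinearMap.smul_apply, LinearMap.add_apply]

theorem IsLocalAction.assocDefect_leibniz (h : IsLocalAction g Y) {k : ℚ} {c : V}
    (hc : c ∈ sector g k) (a b : V) (w : N) (l : ℤ) (m n : ℚ) : ∃ M : ℕ,
    Y c k (assocDefect Y a b w l m n) = assocDefect Y a b (Y c k w) l m n +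
      ∑ j ∈ Finset.range M, bin k j • (assocDefect Y (md j c a) b w l (m + k - j) n +
        assocDefect Y a (md j c b) w l m (n + k - j)) := by
  obtain ⟨M, hM, hM'⟩ := exists_trunc_leibniz l a b c
  refine ⟨M, ?_⟩
  simp only [assocDefect, map_sub]
  rw [h.prodSum_leibniz hc a b w l m n M hM, h.iterSum_leibniz hc a b w l m n M hM hM']
  simp only [smul_add, smul_sub, Finset.sum_add_distrib, Finset.sum_sub_distrib]
  abel

/-- This propagates the Jacobi identity: if it holds on `w` for all vectors and exponents, it holds
on `c_k w`. -/
theorem IsLocalAction.jacobiDefect_leibniz (h : IsLocalAction g Y) {k : ℚ} {c : V}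
    (hc : c ∈ sector g k) (a b : V) (w : N) (l : ℤ) (m n : ℚ) : ∃ M : ℕ,
    Y c k (jacobiDefect Y a b w l m n) = jacobiDefect Y a b (Y c k w) l m n +
      ∑ j ∈ Finset.range M, bin k j • (jacobiDefect Y (md j c a) b w l (m + k - j) n +
        jacobiDefect Y a (md j c b) w l m (n + k - j)) := by
  obtain ⟨M, hM, hM'⟩ := exists_trunc_leibniz l a b c
  refine ⟨M, ?_⟩
  simp only [jacobiDefect, map_sub, map_smul]
  rw [h.prodSum_leibniz hc a b w l m n M hM, h.iterSum_leibniz hc a b w l m n M hM hM',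
    h.prodSum_leibniz hc b a w l n m M (fun t ht => (hM t ht).symm)]
  simp only [smul_add, smul_sub, Finset.sum_add_distrib, Finset.sum_sub_distrib, Finset.smul_sum,
    smul_comm _ ((-1 : ℂ) ^ l)]
  abel

theorem prodFun_add_left (a a' b : V) (w : N) : prodFun Y (a + a') b w =
    fun p q => prodFun Y a b w p q + prodFun Y a' b w p q := by
  funext p q; simp [prodFun]

theorem prodFun_add_right (a b b' : V) (w : N) : prodFun Y a (b + b') w =
    fun p q => prodFun Y a b w p q + prodFun Y a b' w p q := by
  funext p q; simp [prodFun]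

theorem prodFun_add (a b : V) (w w' : N) : prodFun Y a b (w + w') =
    fun p q => prodFun Y a b w p q + prodFun Y a b w' p q := by
  funext p q; simp [prodFun]

theorem iterFun_add_left (a a' b : V) (w : N) : iterFun Y (a + a') b w =
    fun p q => iterFun Y a b w p q + iterFun Y a' b w p q := by
  funext p q; simp [iterFun]

theorem iterFun_add_right (a b b' : V) (w : N) : iterFun Y a (b + b') w =
    fun p q => iterFun Y a b w p q + iterFun Y a b' w p q := by
  funext p q; simp [iterFun]

theorem iterFun_add (a b : V) (w w' : N) : iterFun Y a b (w + w') =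
    fun p q => iterFun Y a b w p q + iterFun Y a b w' p q := by
  funext p q; simp [iterFun]

theorem jacobiDefect_add (h : ∀ (v : V) (w : N), ∃ B : ℚ, ∀ l : ℚ, B ≤ l → Y v l w = 0)
    (a b : V) (w w' : N) (l : ℤ) (m n : ℚ) :
    jacobiDefect Y a b (w + w') l m n =
      jacobiDefect Y a b w l m n + jacobiDefect Y a b w' l m n := by
  simp only [jacobiDefect, prodFun_add, iterFun_add]
  rw [prodSum_add _ _ _ (prodFun_trunc h a b w) (prodFun_trunc h a b w'),
    prodSum_add _ _ _ (prodFun_trunc h b a w) (prodFun_trunc h b a w'),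
    iterSum_add _ _ _ (iterFun_trunc Y a b w) (iterFun_trunc Y a b w')]
  module

theorem jacobiDefect_add_left (h : ∀ (v : V) (w : N), ∃ B : ℚ, ∀ l : ℚ, B ≤ l → Y v l w = 0)
    (a a' b : V) (w : N) (l : ℤ) (m n : ℚ) :
    jacobiDefect Y (a + a') b w l m n =
      jacobiDefect Y a b w l m n + jacobiDefect Y a' b w l m n := by
  simp only [jacobiDefect, prodFun_add_left, prodFun_add_right, iterFun_add_left]
  rw [prodSum_add _ _ _ (prodFun_trunc h a b w) (prodFun_trunc h a' b w),
    prodSum_add _ _ _ (prodFun_trunc h b a w) (prodFun_trunc h b a' w),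
    iterSum_add _ _ _ (iterFun_trunc Y a b w) (iterFun_trunc Y a' b w)]
  module

theorem assocDefect_add_right (h : ∀ (v : V) (w : N), ∃ B : ℚ, ∀ l : ℚ, B ≤ l → Y v l w = 0)
    (a b b' : V) (w : N) (l : ℤ) (m n : ℚ) :
    assocDefect Y a (b + b') w l m n =
      assocDefect Y a b w l m n + assocDefect Y a b' w l m n := by
  simp only [assocDefect, prodFun_add_right, iterFun_add_right]
  rw [prodSum_add _ _ _ (prodFun_trunc h a b w) (prodFun_trunc h a b' w),
    iterSum_add _ _ _ (iterFun_trunc Y a b w) (iterFun_trunc Y a b' w)]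
  abel

theorem jacobiDefect_zero_left (b : V) (w : N) (l : ℤ) (m n : ℚ) :
    jacobiDefect Y 0 b w l m n = 0 := by
  simp [jacobiDefect, prodSum, iterSum, prodFun, iterFun]

theorem jacobiDefect_zero_right (a b : V) (l : ℤ) (m n : ℚ) :
    jacobiDefect Y a b (0 : N) l m n = 0 := by
  simp [jacobiDefect, prodSum, iterSum, prodFun, iterFun]

theorem assocDefect_zero_left (b : V) (w : N) (l : ℤ) (m n : ℚ) :
    assocDefect Y 0 b w l m n = 0 := by
  simp [assocDefect, prodSum, iterSum, prodFun, iterFun]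

theorem assocDefect_zero_middle (a : V) (w : N) (l : ℤ) (m n : ℚ) :
    assocDefect Y a 0 w l m n = 0 := by
  simp [assocDefect, prodSum, iterSum, prodFun, iterFun]

theorem map_assocDefect (h : ∀ (v : V) (w : N), ∃ B : ℚ, ∀ l : ℚ, B ≤ l → Y v l w = 0)
    {N' : Type*} [AddCommGroup N'] [Module ℂ N'] {Y' : V →ₗ[ℂ] ℚ → Module.End ℂ N'}
    (f : N →ₗ[ℂ] N') (hf : IsHom Y Y' f) (a b : V) (w : N) (l : ℤ) (m n : ℚ) :
    f (assocDefect Y a b w l m n) = assocDefect Y' a b (f w) l m n := by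
  rw [assocDefect, map_sub, map_prodSum f _ _ _ (prodFun_trunc h a b w),
    map_iterSum f _ _ _ (iterFun_trunc Y a b w), assocDefect]
  simp only [prodFun, iterFun, hf _ _ _]
  rfl

theorem map_jacobiDefect (h : ∀ (v : V) (w : N), ∃ B : ℚ, ∀ l : ℚ, B ≤ l → Y v l w = 0)
    {N' : Type*} [AddCommGroup N'] [Module ℂ N'] {Y' : V →ₗ[ℂ] ℚ → Module.End ℂ N'}
    (f : N →ₗ[ℂ] N') (hf : IsHom Y Y' f) (a b : V) (w : N) (l : ℤ) (m n : ℚ) :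
    f (jacobiDefect Y a b w l m n) = jacobiDefect Y' a b (f w) l m n := by
  rw [jacobiDefect, map_sub, map_sub, map_smul, map_prodSum f _ _ _ (prodFun_trunc h a b w),
    map_prodSum f _ _ _ (prodFun_trunc h b a w), map_iterSum f _ _ _ (iterFun_trunc Y a b w),
    jacobiDefect]
  simp only [prodFun, iterFun, hf _ _ _]
  rfl

theorem jacobiDefect_smul (h : ∀ (v : V) (w : N), ∃ B : ℚ, ∀ l : ℚ, B ≤ l → Y v l w = 0)
    (a b : V) (s : ℂ) (w : N) (l : ℤ) (m n : ℚ) :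
    jacobiDefect Y a b (s • w) l m n = s • jacobiDefect Y a b w l m n :=
  (map_jacobiDefect h (LinearMap.lsmul ℂ N s) (fun v m w => ((Y v m).map_smul s w).symm)
    a b w l m n).symm

end LocalActions

/-! ### Modules over `U(V[g])` -/

section EnvelopingModules

variable {V : Type*} [AddCommGroup V] [Module ℂ V] [VertexOperatorAlgebra V] {g : FinAut V}
  {N : Type*} [AddCommGroup N] [Module ℂ N] [Module (UVg g) N] [IsScalarTower ℂ (UVg g) N]

theorem actY_apply (v : V) (m : ℚ) (w : N) : actY g N v m w = uι g (vmode g m v) • w := rfl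

theorem actY_comm {m : ℚ} {a : V} (ha : a ∈ sector g m) (n : ℚ) (b : V) (J : ℕ)
    (hJ : ∀ i : ℕ, J ≤ i → md i a b = 0) (w : N) :
    actY g N a m (actY g N b n w) - actY g N b n (actY g N a m w) =
      ∑ i ∈ Finset.range J, bin m i • actY g N (md i a b) (m + n - i) w := by
  simp only [actY_apply]
  rw [← mul_smul, ← mul_smul, ← sub_smul, ← uι_lie, lie_vmode g n ha b J hJ, map_sum,
    Finset.sum_smul]
  simp only [map_smul, smul_assoc]

/-- The truncation condition is stable under the action of `V[g]`. -/
theorem trunc_smul {w : N} (h : ∀ v : V, ∃ B : ℚ, ∀ l : ℚ, B ≤ l → actY g N v l w = 0) (x : Vg g)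
    (v : V) : ∃ B : ℚ, ∀ l : ℚ, B ≤ l → actY g N v l (uι g x • w) = 0 := by
  simp only [← Filter.eventually_atTop] at h ⊢
  refine Vg.induction g (P := fun x => ∀ᶠ l in Filter.atTop, actY g N v l (uι g x • w) = 0) x
    (fun n k c _ hc => ?_) (by simp) (fun x y hx hy => ?_)
  · obtain ⟨J, hJ⟩ := exists_trunc c v
    have h1 : ∀ᶠ l : ℚ in Filter.atTop, ∀ i ∈ Finset.range J,
        actY g N (md i c v) (k + l - i) w = 0 := by
      refine (Filter.eventually_all_finset _).2 fun i _ => ?_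
      have ht : Filter.Tendsto (fun l : ℚ => k + l - i) Filter.atTop Filter.atTop := by
        simp only [sub_eq_add_neg]
        exact Filter.tendsto_atTop_add_const_right _ _ (Filter.tendsto_atTop_add_const_left _ k
          Filter.tendsto_id)
      exact ht.eventually (h (md i c v))
    filter_upwards [h v, h1] with l hl hl'
    -- Since `v_l w = 0` for large `l`, the vector `v_l c_k w` is, up to sign, a finite sum of terms
    -- `(c_i v)_{k+l-i} w`, all of which vanish for large `l`.
    have := actY_comm (N := N) hc l v J (fun i hi => hJ _ (by omega)) w
    rw [hl, map_zero, zero_sub, Finset.sum_eq_zero (fun i hi => by rw [hl' i hi, smul_zero]),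
      neg_eq_zero] at this
    exact this
  · filter_upwards [hx, hy] with l hl hl'
    rw [map_add, add_smul, map_add, hl, hl', add_zero]

end EnvelopingModules

/-! ### The relations `W` and their stability -/

section Associativity

variable {V : Type*} [AddCommGroup V] [Module ℂ V] [VertexOperatorAlgebra V] {g : FinAut V}
  {U : Type*} [AddCommGroup U] [Module ℂ U] (ρ : AgModule g U)

theorem exists_trunc_vermaIn (v : V) (u : U) :
    ∃ B : ℚ, ∀ l : ℚ, B ≤ l → actY g (Verma ρ) v l (vermaIn ρ u) = 0 := by
  simp only [← Filter.eventually_atTop]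
  refine wt_induction (P := fun v => ∀ᶠ l in Filter.atTop,
    actY g (Verma ρ) v l (vermaIn ρ u) = 0) v (fun n v hv => ?_) (by simp) (fun v v' h h' => ?_)
  · filter_upwards [Filter.eventually_ge_atTop (n : ℚ)] with l hl
    exact neg_smul_vermaIn ρ (by linarith) (vmode_mem_VgDeg g hv l) u
  · filter_upwards [h, h'] with l hl hl'
    simp [hl, hl']

theorem verma_isLocalAction : IsLocalAction g (actY g (Verma ρ)) where
  trunc v w := by
    revert v
    refine verma_induction ρ (P := fun w => ∀ v, ∃ B : ℚ, ∀ l : ℚ, B ≤ l →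
      actY g (Verma ρ) v l w = 0) w (fun u v => exists_trunc_vermaIn ρ v u) ?_ ?_
      (fun x z h v => trunc_smul h x v)
    · intro x y hx hy v
      obtain ⟨B, hB⟩ := hx v
      obtain ⟨B', hB'⟩ := hy v
      exact ⟨max B B', fun l hl => by
        rw [map_add, hB l (le_of_max_le_left hl), hB' l (le_of_max_le_right hl), add_zero]⟩
    · intro c x hx v
      obtain ⟨B, hB⟩ := hx v
      exact ⟨B, fun l hl => by rw [map_smul, hB l hl, smul_zero]⟩
  comm _ _ ha n b J hJ w := actY_comm ha n b J hJ w

/-- Upper negation, `(α+i choose i) = (-1)^i (-α-1 choose i)`, identifies the two expansions. The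
indices are shifted since `z₀^α` is the coefficient with `-l-1 = α`, and similarly for `z₂^β`. -/
theorem assocCoeff_eq (n : ℤ) (r : ℕ) (a b : V) (u : U) (α : ℤ) (β : ℚ) :
    assocCoeff ρ n r a b u α β = assocDefect (actY g (Verma ρ)) a b (vermaIn ρ u) (-α - 1)
      (cexp g n r) (-β - 1) := by
  unfold assocCoeff assocDefect prodSum iterSum prodFun iterFun
  congr 1
  · refine finsum_congr fun i => ?_
    have h := bin_neg (-((α : ℚ) + i)) i
    rw [neg_neg, show -((α : ℚ) + i) + i - 1 = -α - 1 by ring] at h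
    rw [h]
    push_cast
    rw [show cexp g n r - 1 - α - (i : ℚ) = cexp g n r + (-α - 1) - i by ring,
      show (i : ℚ) - β - 1 = -β - 1 + i by ring]
  · refine finsum_congr fun i => ?_
    rw [show (i : ℤ) - α - 1 = -α - 1 + i by ring,
      show cexp g n r - (i : ℚ) - β - 1 = cexp g n r + (-β - 1) - i by ring]

theorem assocDefect_cexp_mem {n : ℤ} {r : ℕ} (hr : r < g.T) {a : V} (ha : a ∈ wtSpace V n)
    (har : a ∈ Vr g r) (b : V) (u : U) (l : ℤ) (q : ℚ) :
    assocDefect (actY g (Verma ρ)) a b (vermaIn ρ u) l (cexp g n r) q ∈ assocRel ρ := by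
  refine Submodule.subset_span ⟨n, r, a, b, u, -l - 1, -q - 1, hr, ha, har, ?_⟩
  rw [assocCoeff_eq]
  congr 1 <;> ring

theorem cexp_eq {n : ℤ} {r : ℕ} : cexp g n r = r / g.T + ((n - 1 + del r : ℤ) : ℚ) := by
  unfold cexp; push_cast; ring

/-- Together with `lt_cexp_add_one` this says that the exponent in the definition of `W` is the only
element of `r/T + ℤ` in the interval `(n-1, n]`. It is thus the least one for which the modes from
there on kill `U`. -/
theorem cexp_le {n : ℤ} {r : ℕ} (hr : r < g.T) : cexp g n r ≤ n := by
  have hT : (0 : ℚ) < g.T := by exact_mod_cast g.T_pos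
  have h : (del r : ℚ) + r / g.T ≤ 1 := by
    unfold del
    split_ifs with h0
    · simp [h0]
    · rw [Nat.cast_zero, zero_add, div_le_one hT]
      exact_mod_cast hr.le
  unfold cexp
  linarith

theorem lt_cexp_add_one {n : ℤ} {r : ℕ} : (n : ℚ) - 1 < cexp g n r := by
  have hT : (0 : ℚ) < g.T := by exact_mod_cast g.T_pos
  have h : 0 < (del r : ℚ) + r / g.T := by
    unfold del
    split_ifs with h0
    · simp [h0]
    · rw [Nat.cast_zero, zero_add]
      exact div_pos (by exact_mod_cast Nat.pos_of_ne_zero h0) hT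
  unfold cexp
  linarith

/-- The relations of `W` hold with `(z₀ + z₂)^m` in place of `(z₀ + z₂)^c` whenever
`m > wt a - 1`. -/
theorem assocDefect_mem {n : ℤ} {m : ℚ} {a : V} (ha : a ∈ wtSpace V n) (ham : a ∈ sector g m)
    (hm : (n : ℚ) - 1 < m) (b : V) (u : U) (l : ℤ) (q : ℚ) :
    assocDefect (actY g (Verma ρ)) a b (vermaIn ρ u) l m q ∈ assocRel ρ := by
  rcases sector_cases g ham with rfl | ⟨r, hr, har, k, hk⟩
  · rw [assocDefect_zero_left]; exact Submodule.zero_mem _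
  · have h1 := cexp_le (n := n) hr
    have h2 : ((n - 1 + del r : ℤ) : ℚ) < k + 1 := by
      rw [cexp_eq] at h1
      linarith
    have h3 : n - 1 + del r < k + 1 := by exact_mod_cast h2
    obtain ⟨K, hK⟩ := Int.eq_ofNat_of_zero_le (by omega : 0 ≤ k - (n - 1 + del r))
    have h4 : m = cexp g n r + K := by
      rw [hk, cexp_eq, show k = n - 1 + del r + K by omega]
      push_cast
      ring
    subst h4
    clear hk hK h1 hm ham h2 h3
    induction K generalizing l q with
    | zero => rw [Nat.cast_zero, add_zero]; exact assocDefect_cexp_mem ρ hr ha har b u l q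
    | succ K ih =>
      -- Raising the exponent of `z₁` by one is multiplication by `z₀ + z₂`, which only combines
      -- coefficients already in `W`.
      have h5 := (verma_isLocalAction ρ).assocDefect_succ a b (vermaIn ρ u) l (cexp g n r + K) q
      rw [eq_sub_iff_add_eq] at h5
      push_cast
      rw [← add_assoc, ← h5]
      exact Submodule.add_mem _ (ih _ _) (ih _ _)

theorem nonpos_smul_vermaIn {d : ℚ} (hd : d ≤ 0) {x : Vg g} (hx : x ∈ VgDeg g d) (u : U) :
    uι g x • vermaIn ρ u = vermaIn ρ (zeroMode ρ x u) := by
  rcases hd.lt_or_eq with hd | rfl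
  · rw [neg_smul_vermaIn ρ hd hx, zeroMode_of_ne ρ hd.ne hx, LinearMap.zero_apply, map_zero]
  · exact zero_smul_vermaIn ρ hx u

/-- The space `W` is stable under `V[g]_- ⊕ V[g]_0`. -/
theorem smul_mem_assocRel {d : ℚ} (hd : d ≤ 0) {x : Vg g} (hx : x ∈ VgDeg g d) {w : Verma ρ}
    (hw : w ∈ assocRel ρ) : uι g x • w ∈ assocRel ρ := by
  induction hw using Submodule.span_induction with
  | zero => rw [smul_zero]; exact Submodule.zero_mem _
  | add w w' _ _ h h' => rw [smul_add]; exact Submodule.add_mem _ h h'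
  | smul c w _ h =>
    rw [smul_comm]
    exact Submodule.smul_mem _ _ h
  | mem w hw =>
    obtain ⟨n, r, a, b, u, α, β, hr, ha, har, rfl⟩ := hw
    rw [assocCoeff_eq]
    induction hx using Submodule.span_induction with
    | zero => rw [map_zero, zero_smul]; exact Submodule.zero_mem _
    | add x x' _ _ h h' => rw [map_add, add_smul]; exact Submodule.add_mem _ h h'
    | smul c x _ h => rw [map_smul, smul_assoc]; exact Submodule.smul_mem _ _ h
    | mem x hx =>
      obtain ⟨p, k, c, hcp, hck, hdeg, rfl⟩ := hx
      obtain ⟨M, hM⟩ := (verma_isLocalAction ρ).assocDefect_leibniz hck a b (vermaIn ρ u) (-α - 1)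
        (cexp g n r) (-β - 1)
      have hu : actY g (Verma ρ) c k (vermaIn ρ u) = vermaIn ρ (zeroMode ρ (vmode g k c) u) :=
        nonpos_smul_vermaIn ρ (by linarith) (vmode_mem_VgDeg g hcp k) u
      change actY g (Verma ρ) c k _ ∈ _
      rw [hM, hu]
      have hac : a ∈ sector g (cexp g n r) := mem_sector_of_Vr g har ⟨_, cexp_eq⟩
      have hlt := lt_cexp_add_one (g := g) (n := n) (r := r)
      refine Submodule.add_mem _ (assocDefect_cexp_mem ρ hr ha har _ _ _ _)
        (Submodule.sum_mem _ fun j _ => Submodule.smul_mem _ _ (Submodule.add_mem _ ?_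
          (assocDefect_cexp_mem ρ hr ha har _ _ _ _)))
      -- The vector `c_j a` has weight `p + n - j - 1`. As `c(k)` has degree `p - k - 1 ≤ 0`, the
      -- new exponent still exceeds this weight minus one, although it need not be the exponent used
      -- to define `W`.
      refine assocDefect_mem ρ (md_mem_wtSpace hcp ha j) ?_ ?_ _ _ _ _
      · have := sector_sub_int g (k + cexp g n r) j
        rw [add_comm (cexp g n r) k]
        rw [Int.cast_natCast] at this
        rw [this]
        exact md_mem_sector g hck hac _
      · push_cast
        linarith

end Associativity

/-! ### The projection kills `W` -/

section Projection

variable {V : Type*} [AddCommGroup V] [Module ℂ V] [VertexOperatorAlgebra V] {g : FinAut V}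
  {U : Type*} [AddCommGroup U] [Module ℂ U] (ρ : AgModule g U)

/-- The projection of `M(U)` onto its component `U` of degree `0`. -/
def vermaProj : Verma ρ →ₗ[ℂ] U := (exists_vermaProj ρ).choose

theorem vermaProj_vermaIn (u : U) : vermaProj ρ (vermaIn ρ u) = u :=
  (exists_vermaProj ρ).choose_spec.1 u

theorem vermaProj_smul {d : ℚ} (hd : 0 ≤ d) {x : Vg g} (hx : x ∈ VgDeg g d) (z : Verma ρ) :
    vermaProj ρ (uι g x • z) = zeroMode ρ x (vermaProj ρ z) :=
  (exists_vermaProj ρ).choose_spec.2 d hd x hx z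

theorem vermaProj_smul_vermaIn (x : Vg g) (u : U) :
    vermaProj ρ (uι g x • vermaIn ρ u) = zeroMode ρ x u := by
  refine Vg.homogeneous_induction g (P := fun x =>
    vermaProj ρ (uι g x • vermaIn ρ u) = zeroMode ρ x u) x (fun d x hx => ?_) (by simp)
    (fun x y h h' => by simp only [map_add, add_smul, h, h', LinearMap.add_apply])
  rcases le_total d 0 with hd | hd
  · rw [nonpos_smul_vermaIn ρ hd hx, vermaProj_vermaIn]
  · rw [vermaProj_smul ρ hd hx, vermaProj_vermaIn]

/-- A component in `V^r` with `r ≠ 0` contributes zero to both sides: it has no modes with integral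
index, and it lies in `O_g(V)`. -/
theorem zeroMode_vmode_of_mem_wtSpace {n : ℤ} {a : V} (ha : a ∈ wtSpace V n) :
    zeroMode ρ (vmode g ((n : ℚ) - 1) a) = ρ.act (Ag.mk g a) := by
  rw [← sum_proj g a]
  simp only [map_sum]
  refine Finset.sum_congr rfl fun r hr => ?_
  have hr' : r < g.T := Finset.mem_range.1 hr
  by_cases h0 : r = 0
  · subst h0
    exact zeroMode_vmode ρ (proj_mem_wtSpace g ha _) (proj_mem g _ _)
  · rw [ρ.act_eq_zero (mem_Og_of_pos hr' h0 (proj_mem_wtSpace g ha _) (proj_mem g _ _)),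
      vmode_eq_zero g (proj_mem g _ _), map_zero]
    rintro ⟨k, hk⟩
    have hT : (0 : ℚ) < g.T := by exact_mod_cast g.T_pos
    rw [div_eq_iff hT.ne'] at hk
    have hk' : (r : ℤ) = (n - 1 + k) * g.T := by exact_mod_cast hk
    have h1 : 0 < n - 1 + k := by
      by_contra h
      have := mul_nonpos_of_nonpos_of_nonneg (not_lt.1 h) (Int.natCast_nonneg g.T)
      omega
    nlinarith

/-- The bound on `p` says that `a(p)` has nonnegative degree and so can be taken out of the
projection. -/
theorem vermaProj_prodFun {n : ℤ} {a : V} (ha : a ∈ wtSpace V n) (b : V) (u : U) {p q : ℚ}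
    (hp : p ≤ n - 1) : vermaProj ρ (prodFun (actY g (Verma ρ)) a b (vermaIn ρ u) p q) =
      zeroMode ρ (vmode g p a) (zeroMode ρ (vmode g q b) u) := by
  have := vermaProj_smul ρ (d := n - p - 1) (by linarith) (vmode_mem_VgDeg g ha p)
    (actY g (Verma ρ) b q (vermaIn ρ u))
  exact this.trans (by rw [actY_apply, vermaProj_smul_vermaIn])

theorem vermaProj_iterFun (a b : V) (u : U) (p : ℤ) (q : ℚ) :
    vermaProj ρ (iterFun (actY g (Verma ρ)) a b (vermaIn ρ u) p q) =
      zeroMode ρ (vmode g q (md p a b)) u :=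
  vermaProj_smul_vermaIn ρ _ u

/-- All terms of the sum have the same degree, the quantity in the condition. In degree zero the
binomial coefficients assemble into a residue. -/
theorem vermaProj_iterSum {n m : ℤ} {a b : V} (ha : a ∈ wtSpace V n) (hb : b ∈ wtSpace V m)
    (u : U) (l : ℤ) (c q : ℚ) :
    vermaProj ρ (iterSum l c q (iterFun (actY g (Verma ρ)) a b (vermaIn ρ u))) =
      if (n : ℚ) + m - l - c - q - 2 = 0 then ρ.act (Ag.mk g (resid c (-l) a b)) u else 0 := by
  rw [map_iterSum _ _ _ _ (iterFun_trunc _ _ _ _)]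
  obtain ⟨J, hJ⟩ := exists_trunc_add l a b
  simp only [vermaProj_iterFun, iterSum]
  rw [finsum_eq_range _ J (fun i hi => by rw [hJ _ (by omega)]; simp)]
  have hw : ∀ i : ℕ, md (l + i) a b ∈ wtSpace V (n + m - (l + i) - 1) := fun i =>
    md_mem_wtSpace ha hb _
  split_ifs with hD
  · rw [resid_eq _ _ _ _ J (fun i hi => by rw [sub_neg_eq_add, add_comm, hJ _ (by omega)])]
    simp only [map_sum, map_smul, LinearMap.sum_apply, LinearMap.smul_apply]
    refine Finset.sum_congr rfl fun i _ => ?_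
    rw [sub_neg_eq_add, add_comm (i : ℤ) l, ← zeroMode_vmode_of_mem_wtSpace ρ (hw i)]
    congr 5
    push_cast
    linarith
  · refine Finset.sum_eq_zero fun i _ => ?_
    rw [zeroMode_of_ne ρ _ (vmode_mem_VgDeg g (hw i) _), LinearMap.zero_apply, smul_zero]
    intro h
    apply hD
    push_cast at h
    linarith

/-- For `l ≥ 0` the relation already holds in `M(U)`, as a consequence of the commutator formula.
For `l < 0` both sides are computed in `A_g(V)`: when `r = 0` and `l = -1` they agree by the product
rule, and otherwise the product side vanishes and the iterate side is a residue in `O_g(V)`. -/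
theorem vermaProj_assocDefect {n m : ℤ} {r : ℕ} (hr : r < g.T) {a b : V} (ha : a ∈ wtSpace V n)
    (har : a ∈ Vr g r) (hb : b ∈ wtSpace V m) (u : U) (l : ℤ) (q : ℚ) :
    vermaProj ρ (assocDefect (actY g (Verma ρ)) a b (vermaIn ρ u) l (cexp g n r) q) = 0 := by
  have hloc := verma_isLocalAction ρ
  have hac : a ∈ sector g (cexp g n r) := mem_sector_of_Vr g har ⟨_, cexp_eq⟩
  have hT : (0 : ℚ) < g.T := by exact_mod_cast g.T_pos
  rcases le_or_gt 0 l with hl | hl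
  · have hkill : ∀ i : ℕ, actY g (Verma ρ) a (cexp g n r + i) (vermaIn ρ u) = 0 := fun i =>
      neg_smul_vermaIn ρ (by
        have := lt_cexp_add_one (g := g) (n := n) (r := r)
        have : (0 : ℚ) ≤ i := Nat.cast_nonneg i
        linarith) (vmode_mem_VgDeg g ha _) u
    rw [← jacobiDefect_eq_assocDefect hkill]
    obtain ⟨L, rfl⟩ := Int.eq_ofNat_of_zero_le hl
    have key : ∀ L : ℕ, ∀ c : ℚ, a ∈ sector g c → ∀ q : ℚ,
        jacobiDefect (actY g (Verma ρ)) a b (vermaIn ρ u) L c q = 0 := by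
      intro L
      induction L with
      | zero => exact fun c hc q => hloc.jacobiDefect_zero hc b _ q
      | succ L ih =>
        intro c hc q
        have hc' : a ∈ sector g (c + 1) := by
          have := sector_add_int g c 1
          rw [Int.cast_one] at this
          rwa [this]
        push_cast
        rw [hloc.jacobiDefect_succ, ih _ hc, ih _ hc', sub_zero]
    rw [key L _ hac, map_zero]
  -- The modes of `a` occurring here have degree `n - 1 - c - l + i ≥ 0`, with `c` the exponent
  -- `cexp g n r`, and survive only in degree zero. This forces `c - n + 1 = i - l ≥ 1`, hence `r =
  -- 0`, `l = -1` and `i = 0`.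
  · have hprod : vermaProj ρ (prodSum l (cexp g n r) q
        (prodFun (actY g (Verma ρ)) a b (vermaIn ρ u))) =
        if r = 0 ∧ l = -1 ∧ (m : ℚ) - q - 1 = 0 then
          ρ.act (Ag.mk g a) (ρ.act (Ag.mk g b) u) else 0 := by
      rw [map_prodSum _ _ _ _ (prodFun_trunc hloc.trunc _ _ _)]
      have hl1 : (l : ℚ) ≤ -1 := by exact_mod_cast (by omega : l ≤ -1)
      have hc := cexp_le (n := n) hr
      have hp : ∀ i : ℕ, cexp g n r + l - i ≤ n - 1 := fun i => by
        have : (0 : ℚ) ≤ i := Nat.cast_nonneg i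
        linarith
      unfold prodSum
      simp only [vermaProj_prodFun ρ ha b u (hp _)]
      by_cases h0 : r = 0 ∧ l = -1
      · obtain ⟨rfl, rfl⟩ := h0
        rw [finsum_eq_range _ 1]
        · simp only [Finset.sum_range_one, cexp_zero, pow_zero, bin_zero_right, one_smul,
            Nat.cast_zero, sub_zero, add_zero, one_mul, true_and]
          push_cast
          rw [← sub_eq_add_neg, zeroMode_vmode ρ ha har]
          split_ifs with hD
          · rw [← zeroMode_vmode_of_mem_wtSpace ρ hb, show q = (m : ℚ) - 1 by linarith]
          · rw [zeroMode_of_ne ρ hD (by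
              convert vmode_mem_VgDeg g hb q using 2), LinearMap.zero_apply, map_zero]
        · intro i hi
          have : (1 : ℚ) ≤ i := by exact_mod_cast hi
          rw [zeroMode_of_ne ρ _ (vmode_mem_VgDeg g ha _), LinearMap.zero_apply, smul_zero]
          rw [cexp_zero]
          push_cast
          intro h
          linarith
      · rw [if_neg (fun h => h0 ⟨h.1, h.2.1⟩)]
        apply finsum_eq_zero_of_forall_eq_zero
        intro i
        rw [zeroMode_of_ne ρ _ (vmode_mem_VgDeg g ha _), LinearMap.zero_apply, smul_zero]
        intro h
        have hi : (0 : ℚ) ≤ i := Nat.cast_nonneg i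
        by_cases hr0 : r = 0
        · subst hr0
          have : l ≤ -2 := by
            have : l ≠ -1 := fun h => h0 ⟨rfl, h⟩
            omega
          have : (l : ℚ) ≤ -2 := by exact_mod_cast this
          rw [cexp_zero] at h
          linarith
        · have h1 : (r : ℚ) / g.T < 1 := by
            rw [div_lt_one hT]; exact_mod_cast hr
          simp only [cexp, del, hr0, if_false] at h
          push_cast at h
          linarith
    rw [assocDefect, map_sub, hprod, vermaProj_iterSum ρ ha hb, sub_eq_zero]
    by_cases h0 : r = 0 ∧ l = -1
    · obtain ⟨rfl, rfl⟩ := h0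
      have e : (n : ℚ) + m - ((-1 : ℤ) : ℚ) - cexp g n 0 - q - 2 = m - q - 1 := by
        rw [cexp_zero]; push_cast; ring
      rw [e]
      simp only [true_and]
      split_ifs
      · have := ρ.act_mul n 0 a b hr ha har
        rw [star_zero_eq_resid] at this
        rw [cexp_zero, neg_neg, this]
        rfl
      · rfl
    · rw [if_neg (fun h => h0 ⟨h.1, h.2.1⟩)]
      -- Outside the exceptional case the pole order `-l` is at least the order `1 + δ_r` in the
      -- definition of `∘_g`, so `resid_mem_Og` applies.
      have hk : 1 + (del r : ℤ) ≤ -l := by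
        unfold del
        split_ifs with h
        · have : l ≠ -1 := fun h' => h0 ⟨h, h'⟩
          push_cast
          omega
        · push_cast
          omega
      obtain ⟨K, hK⟩ := Int.eq_ofNat_of_zero_le (sub_nonneg.2 hk)
      have hO := resid_mem_Og hr b K ha har
      rw [show 1 + (del r : ℤ) + K = -l by omega] at hO
      rw [ρ.act_eq_zero hO, LinearMap.zero_apply, ite_self]

theorem vermaProj_assocRel {w : Verma ρ} (hw : w ∈ assocRel ρ) : vermaProj ρ w = 0 := by
  induction hw using Submodule.span_induction with
  | zero => exact map_zero _
  | add w w' _ _ h h' => rw [map_add, h, h', add_zero]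
  | smul c w _ h => rw [map_smul, h, smul_zero]
  | mem w hw =>
    obtain ⟨n, r, a, b, u, α, β, hr, ha, har, rfl⟩ := hw
    rw [assocCoeff_eq]
    refine wt_induction (P := fun b => vermaProj ρ (assocDefect (actY g (Verma ρ)) a b
      (vermaIn ρ u) (-α - 1) (cexp g n r) (-β - 1)) = 0) b
      (fun m b hb => vermaProj_assocDefect ρ hr ha har hb u _ _) ?_ (fun b b' h h' => ?_)
    · rw [assocDefect_zero_middle, map_zero]
    · rw [assocDefect_add_right (verma_isLocalAction ρ).trunc, map_add, h, h', add_zero]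

end Projection

/-! ### The projection kills `U(V[g])W` -/

section Vanishing

variable {V : Type*} [AddCommGroup V] [Module ℂ V] [VertexOperatorAlgebra V] {g : FinAut V}
  {U : Type*} [AddCommGroup U] [Module ℂ U] (ρ : AgModule g U)

/-- A word in homogeneous elements of `V[g]`. -/
def HomogeneousWord (ws : List (Vg g)) : Prop := ∀ x ∈ ws, ∃ d, x ∈ VgDeg g d

/-- The product in `U(V[g])` of the letters of a word. -/
def wordProd (ws : List (Vg g)) : UVg g := (ws.map (uι g)).prod

theorem wordProd_cons (x : Vg g) (ws : List (Vg g)) :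
    wordProd (x :: ws) = uι g x * wordProd ws := by
  simp [wordProd]

theorem uι_mul_wordProd (x : Vg g) (ws : List (Vg g)) :
    uι g x * wordProd ws = adSum x wordProd ws + wordProd ws * uι g x := by
  induction ws with
  | nil => simp [wordProd, adSum_nil]
  | cons y ws ih =>
    have h : adSum x (fun v => wordProd (y :: v)) ws = uι g y * adSum x wordProd ws := by
      rw [← LinearMap.mulLeft_apply (R := ℂ), ← adSum_map]
      exact adSum_congr _ _ fun v _ => wordProd_cons y v
    rw [adSum_cons, h, wordProd_cons, wordProd_cons, uι_lie, mul_assoc (uι g y), ← add_sub_cancel_left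
      (adSum x wordProd ws) (wordProd ws * uι g x), ← ih]
    noncomm_ring

theorem adSum_eq_zero {A : Type*} [AddCommGroup A] {d : ℚ} {x : Vg g} (hx : x ∈ VgDeg g d)
    (ws : List (Vg g)) : ∀ F : List (Vg g) → A, HomogeneousWord ws →
    (∀ v, v.length = ws.length → HomogeneousWord v → F v = 0) → adSum x F ws = 0 := by
  induction ws with
  | nil => intro F _ _; rfl
  | cons y ws ih =>
    intro F h hF
    have hws : HomogeneousWord ws := fun z hz => h z (List.mem_cons_of_mem _ hz)
    obtain ⟨e, he⟩ := h y List.mem_cons_self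
    rw [adSum_cons, hF _ (by simp), zero_add]
    · refine ih _ hws fun v hv hv' => hF _ (by simp [hv]) ?_
      intro z hz
      rcases List.mem_cons.1 hz with rfl | hz
      · exact ⟨e, he⟩
      · exact hv' z hz
    · intro z hz
      rcases List.mem_cons.1 hz with rfl | hz
      · exact ⟨_, lie_mem_VgDeg g hx he⟩
      · exact hws z hz

/-- A leftmost letter of nonnegative degree comes out of the projection. One of nonpositive degree
is moved to the right, where it maps `W` to itself; the commutators left behind are words with one
letter fewer. Either way the induction on the length applies. -/
theorem vermaProj_wordProd (n : ℕ) : ∀ ws : List (Vg g), ws.length = n → HomogeneousWord ws →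
    ∀ w ∈ assocRel ρ, vermaProj ρ (wordProd ws • w) = 0 := by
  induction n with
  | zero =>
    intro ws hn _ w hw
    rw [List.length_eq_zero_iff.1 hn]
    simpa [wordProd] using vermaProj_assocRel ρ hw
  | succ n ih =>
    intro ws hn h w hw
    cases ws with
    | nil => simp at hn
    | cons x ws =>
      have hn' : ws.length = n := by simpa using hn
      have hws : HomogeneousWord ws := fun z hz => h z (List.mem_cons_of_mem _ hz)
      obtain ⟨d, hd⟩ := h x List.mem_cons_self
      rcases le_total 0 d with hd0 | hd0
      · rw [wordProd_cons, mul_smul, vermaProj_smul ρ hd0 hd, ih ws hn' hws w hw, map_zero]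
      · rw [wordProd_cons, uι_mul_wordProd, add_smul, map_add, mul_smul,
          ih ws hn' hws _ (smul_mem_assocRel ρ hd0 hd hw), add_zero]
        have e : vermaProj ρ (adSum x wordProd ws • w) =
            (vermaProj ρ ∘ₗ (LinearMap.toSpanSingleton (UVg g) (Verma ρ) w).restrictScalars ℂ)
              (adSum x wordProd ws) := rfl
        rw [e, ← adSum_map]
        exact adSum_eq_zero hd ws _ hws fun v hv hv' => ih v (hv.trans hn') hv' w hw

theorem mem_span_wordProd (y : UVg g) :
    y ∈ Submodule.span ℂ {z | ∃ ws : List (Vg g), HomogeneousWord ws ∧ z = wordProd ws} := by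
  refine UVg.induction (P := fun y => y ∈ Submodule.span ℂ
    {z | ∃ ws : List (Vg g), HomogeneousWord ws ∧ z = wordProd ws}) y
    (Submodule.subset_span ⟨[], fun x hx => by simp at hx, rfl⟩)
    (fun x y => Submodule.add_mem _) (fun c x => Submodule.smul_mem _ c) (fun x y hy => ?_)
  induction hy using Submodule.span_induction with
  | zero => rw [mul_zero]; exact Submodule.zero_mem _
  | add w w' _ _ h h' => rw [mul_add]; exact Submodule.add_mem _ h h'
  | smul c w _ h => rw [mul_smul_comm]; exact Submodule.smul_mem _ _ h
  | mem y hy =>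
    obtain ⟨ws, hws, rfl⟩ := hy
    refine Vg.homogeneous_induction g (P := fun x => uι g x * wordProd ws ∈ Submodule.span ℂ
      {z | ∃ ws : List (Vg g), HomogeneousWord ws ∧ z = wordProd ws}) x (fun d x hx => ?_)
      (by simp) (fun x x' h h' => by rw [map_add, add_mul]; exact Submodule.add_mem _ h h')
    refine Submodule.subset_span ⟨x :: ws, fun z hz => ?_, (wordProd_cons x ws).symm⟩
    rcases List.mem_cons.1 hz with rfl | hz
    · exact ⟨d, hx⟩
    · exact hws z hz

theorem vermaProj_assocSub {z : Verma ρ} (hz : z ∈ assocSub ρ) : vermaProj ρ z = 0 := by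
  suffices h : ∀ y : UVg g, vermaProj ρ (y • z) = 0 by
    simpa using h 1
  induction hz using Submodule.span_induction with
  | zero => simp
  | add w w' _ _ h h' => intro y; rw [smul_add, map_add, h, h', add_zero]
  | smul c w _ h => intro y; rw [← mul_smul]; exact h _
  | mem w hw =>
    intro y
    induction mem_span_wordProd y using Submodule.span_induction with
    | zero => simp
    | add w w' _ _ h h' => rw [add_smul, map_add, h, h', add_zero]
    | smul c w _ h => rw [smul_assoc, map_smul, h, smul_zero]
    | mem y hy =>
      obtain ⟨ws, hws, rfl⟩ := hy
      exact vermaProj_wordProd ρ _ ws rfl hws w hw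

/-- The projection is the identity on `U` and zero on the submodule divided out. -/
theorem barIn_injective : Function.Injective (barIn ρ) := by
  rw [← LinearMap.ker_eq_bot, LinearMap.ker_eq_bot']
  intro u hu
  have h := vermaProj_assocSub ρ ((Submodule.Quotient.mk_eq_zero _).1 hu)
  rwa [vermaProj_vermaIn] at h

end Vanishing

/-! ### The twisted Jacobi identity and the vacuum on `M̄(U)` -/

section Bar

variable {V : Type*} [AddCommGroup V] [Module ℂ V] [VertexOperatorAlgebra V] {g : FinAut V}
  {U : Type*} [AddCommGroup U] [Module ℂ U] (ρ : AgModule g U)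

theorem bar_induction {P : VermaBar ρ → Prop} (z : VermaBar ρ) (base : ∀ u, P (barIn ρ u))
    (add : ∀ x y, P x → P y → P (x + y)) (smul : ∀ (c : ℂ) x, P x → P (c • x))
    (lie : ∀ (x : Vg g) z, P z → P (uι g x • z)) : P z := by
  obtain ⟨t, rfl⟩ := (assocSub ρ).mkQ_surjective z
  exact verma_induction ρ (P := fun t => P ((assocSub ρ).mkQ t)) t base
    (fun x y hx hy => by rw [map_add]; exact add _ _ hx hy) (fun c x hx => smul c _ hx)
    (fun x z hz => by rw [map_smul]; exact lie _ _ hz)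

theorem isHom_mkQ : IsHom (actY g (Verma ρ)) (barY ρ) ((assocSub ρ).mkQ.restrictScalars ℂ) :=
  fun _ _ _ => rfl

theorem nonpos_smul_barIn {d : ℚ} (hd : d ≤ 0) {x : Vg g} (hx : x ∈ VgDeg g d) (u : U) :
    uι g x • barIn ρ u = barIn ρ (zeroMode ρ x u) :=
  congrArg (assocSub ρ).mkQ (nonpos_smul_vermaIn ρ hd hx u)

theorem assocDefect_barIn {n : ℤ} {m : ℚ} {a : V} (ha : a ∈ wtSpace V n) (ham : a ∈ sector g m)
    (hm : (n : ℚ) - 1 < m) (b : V) (u : U) (l : ℤ) (q : ℚ) :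
    assocDefect (barY ρ) a b (barIn ρ u) l m q = 0 := by
  have h := map_assocDefect (verma_isLocalAction ρ).trunc _ (isHom_mkQ ρ) a b (vermaIn ρ u) l m q
  exact h.symm.trans ((Submodule.Quotient.mk_eq_zero _).2
    (Submodule.subset_span (assocDefect_mem ρ ha ham hm b u l q)))

theorem bar_isLocalAction : IsLocalAction g (barY ρ) where
  trunc v w := by
    obtain ⟨t, rfl⟩ := (assocSub ρ).mkQ_surjective w
    obtain ⟨B, hB⟩ := (verma_isLocalAction ρ).trunc v t
    exact ⟨B, fun l hl => (isHom_mkQ ρ v l t).symm.trans (by rw [hB l hl, map_zero])⟩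
  comm _ _ ha n b J hJ w := actY_comm ha n b J hJ w

theorem md_mem_sector_sub {p q : ℚ} {a b : V} (ha : a ∈ sector g p) (hb : b ∈ sector g q) (j : ℕ) :
    md j a b ∈ sector g (q + p - j) := by
  have := sector_sub_int g (q + p) j
  rw [Int.cast_natCast] at this
  rw [this, add_comm]
  exact md_mem_sector g ha hb _

/-- For homogeneous `a` the relations defining `M̄(U)` give associativity on `U` at a large
exponent, and `IsLocalAction.jacobiDefect_eq_zero_of_assoc` extends this to the Jacobi identity at
every exponent of the same class modulo `ℤ`. -/
theorem barY_jacobiDefect_barIn {m : ℚ} {a : V} (ha : a ∈ sector g m) (b : V) (u : U) (l : ℤ)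
    (n : ℚ) : jacobiDefect (barY ρ) a b (barIn ρ u) l m n = 0 := by
  have hloc := bar_isLocalAction ρ
  rw [← proj_of_mem g ha]
  clear ha
  refine wt_induction (P := fun a => jacobiDefect (barY ρ) (proj g m a) b (barIn ρ u) l m n = 0) a
    (fun k a ha => ?_) (by rw [map_zero, jacobiDefect_zero_left])
    (fun a a' h h' => by rw [map_add, jacobiDefect_add_left hloc.trunc, h, h', add_zero])
  -- Shifting the exponent by `K` brings it above `k - 1`, where the modes of `a` kill `U`. The
  -- shift is undone at the end by taking `j = -K`.
  obtain ⟨K, hK⟩ := exists_nat_gt ((k : ℚ) - 1 - m)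
  have hs : proj g m a ∈ sector g (m + (K : ℤ)) := by
    rw [sector_add_int]; exact proj_mem g m a
  have hw := proj_mem_wtSpace g ha m
  have hlt : (k : ℚ) - 1 < m + (K : ℤ) := by push_cast; linarith
  have h := hloc.jacobiDefect_eq_zero_of_assoc (w := barIn ρ u) (b := b) hs (fun i => by
      have h0 : (k : ℚ) - (m + (K : ℤ) + i) - 1 < 0 := by
        have : (0 : ℚ) ≤ i := Nat.cast_nonneg i
        linarith
      have hv := vmode_mem_VgDeg g hw (m + (K : ℤ) + i)
      refine (nonpos_smul_barIn ρ h0.le hv u).trans ?_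
      rw [zeroMode_of_ne ρ h0.ne hv, LinearMap.zero_apply, map_zero])
    (fun l n => assocDefect_barIn ρ hw hs hlt b u l n) l (-K) n
  rwa [Int.cast_neg, add_neg_cancel_right] at h

/-- The module is generated by `U` under `V[g]`, and the derivation property of the defect passes
the identity from `z` to `c_k z`. The induction runs over all `a`, `b` and exponents at once, as the
Leibniz formula changes them. -/
theorem barY_jacobiDefect (w : VermaBar ρ) : ∀ (m : ℚ) (a : V), a ∈ sector g m →
    ∀ (b : V) (l : ℤ) (n : ℚ), jacobiDefect (barY ρ) a b w l m n = 0 := by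
  have hloc := bar_isLocalAction ρ
  refine bar_induction ρ (P := fun w => ∀ (m : ℚ) (a : V), a ∈ sector g m →
    ∀ (b : V) (l : ℤ) (n : ℚ), jacobiDefect (barY ρ) a b w l m n = 0) w
    (fun u m a ha b l n => barY_jacobiDefect_barIn ρ ha b u l n)
    (fun x y hx hy m a ha b l n => by
      rw [jacobiDefect_add hloc.trunc, hx m a ha, hy m a ha, add_zero])
    (fun c x hx m a ha b l n => by rw [jacobiDefect_smul hloc.trunc, hx m a ha, smul_zero])
    (fun x z hz m a ha b l n => ?_)
  refine Vg.induction g (P := fun x => jacobiDefect (barY ρ) a b (uι g x • z) l m n = 0) x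
    (fun _ k c _ hc => ?_) (by rw [map_zero, zero_smul, jacobiDefect_zero_right])
    (fun x y hx hy => by rw [map_add, add_smul, jacobiDefect_add hloc.trunc, hx, hy, add_zero])
  obtain ⟨M, hM⟩ := hloc.jacobiDefect_leibniz hc a b z l m n
  rw [hz m a ha, map_zero, Finset.sum_eq_zero (fun j _ => by
    rw [hz _ _ (md_mem_sector_sub hc ha j), hz m a ha, add_zero, smul_zero]), add_zero] at hM
  exact hM.symm

theorem vmode_vac_eq_zero {m : ℚ} (hm : m ≠ -1) : vmode g m (vac V) = 0 := by
  have h := vmode_Lm1 g (m + 1) (vac V)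
  rw [Lm1_vac, map_zero, add_sub_cancel_right, eq_comm, smul_eq_zero] at h
  refine h.resolve_left fun h => hm ?_
  have : m + 1 = 0 := by exact_mod_cast neg_eq_zero.1 h
  linarith

theorem vmode_vac_lie (x : Vg g) : ⁅vmode g (-1) (vac V), x⁆ = 0 := by
  refine Vg.induction g (P := fun x => ⁅vmode g (-1) (vac V), x⁆ = 0) x (fun n m a _ _ => ?_)
    (by simp) (fun x y hx hy => by rw [lie_add, hx, hy, add_zero])
  have hs : vac V ∈ sector g (-1) := by
    have := sector_intCast g (-1)
    push_cast at this
    rw [this]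
    exact vac_mem_sector g
  rw [lie_vmode g m hs a 0 (fun i _ => by rw [md_vac_left, if_neg (by omega)])]
  rfl

/-- The element `𝟏(-1)` is central in `V[g]` and acts on the generating space `U` as the unit of
`A_g(V)`. -/
theorem vmode_vac_smul (z : VermaBar ρ) : uι g (vmode g (-1) (vac V)) • z = z := by
  refine bar_induction ρ (P := fun z => uι g (vmode g (-1) (vac V)) • z = z) z (fun u => ?_)
    (fun x y hx hy => by rw [smul_add, hx, hy]) (fun c x hx => by rw [smul_comm, hx])
    (fun x z hz => ?_)
  · have h0 := vac_mem_wtSpace (V := V)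
    have h1 := vmode_mem_VgDeg g h0 (-1)
    have h2 := zeroMode_vmode ρ h0 vac_mem_Vr
    simp only [Int.cast_zero, zero_sub] at h1 h2
    rw [nonpos_smul_barIn ρ (by norm_num) h1, h2, ρ.act_one, Module.End.one_apply]
  · have h := uι_lie (vmode g (-1) (vac V)) x
    rw [vmode_vac_lie, map_zero, eq_comm, sub_eq_zero] at h
    rw [← mul_smul, h, mul_smul, hz]

theorem bar_isWeakTwisted : IsWeakTwisted g (barY ρ) where
  exponents r _ u hu m hm := by
    refine LinearMap.ext fun z => ?_
    change uι g (vmode g m u) • z = 0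
    rw [vmode_eq_zero g hu, map_zero, zero_smul]
    rintro ⟨k, hk⟩
    exact hm ⟨-k, by rw [hk]; push_cast; ring⟩
  truncation := (bar_isLocalAction ρ).trunc
  vacuum m := by
    refine LinearMap.ext fun z => ?_
    change uι g (vmode g m (vac V)) • z = _
    split_ifs with hm
    · rw [hm, vmode_vac_smul, Module.End.one_apply]
    · rw [vmode_vac_eq_zero hm, map_zero, zero_smul, LinearMap.zero_apply]
  jacobi r _ u hu v w l m n hm := by
    have h := barY_jacobiDefect ρ w m u (mem_sector_of_Vr g hu hm) v l n
    rw [jacobiDefect_eq (bar_isLocalAction ρ).trunc, sub_eq_zero] at h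
    exact h.symm

end Bar

/-! ### The grading of `M̄(U)` and admissibility -/

section Grading

variable {V : Type*} [AddCommGroup V] [Module ℂ V] [VertexOperatorAlgebra V] {g : FinAut V}
  {U : Type*} [AddCommGroup U] [Module ℂ U] (ρ : AgModule g U)

theorem vermaGr_le (A : ℚ → Submodule ℂ (Verma ρ)) (h0 : ∀ u, vermaIn ρ u ∈ A 0)
    (hA : ∀ d, ∀ x ∈ VgDeg g d, ∀ q, ∀ z ∈ A q, uι g x • z ∈ A (d + q)) (q : ℚ) :
    vermaGr ρ q ≤ A q := by
  refine Submodule.span_le.2 ?_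
  rintro _ ⟨x, hx, u, rfl⟩
  rw [SetLike.mem_coe]
  induction hx using Submodule.span_induction with
  | zero => rw [zero_smul]; exact Submodule.zero_mem _
  | add x y _ _ hx hy => rw [add_smul]; exact Submodule.add_mem _ hx hy
  | smul c x _ hx => rw [smul_assoc]; exact Submodule.smul_mem _ _ hx
  | mem x hx =>
    obtain ⟨ws, hws, rfl, rfl⟩ := hx
    induction ws with
    | nil => simpa using h0 u
    | cons p ws ih =>
      simp only [List.map_cons, List.prod_cons, List.sum_cons, mul_smul]
      exact hA _ _ (hws p List.mem_cons_self) _ _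
        (ih fun p hp => hws p (List.mem_cons_of_mem _ hp))

theorem uι_mul_mem_uDeg {d q : ℚ} {x : Vg g} (hx : x ∈ VgDeg g d) {y : UVg g} (hy : y ∈ uDeg g q) :
    uι g x * y ∈ uDeg g (d + q) := by
  induction hy using Submodule.span_induction with
  | zero => rw [mul_zero]; exact Submodule.zero_mem _
  | add y y' _ _ h h' => rw [mul_add]; exact Submodule.add_mem _ h h'
  | smul c y _ h => rw [mul_smul_comm]; exact Submodule.smul_mem _ _ h
  | mem y hy =>
    obtain ⟨ws, hws, rfl, rfl⟩ := hy
    exact Submodule.subset_span ⟨(d, x) :: ws, List.forall_mem_cons.2 ⟨hx, hws⟩, by simp, by simp⟩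

theorem vermaIn_mem_vermaGr (u : U) : vermaIn ρ u ∈ vermaGr ρ 0 :=
  Submodule.subset_span ⟨1, Submodule.subset_span ⟨[], by simp⟩, u, (one_smul _ _).symm⟩

theorem smul_mem_vermaGr {d q : ℚ} {x : Vg g} (hx : x ∈ VgDeg g d) {z : Verma ρ}
    (hz : z ∈ vermaGr ρ q) : uι g x • z ∈ vermaGr ρ (d + q) := by
  induction hz using Submodule.span_induction with
  | zero => rw [smul_zero]; exact Submodule.zero_mem _
  | add y y' _ _ h h' => rw [smul_add]; exact Submodule.add_mem _ h h'
  | smul c y _ h => rw [smul_comm]; exact Submodule.smul_mem _ _ h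
  | mem y hy =>
    obtain ⟨y, hy, u, rfl⟩ := hy
    exact Submodule.subset_span ⟨_, uι_mul_mem_uDeg hx hy, u, (mul_smul _ _ _).symm⟩

theorem smul_mem_barGr {d q : ℚ} {x : Vg g} (hx : x ∈ VgDeg g d) {z : VermaBar ρ}
    (hz : z ∈ barGr ρ q) : uι g x • z ∈ barGr ρ (d + q) := by
  obtain ⟨t, ht, rfl⟩ := hz
  exact ⟨uι g x • t, smul_mem_vermaGr ρ hx ht, map_smul (assocSub ρ).mkQ _ _⟩

/-- The vectors `x₁ ⋯ xₖ ⊗ u` of degree `q`, where all `xᵢ` have positive degree. -/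
inductive PosGen : ℚ → Verma ρ → Prop
  | base (u : U) : PosGen 0 (vermaIn ρ u)
  | lie {d q : ℚ} {x : Vg g} {z : Verma ρ} (hd : 0 < d) (hx : x ∈ VgDeg g d) (hz : PosGen q z) :
      PosGen (d + q) (uι g x • z)

/-- The span of the vectors `x₁ ⋯ xₖ ⊗ u` of degree `q`, where all `xᵢ` have positive degree. -/
def posSpan (q : ℚ) : Submodule ℂ (Verma ρ) := Submodule.span ℂ {z | PosGen ρ q z}

theorem pos_smul_mem_posSpan {d q : ℚ} (hd : 0 < d) {x : Vg g} (hx : x ∈ VgDeg g d) {z : Verma ρ}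
    (hz : z ∈ posSpan ρ q) : uι g x • z ∈ posSpan ρ (d + q) := by
  induction hz using Submodule.span_induction with
  | zero => rw [smul_zero]; exact Submodule.zero_mem _
  | add y y' _ _ h h' => rw [smul_add]; exact Submodule.add_mem _ h h'
  | smul c y _ h => rw [smul_comm]; exact Submodule.smul_mem _ _ h
  | mem y hy => exact Submodule.subset_span (PosGen.lie hd hx hy)

/-- The spanning half of the Poincaré–Birkhoff–Witt theorem: a letter of nonpositive degree is
commuted past the positive ones until it reaches `U`. The commutators may have any degree, so the
induction is on the vector with all letters allowed. -/
theorem smul_mem_posSpan_of_posGen {q : ℚ} {z : Verma ρ} (hz : PosGen ρ q z) :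
    ∀ d, ∀ x ∈ VgDeg g d, uι g x • z ∈ posSpan ρ (d + q) := by
  induction hz with
  | base u =>
    intro d x hx
    rcases lt_trichotomy d 0 with hd | rfl | hd
    · rw [neg_smul_vermaIn ρ hd hx]; exact Submodule.zero_mem _
    · rw [zero_smul_vermaIn ρ hx, add_zero]
      exact Submodule.subset_span (PosGen.base _)
    · exact Submodule.subset_span (PosGen.lie hd hx (PosGen.base u))
  | @lie e q y z he hy hz ih =>
    intro d x hx
    rcases lt_or_ge 0 d with hd | hd
    · exact Submodule.subset_span (PosGen.lie hd hx (PosGen.lie he hy hz))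
    · have h : uι g x • uι g y • z = uι g y • uι g x • z + uι g ⁅x, y⁆ • z := by
        rw [uι_lie, sub_smul, mul_smul, mul_smul]; abel
      rw [h]
      refine Submodule.add_mem _ ?_ ?_
      · rw [add_left_comm]
        exact pos_smul_mem_posSpan ρ he hy (ih d x hx)
      · rw [← add_assoc]
        exact ih _ _ (lie_mem_VgDeg g hx hy)

theorem vermaGr_le_posSpan (q : ℚ) : vermaGr ρ q ≤ posSpan ρ q := by
  refine vermaGr_le ρ _ (fun u => Submodule.subset_span (PosGen.base u)) (fun d x hx q z hz => ?_) q
  induction hz using Submodule.span_induction with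
  | zero => rw [smul_zero]; exact Submodule.zero_mem _
  | add y y' _ _ h h' => rw [smul_add]; exact Submodule.add_mem _ h h'
  | smul c y _ h => rw [smul_comm]; exact Submodule.smul_mem _ _ h
  | mem y hy => exact smul_mem_posSpan_of_posGen ρ hy d x hx

theorem PosGen.nonneg {q : ℚ} {z : Verma ρ} (hz : PosGen ρ q z) :
    0 ≤ q ∧ (q = 0 → z ∈ LinearMap.range (vermaIn ρ)) := by
  induction hz with
  | base u => exact ⟨le_rfl, fun _ => ⟨u, rfl⟩⟩
  | lie hd _ _ ih => exact ⟨by linarith [ih.1], fun h => by linarith [ih.1]⟩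

theorem PosGen.support {q : ℚ} {z : Verma ρ} (hz : PosGen ρ q z) :
    (∃ k : ℕ, q = k / g.T) ∨ z = 0 := by
  have hT : (0 : ℚ) < g.T := by exact_mod_cast g.T_pos
  induction hz with
  | base u => exact Or.inl ⟨0, by simp⟩
  | @lie d q x z hd hx _ ih =>
    rcases ih with ⟨k, rfl⟩ | rfl
    · by_cases h : ∃ j : ℤ, d = j / g.T
      · obtain ⟨j, rfl⟩ := h
        have hj : 0 < j := by exact_mod_cast (div_pos_iff_of_pos_right hT).1 hd
        obtain ⟨i, rfl⟩ := Int.eq_ofNat_of_zero_le hj.le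
        exact Or.inl ⟨i + k, by push_cast; ring⟩
      · rw [VgDeg_eq_bot g h, Submodule.mem_bot] at hx
        exact Or.inr (by rw [hx, map_zero, zero_smul])
    · exact Or.inr (smul_zero _)

theorem barGr_eq_bot {q : ℚ} (hq : ¬ ∃ k : ℕ, q = k / g.T) : barGr ρ q = ⊥ := by
  have h : vermaGr ρ q = ⊥ := by
    rw [eq_bot_iff]
    refine (vermaGr_le_posSpan ρ q).trans (Submodule.span_le.2 fun z hz => ?_)
    exact (PosGen.support ρ hz).resolve_left hq
  rw [barGr, h, Submodule.map_bot]

/-- A product of letters of positive degree has total degree zero only if it is empty. -/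
theorem range_barIn : LinearMap.range (barIn ρ) = barGr ρ 0 := by
  apply le_antisymm
  · rintro _ ⟨u, rfl⟩
    exact ⟨_, vermaIn_mem_vermaGr ρ u, rfl⟩
  · have h : vermaGr ρ 0 ≤ LinearMap.range (vermaIn ρ) :=
      (vermaGr_le_posSpan ρ 0).trans (Submodule.span_le.2 fun z hz => (PosGen.nonneg ρ hz).2 rfl)
    rw [barIn, LinearMap.range_comp]
    exact Submodule.map_mono h

theorem iSup_barGr : ⨆ q, barGr ρ q = ⊤ := by
  rw [eq_top_iff]
  intro z _
  refine bar_induction ρ (P := fun z => z ∈ ⨆ q, barGr ρ q) z (fun u => ?_)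
    (fun x y => Submodule.add_mem _) (fun c x => Submodule.smul_mem _ c) (fun x z hz => ?_)
  · refine Submodule.mem_iSup_of_mem 0 ?_
    rw [← range_barIn]
    exact ⟨u, rfl⟩
  · induction hz using Submodule.iSup_induction' with
    | zero => rw [smul_zero]; exact Submodule.zero_mem _
    | add y y' _ _ h h' => rw [smul_add]; exact Submodule.add_mem _ h h'
    | mem q z hz =>
      exact Vg.homogeneous_induction g (P := fun x => uι g x • z ∈ ⨆ q, barGr ρ q) x
        (fun d x hx => Submodule.mem_iSup_of_mem _ (smul_mem_barGr ρ hx hz))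
        (by rw [map_zero, zero_smul]; exact Submodule.zero_mem _)
        (fun x y hx hy => by rw [map_add, add_smul]; exact Submodule.add_mem _ hx hy)

/-- The universal property of `M̄(U)` with respect to representations of `V[g]`. -/
theorem exists_barLift {N : Type*} [AddCommGroup N] [Module ℂ N]
    (θ : UVg g →ₐ[ℂ] Module.End ℂ N) (φ : U →ₗ[ℂ] N)
    (hneg : ∀ d < 0, ∀ x ∈ VgDeg g d, ∀ u, θ (uι g x) (φ u) = 0)
    (hzero : ∀ x ∈ VgDeg g 0, ∀ u, θ (uι g x) (φ u) = φ (zeroMode ρ x u))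
    {Y : V →ₗ[ℂ] ℚ → Module.End ℂ N} (hY : ∀ v m, θ (uι g (vmode g m v)) = Y v m)
    (hass : ∀ (n : ℤ) (r : ℕ) (a b : V) (u : U) (l : ℤ) (q : ℚ), r < g.T → a ∈ wtSpace V n →
      a ∈ Vr g r → assocDefect Y a b (φ u) l (cexp g n r) q = 0) :
    ∃ f : VermaBar ρ →ₗ[ℂ] N, (∀ x z, f (x • z) = θ x (f z)) ∧ ∀ u, f (barIn ρ u) = φ u := by
  obtain ⟨f, hf, hφ⟩ := exists_vermaLift ρ θ φ hneg hzero
  let _ : Module (UVg g) N := Module.compHom N θ.toRingHom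
  have hs : ∀ (x : UVg g) (w : N), x • w = θ x w := fun _ _ => rfl
  have : IsScalarTower ℂ (UVg g) N := ⟨fun c x w => by rw [hs, hs, map_smul]; rfl⟩
  let F : Verma ρ →ₗ[UVg g] N := { toFun := f, map_add' := map_add f, map_smul' := hf }
  have hhom : IsHom (actY g (Verma ρ)) Y f := fun v m w => by
    rw [actY_apply, hf, hY]
  have hk : assocSub ρ ≤ LinearMap.ker F := by
    refine Submodule.span_le.2 fun z hz => ?_
    change f z = 0
    induction hz using Submodule.span_induction with
    | zero => exact map_zero _
    | add w w' _ _ h h' => rw [map_add, h, h', add_zero]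
    | smul c w _ h => rw [map_smul, h, smul_zero]
    | mem w hw =>
      obtain ⟨n, r, a, b, u, α, β, hr, ha, har, rfl⟩ := hw
      rw [assocCoeff_eq, map_assocDefect (verma_isLocalAction ρ).trunc f hhom, hφ]
      exact hass n r a b u _ _ hr ha har
  exact ⟨((assocSub ρ).liftQ F hk).restrictScalars ℂ,
    fun x z => ((assocSub ρ).liftQ F hk).map_smul x z, hφ⟩

theorem eul_mem_VgDeg : eul g ∈ VgDeg g 0 := by
  have h := vmode_mem_VgDeg g (conf_mem_wtSpace (V := V)) 1
  norm_num at h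
  exact h

/-- The operator `ω(1)` has the right commutators with `V[g]`, but it acts on `U` as `ω` in
`A_g(V)`, not as zero. This action commutes with `V[g]_0`, since `ω(1)` does, so it extends to an
endomorphism of the module `M̄(U)`, which is subtracted. -/
theorem exists_degree_operator : ∃ D : Module.End ℂ (VermaBar ρ), (∀ u, D (barIn ρ u) = 0) ∧
    ∀ d, ∀ x ∈ VgDeg g d, ∀ z, D (uι g x • z) = uι g x • D z + (d : ℂ) • uι g x • z := by
  have he := eul_mem_VgDeg (g := g)
  -- The universal property is applied with `M̄(U)` itself as target; the relations hold there
  -- because the image of `U` again lies in `U`.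
  obtain ⟨f, hf, hf'⟩ := exists_barLift ρ (Algebra.lsmul ℂ ℂ (VermaBar ρ))
    (barIn ρ ∘ₗ zeroMode ρ (eul g))
    (fun d hd x hx u => (nonpos_smul_barIn ρ hd.le hx _).trans (by
      rw [zeroMode_of_ne ρ hd.ne hx, LinearMap.zero_apply, map_zero]))
    (fun x hx u => (nonpos_smul_barIn ρ le_rfl hx _).trans (by
      have h := zeroMode_lie_zero ρ he hx
      rw [eul_lie g hx, Rat.cast_zero, zero_smul, map_zero, eq_comm, sub_eq_zero] at h
      exact congrArg (barIn ρ) (LinearMap.congr_fun h u).symm))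
    (Y := barY ρ) (fun _ _ => rfl) (fun n r a b u l q hr ha har =>
      assocDefect_barIn ρ ha (mem_sector_of_Vr g har ⟨_, cexp_eq⟩) lt_cexp_add_one b _ l q)
  refine ⟨Algebra.lsmul ℂ ℂ (VermaBar ρ) (uι g (eul g)) - f, fun u => ?_, fun d x hx z => ?_⟩
  · rw [LinearMap.sub_apply, hf', sub_eq_zero]
    exact nonpos_smul_barIn ρ le_rfl he u
  · have h := uι_lie (eul g) x
    rw [eul_lie g hx, map_smul, eq_sub_iff_add_eq] at h
    have h' := congrArg (fun y => y • z) h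
    simp only [add_smul, mul_smul, smul_assoc] at h'
    simp only [LinearMap.sub_apply, hf, Algebra.lsmul_coe, smul_sub, ← h']
    abel

theorem barGr_isInternal : DirectSum.IsInternal (barGr ρ) := by
  obtain ⟨D, hD, hD'⟩ := exists_degree_operator ρ
  refine DirectSum.isInternal_submodule_of_iSupIndep_of_iSup_eq_top
    (iSupIndep_of_le_eigenspace D _ fun q => ?_) (iSup_barGr ρ)
  rw [barGr, Submodule.map_le_iff_le_comap]
  refine vermaGr_le ρ (fun q => (D.eigenspace (q : ℂ)).comap
    ((assocSub ρ).mkQ.restrictScalars ℂ)) (fun u => ?_) (fun d x hx q z hz => ?_) q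
  · rw [Submodule.mem_comap, Module.End.mem_eigenspace_iff, Rat.cast_zero, zero_smul]
    exact hD u
  · rw [Submodule.mem_comap, Module.End.mem_eigenspace_iff] at hz ⊢
    have h := hD' d x hx ((assocSub ρ).mkQ z)
    refine h.trans ?_
    have hz' : D ((assocSub ρ).mkQ z) = (q : ℂ) • (assocSub ρ).mkQ z := hz
    rw [hz', Rat.cast_add, add_smul, smul_comm, add_comm]
    rfl

theorem bar_isAdmissible : IsAdmissible g (barY ρ) (barGr ρ) where
  weak := bar_isWeakTwisted ρ
  internal := barGr_isInternal ρ
  support _ hq := barGr_eq_bot ρ hq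
  degree n v hv m q x hx := by
    have h := smul_mem_barGr ρ (vmode_mem_VgDeg g hv m) hx
    rwa [show (n : ℚ) - m - 1 + q = q + n - m - 1 by ring] at h

theorem barIn_isAgHom : IsAgHom ρ (barY ρ) (barIn ρ) where
  mem_Omega u n v hv m hm := (nonpos_smul_barIn ρ hm.le (vmode_mem_VgDeg g hv m) u).trans (by
    rw [zeroMode_of_ne ρ hm.ne (vmode_mem_VgDeg g hv m), LinearMap.zero_apply, map_zero])
  map_act n a ha ha0 u := by
    have h := vmode_mem_VgDeg g ha ((n : ℚ) - 1)
    rw [← zeroMode_vmode ρ ha ha0]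
    exact (nonpos_smul_barIn ρ (by linarith) h u).symm

end Grading

/-! ### Weak twisted modules and the universal property -/

section WeakModules

variable {V : Type*} [AddCommGroup V] [Module ℂ V] [VertexOperatorAlgebra V] {g : FinAut V}
  {M : Type*} [AddCommGroup M] [Module ℂ M] {Y : V →ₗ[ℂ] ℚ → Module.End ℂ M}

theorem IsWeakTwisted.jacobiDefect_eq_zero (h : IsWeakTwisted g Y) {m : ℚ} {a : V}
    (ha : a ∈ sector g m) (b : V) (w : M) (l : ℤ) (n : ℚ) : jacobiDefect Y a b w l m n = 0 := by
  rcases sector_cases g ha with rfl | ⟨r, hr, har, hk⟩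
  · exact jacobiDefect_zero_left b w l m n
  · rw [jacobiDefect_eq h.truncation, sub_eq_zero]
    exact (h.jacobi r hr a har b w l m n hk).symm

theorem IsWeakTwisted.isLocalAction (h : IsWeakTwisted g Y) : IsLocalAction g Y where
  trunc := h.truncation
  comm m a ha n b J hJ w := by
    have hd := h.jacobiDefect_eq_zero ha b w 0 n
    rw [jacobiDefect, prodSum_zero_left, prodSum_zero_left, zpow_zero, one_smul, sub_eq_zero] at hd
    refine hd.trans ?_
    unfold iterSum iterFun
    rw [finsum_eq_range _ J]
    · simp only [zero_add]
    · intro i hi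
      rw [zero_add, hJ i hi]; simp

theorem IsWeakTwisted.map_proj (h : IsWeakTwisted g Y) (m : ℚ) (a : V) :
    Y (proj g m a) m = Y a m := by
  refine homogeneous_induction g (P := fun a => Y (proj g m a) m = Y a m) a
    (fun n r hr a _ ha => ?_) (by simp)
    (fun a b h h' => by simp only [map_add, Pi.add_apply, h, h'])
  by_cases hm : ∃ k : ℤ, m = r / g.T + k
  · rw [proj_of_mem g (mem_sector_of_Vr g ha hm)]
  · rw [proj_eq_zero g ha, h.exponents r hr a ha m hm, map_zero, Pi.zero_apply]
    rintro ⟨k, hk⟩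
    exact hm ⟨-k, by rw [hk]; push_cast; ring⟩

/-- The Jacobi identity with the vacuum as second vector and `l = -2`, `n = 0`. On the iterate side
only `a_{-2} 𝟏 = L(-1)a` and `a_{-1} 𝟏 = a` occur, and on the product side the index `-1` of the
vacuum is never reached. -/
theorem IsWeakTwisted.map_Lm1 (h : IsWeakTwisted g Y) (m : ℚ) (a : V) :
    Y (Lm1 V a) m = (-(m : ℂ)) • Y a (m - 1) := by
  refine homogeneous_induction g (P := fun a => Y (Lm1 V a) m = (-(m : ℂ)) • Y a (m - 1)) a
    (fun n r hr a _ ha => ?_) (by simp)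
    (fun a b h h' => by simp only [map_add, Pi.add_apply, h, h', smul_add])
  by_cases hm : ∃ k : ℤ, m = r / g.T + k
  · ext w
    have hj := h.jacobi r hr a ha (vac V) w (-2) m 0 hm
    rw [finsum_eq_range _ 2, finsum_eq_zero_of_forall_eq_zero] at hj
    · simp only [Finset.sum_range_succ, Finset.range_zero, Finset.sum_empty, zero_add,
        bin_zero_right, one_smul, bin_one_right, Nat.cast_zero, Nat.cast_one, add_zero, sub_zero,
        md_neg_two_vac] at hj
      rw [show (-2 + 1 : ℤ) = -1 by norm_num, md_neg_one_vac] at hj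
      rw [LinearMap.smul_apply, neg_smul]
      exact eq_neg_of_add_eq_zero_left hj
    · intro i
      have hi : (0 : ℚ) ≤ i := Nat.cast_nonneg i
      rw [h.vacuum, h.vacuum, if_neg (by linarith), if_neg (by push_cast; linarith)]
      simp
    · intro i hi
      rw [md_nonneg_vac a (by omega)]
      simp
  · rw [h.exponents r hr a ha (m - 1) (by
        rintro ⟨k, hk⟩
        exact hm ⟨k + 1, by push_cast; linear_combination hk⟩), smul_zero]
    exact h.exponents r hr _ (Lm1_mem_sector g ha) m hm

theorem IsWeakTwisted.actLoop_loopD (h : IsWeakTwisted g Y) (x : Loop V) :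
    actLoop Y (loopD V x) = 0 := by
  induction x using Finsupp.induction_linear with
  | zero => simp
  | add x y hx hy => rw [map_add, map_add, hx, hy, add_zero]
  | single q a =>
    rw [loopD_single, map_add, map_smul, actLoop_single, actLoop_single, h.map_Lm1]
    module

/-- A weak `g`-twisted module is a module for the Lie algebra `V[g]`. -/
theorem IsWeakTwisted.exists_algHom (h : IsWeakTwisted g Y) :
    ∃ θ : UVg g →ₐ[ℂ] Module.End ℂ M, ∀ v m, θ (uι g (vmode g m v)) = Y v m := by
  let τ : Vg g →ₗ[ℂ] Module.End ℂ M :=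
    Submodule.liftQ _ (actLoop Y ∘ₗ (twLoop g).subtype) (by
      rintro _ ⟨x, rfl⟩
      exact h.actLoop_loopD x.1)
  have hτ : ∀ v m, τ (vmode g m v) = Y v m := fun v m => by
    rw [← h.map_proj]
    exact actLoop_single m (proj g m v)
  have hlie : ∀ x y, τ ⁅x, y⁆ = τ x * τ y - τ y * τ x := fun x y => by
    refine Vg.induction g (P := fun x => τ ⁅x, y⁆ = τ x * τ y - τ y * τ x) x
      (fun n p a _ ha => ?_) (by simp)
      (fun x x' h h' => by rw [add_lie, map_add, h, h', map_add]; noncomm_ring)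
    refine Vg.induction g (P := fun y => τ ⁅vmode g p a, y⁆ =
      τ (vmode g p a) * τ y - τ y * τ (vmode g p a)) y (fun _ q b _ _ => ?_) (by simp)
      (fun x x' h h' => by rw [lie_add, map_add, h, h', map_add]; noncomm_ring)
    obtain ⟨J, hJ⟩ := exists_trunc a b
    have hJ' : ∀ i : ℕ, J ≤ i → md i a b = 0 := fun i hi => hJ _ (by omega)
    ext w
    have hc := h.isLocalAction.comm p a ha q b J hJ' w
    rw [lie_vmode g q ha b J hJ', map_sum, hτ, hτ, LinearMap.sub_apply, Module.End.mul_apply,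
      Module.End.mul_apply, hc, LinearMap.sum_apply]
    simp only [map_smul, hτ, LinearMap.smul_apply]
  obtain ⟨θ, hθ⟩ := TwistedVOA.exists_algHom τ hlie
  exact ⟨θ, fun v m => (hθ _).trans (hτ v m)⟩

variable {U : Type*} [AddCommGroup U] [Module ℂ U] (ρ : AgModule g U)

/-- The map exists because `M` is a `V[g]`-module in which the vectors of `φ(U)` satisfy the
relations of both `M(U)` and `W`. It is unique because `U` generates `M̄(U)` under the operators
`a(m)`. -/
theorem bar_universal (h : IsWeakTwisted g Y) {φ : U →ₗ[ℂ] M} (hφ : IsAgHom ρ Y φ) :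
    ∃! f : VermaBar ρ →ₗ[ℂ] M, IsHom (barY ρ) Y f ∧ ∀ u : U, f (barIn ρ u) = φ u := by
  obtain ⟨θ, hθ⟩ := h.exists_algHom
  have hneg : ∀ d < 0, ∀ x ∈ VgDeg g d, ∀ u, θ (uι g x) (φ u) = 0 := fun d hd x hx u => by
    induction hx using Submodule.span_induction with
    | zero => simp
    | add x y _ _ hx hy => rw [map_add, map_add, LinearMap.add_apply, hx, hy, add_zero]
    | smul c x _ hx => rw [map_smul, map_smul, LinearMap.smul_apply, hx, smul_zero]
    | mem x hx =>
      obtain ⟨n, m, a, ha, _, rfl, rfl⟩ := hx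
      rw [hθ]
      exact hφ.mem_Omega u n a ha m hd
  have hzero : ∀ x ∈ VgDeg g 0, ∀ u, θ (uι g x) (φ u) = φ (zeroMode ρ x u) := fun x hx u => by
    refine exists_of_mem_VgDeg_zero (P := fun x => θ (uι g x) (φ u) = φ (zeroMode ρ x u)) hx
      (fun n a ha ha0 => ?_) (by simp)
      (fun x y hx hy => by simp only [map_add, LinearMap.add_apply, hx, hy])
      (fun c x hx => by simp only [map_smul, LinearMap.smul_apply, hx])
    rw [hθ, zeroMode_vmode ρ ha ha0, hφ.map_act n a ha ha0]
  have hass : ∀ (n : ℤ) (r : ℕ) (a b : V) (u : U) (l : ℤ) (q : ℚ), r < g.T → a ∈ wtSpace V n →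
      a ∈ Vr g r → assocDefect Y a b (φ u) l (cexp g n r) q = 0 := fun n r a b u l q _ ha har => by
    -- On `φ(U) ⊆ Ω(M)` the modes of `a` from the exponent `cexp g n r` on vanish, so associativity
    -- there is a case of the Jacobi identity of `M`.
    rw [← jacobiDefect_eq_assocDefect]
    · exact h.jacobiDefect_eq_zero (mem_sector_of_Vr g har ⟨_, cexp_eq⟩) b _ l q
    · intro i
      refine hφ.mem_Omega u n a ha _ ?_
      have := lt_cexp_add_one (g := g) (n := n) (r := r)
      have : (0 : ℚ) ≤ i := Nat.cast_nonneg i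
      linarith
  obtain ⟨f, hf, hf'⟩ := exists_barLift ρ θ φ hneg hzero hθ hass
  refine ⟨f, ⟨fun v m z => ?_, hf'⟩, fun f' hf'' => ?_⟩
  · exact (hf _ z).trans (LinearMap.congr_fun (hθ v m) _)
  · refine LinearMap.ext fun z => ?_
    refine bar_induction ρ (P := fun z => f' z = f z) z (fun u => by rw [hf''.2, hf'])
      (fun x y hx hy => by rw [map_add, map_add, hx, hy])
      (fun c x hx => by rw [map_smul, map_smul, hx]) (fun x z hz => ?_)
    refine Vg.induction g (P := fun x => f' (uι g x • z) = f (uι g x • z)) x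
      (fun n m a _ _ => ?_) (by simp)
      (fun x y hx hy => by rw [map_add, add_smul, map_add, map_add, hx, hy])
    refine (hf''.1 a m z).trans ?_
    rw [hf, hθ, hz]

end WeakModules

end TwistedVOA

end

open TwistedVOA

theorem theorem6p1 {V : Type*} [AddCommGroup V] [Module ℂ V] [VertexOperatorAlgebra V]
    (g : FinAut V) {U : Type*} [AddCommGroup U] [Module ℂ U] (ρ : AgModule g U) :
    IsAdmissible g (barY ρ) (barGr ρ) ∧
    (Function.Injective (barIn ρ) ∧ LinearMap.range (barIn ρ) = barGr ρ 0 ∧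
      IsAgHom ρ (barY ρ) (barIn ρ)) ∧
    ∀ (M : Type*) [AddCommGroup M] [Module ℂ M] (Y : V →ₗ[ℂ] ℚ → Module.End ℂ M),
      IsWeakTwisted g Y →
      ∀ φ : U →ₗ[ℂ] M, IsAgHom ρ Y φ →
        ∃! f : VermaBar ρ →ₗ[ℂ] M,
          IsHom (barY ρ) Y f ∧ ∀ u : U, f (barIn ρ u) = φ u := by
  exact ⟨bar_isAdmissible ρ, ⟨barIn_injective ρ, range_barIn ρ, barIn_isAgHom ρ⟩,
    fun _ _ _ _ hY _ hφ => bar_universal ρ hY hφ⟩
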